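/- Let $\mathrm{O}_n$ be the orthogonal group of Euclidean space $\mathbb{R}^n$. An element of $\mathrm{O}_n$ is a *reflection* (*rotation*) if its fixed point subspace has codimension one (two). A *reflection group* is a finite subgroup of $\mathrm{O}_n$ generated by reflections; a *reflection-rotation group* is a finite subgroup of $\mathrm{O}_n$ generated by reflections and rotations. For a finite $G<\mathrm{O}_n$, the orbit space $\mathbb{R}^n/G$ carries the unique PL structure for which the projection $\mathbb{R}^n\to\mathbb{R}^n/G$ is piecewise linear. We say that *the main theorem holds for $G$* if this PL structure exists and the following is true: $\mathbb{R}^n/G$ is a PL $n$-manifold with (possibly empty) boundary if and only if $G$ is a reflection-rotation group, and in this case either $\mathbb{R}^n/G$ is PL homeomorphic to the half space $\mathbb{R}^{n-1}\times\mathbb{R}_{\ge 0}$ and $G$ contains a reflection, or $\mathbb{R}^n/G$ is PL homeomorphic to $\mathbb{R}^n$ and $G$ contains no reflection. We say that *the PL linearization principle can be applied to $H\triangleleft G$* if $H$ is a normal subgroup of $G<\mathrm{O}_n$ and there are a PL homeomorphism $F:\mathbb{R}^n/H\to\mathbb{R}^n$ and a homomorphism $r:G\to\mathrm{O}_n$ with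 kernel $H$ such that $F(g\cdot\bar x)=r(g)F(\bar x)$ for all $g\in G$ and $\bar x\in\mathbb{R}^n/H$. Let $W<\mathrm{O}_n$ be a reflection group and let $W^{+}$ be its subgroup of elements of determinant one. Then the main theorem holds for $W$ and for $W^+$, and the PL linearization principle can be applied to $W^+\triangleleft W$. Let moreover $h\in\mathrm{O}_n\setminus W$ be a rotation that normalizes $W$, put $W^{\times}=\langle W,h\rangle$ and $W^{\oplus}=\langle W^{+},h\rangle$, and assume that $W^\times$ is finite (this is automatic if $W$ fixes no nonzero vector). Then the main theorem holds for $W^{\oplus}$ and for $W^{\times}$, and the PL linearization principle can be applied to $W^{+}\triangleleft W^{\times}$ and to $W^{\oplus}\triangleleft W^{\times}$. In particular, for every $n$ the PL linearization principle can be applied to $W^{+}(\mathrm{D}_n)\triangleleft W(\mathrm{BC}_n)$, where $W(\mathrm{D}_n)$ is generated by the reflections in the hyperplanes orthogonal to the vectors $e_i\pm e_j$, $i\neq j$, and $W(\mathrm{BC}_n)$ is generated by these and the reflections in the coordinate hyperplanes $e_i^{\perp}$. -/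

import Mathlib

noncomputable section

open Set Topology

namespace PLQuot

/-! ### Polyhedra -/

section Polyhedra

variable {E F : Type*} [NormedAddCommGroup E] [NormedSpace ℝ E]
  [NormedAddCommGroup F] [NormedSpace ℝ F]

/-- A subset `P` is a polyhedron if every point of `P` has a neighbourhood in `P` that is a union
of finitely many simplices contained in `P`. -/
def IsPolyhedron (P : Set E) : Prop :=
  ∀ x ∈ P, ∃ T : Finset (Finset E),
    (∀ s ∈ T, AffineIndependent ℝ ((↑) : s → E) ∧ convexHull ℝ (s : Set E) ⊆ P) ∧
    (⋃ s ∈ T, convexHull ℝ (s : Set E)) ∈ 𝓝[P] x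

/-- Finite unions of convex hulls of finite sets; by `isFinUnion_iff` these are precisely the
compact polyhedra. -/
def IsFinUnion (P : Set E) : Prop :=
  ∃ T : Finset (Finset E), P = ⋃ s ∈ T, convexHull ℝ (s : Set E)

theorem isFinUnion_iUnion {ι : Type*} (I : Finset ι) (Q : ι → Set E)
    (h : ∀ i ∈ I, IsFinUnion (Q i)) : IsFinUnion (⋃ i ∈ I, Q i) := by
  classical
  choose! T hT using h
  refine ⟨I.biUnion T, ?_⟩
  ext x
  simp only [mem_iUnion, Finset.mem_biUnion]
  constructor
  · rintro ⟨i, hi, hx⟩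
    rw [hT i hi] at hx
    simp only [mem_iUnion] at hx
    obtain ⟨s, hs, hx⟩ := hx
    exact ⟨s, ⟨i, hi, hs⟩, hx⟩
  · rintro ⟨s, ⟨i, hi, hs⟩, hx⟩
    refine ⟨i, hi, ?_⟩
    rw [hT i hi]
    simp only [mem_iUnion]
    exact ⟨s, hs, hx⟩

theorem isFinUnion_convexHull {S : Set E} (hS : S.Finite) : IsFinUnion (convexHull ℝ S) :=
  ⟨{hS.toFinset}, by simp⟩

theorem IsFinUnion.exists_simplices {P : Set E} (h : IsFinUnion P) :
    ∃ T : Finset (Finset E), (∀ s ∈ T, AffineIndependent ℝ ((↑) : s → E)) ∧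
      P = ⋃ s ∈ T, convexHull ℝ (s : Set E) := by
  classical
  obtain ⟨T, rfl⟩ := h
  refine ⟨T.biUnion fun s => s.powerset.filter fun t => AffineIndependent ℝ ((↑) : t → E),
    ?_, ?_⟩
  · intro s hs
    simp only [Finset.mem_biUnion, Finset.mem_filter] at hs
    obtain ⟨_, _, _, h⟩ := hs
    exact h
  · ext x
    simp only [mem_iUnion, Finset.mem_biUnion, Finset.mem_filter, Finset.mem_powerset]
    constructor
    · rintro ⟨s, hs, hx⟩
      rw [convexHull_eq_union] at hx
      simp only [mem_iUnion] at hx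
      obtain ⟨t, hts, hti, hx⟩ := hx
      exact ⟨t, ⟨s, hs, by exact_mod_cast hts, hti⟩, hx⟩
    · rintro ⟨t, ⟨s, hs, hts, _⟩, hx⟩
      exact ⟨s, hs, convexHull_mono (by exact_mod_cast hts) hx⟩

theorem isPolyhedron_of_local {P : Set E}
    (h : ∀ x ∈ P, ∃ Q, IsFinUnion Q ∧ Q ⊆ P ∧ Q ∈ 𝓝[P] x) : IsPolyhedron P := by
  intro x hx
  obtain ⟨Q, hQ, hQP, hn⟩ := h x hx
  obtain ⟨T, hT, rfl⟩ := hQ.exists_simplices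
  exact ⟨T, fun s hs => ⟨hT s hs, (subset_biUnion_of_mem (u := fun s : Finset E =>
    convexHull ℝ (s : Set E)) hs).trans hQP⟩, hn⟩

theorem IsPolyhedron.local {P : Set E} (h : IsPolyhedron P) :
    ∀ x ∈ P, ∃ Q, IsFinUnion Q ∧ Q ⊆ P ∧ Q ∈ 𝓝[P] x := by
  intro x hx
  obtain ⟨T, hT, hn⟩ := h x hx
  exact ⟨_, ⟨T, rfl⟩, iUnion₂_subset fun s hs => (hT s hs).2, hn⟩

theorem IsFinUnion.isCompact {P : Set E} (h : IsFinUnion P) : IsCompact P := by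
  obtain ⟨T, rfl⟩ := h
  exact T.isCompact_biUnion fun s _ => s.finite_toSet.isCompact_convexHull ℝ

theorem IsFinUnion.isPolyhedron {P : Set E} (h : IsFinUnion P) : IsPolyhedron P :=
  isPolyhedron_of_local fun _ _ => ⟨P, h, Subset.rfl, self_mem_nhdsWithin⟩

/-- A compact subset of a polyhedron lies in a compact polyhedron inside it. -/
theorem IsPolyhedron.exists_finUnion {P K : Set E} (hP : IsPolyhedron P) (hK : IsCompact K)
    (hKP : K ⊆ P) : ∃ Q, IsFinUnion Q ∧ K ⊆ Q ∧ Q ⊆ P := by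
  classical
  have := hP.local
  choose! Q hQ hQP hn using this
  obtain ⟨t, ht, htK⟩ := hK.elim_nhdsWithin_subcover Q
    fun x hx => nhdsWithin_mono x hKP (hn x (hKP hx))
  exact ⟨⋃ x ∈ t, Q x, isFinUnion_iUnion t Q fun x hx => hQ x (hKP (ht x hx)), htK,
    iUnion₂_subset fun x hx => hQP x (hKP (ht x hx))⟩

theorem isFinUnion_iff {P : Set E} : IsFinUnion P ↔ IsCompact P ∧ IsPolyhedron P := by
  refine ⟨fun h => ⟨h.isCompact, h.isPolyhedron⟩, fun ⟨hc, hp⟩ => ?_⟩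
  obtain ⟨Q, hQ, h1, h2⟩ := hp.exists_finUnion hc Subset.rfl
  rwa [h1.antisymm h2]

theorem IsFinUnion.image {P : Set E} (h : IsFinUnion P) (f : E →ₗ[ℝ] F) :
    IsFinUnion (f '' P) := by
  obtain ⟨T, rfl⟩ := h
  rw [image_iUnion₂]
  refine isFinUnion_iUnion T _ fun s _ => ?_
  rw [f.image_convexHull]
  exact isFinUnion_convexHull (s.finite_toSet.image f)

theorem IsFinUnion.prod {P : Set E} {Q : Set F} (hP : IsFinUnion P) (hQ : IsFinUnion Q) :
    IsFinUnion (P ×ˢ Q) := by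
  obtain ⟨T, rfl⟩ := hP
  obtain ⟨U, rfl⟩ := hQ
  have : (⋃ s ∈ T, convexHull ℝ (s : Set E)) ×ˢ (⋃ s ∈ U, convexHull ℝ (s : Set F)) =
      ⋃ i ∈ T ×ˢ U, convexHull ℝ ((i.1 : Set E) ×ˢ (i.2 : Set F)) := by
    ext x
    simp only [mem_prod, mem_iUnion, Finset.mem_product, convexHull_prod, Prod.exists]
    constructor
    · rintro ⟨⟨s, hs, h1⟩, ⟨t, ht, h2⟩⟩
      exact ⟨s, t, ⟨hs, ht⟩, h1, h2⟩
    · rintro ⟨s, t, ⟨hs, ht⟩, h1, h2⟩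
      exact ⟨⟨s, hs, h1⟩, ⟨t, ht, h2⟩⟩
  rw [this]
  exact isFinUnion_iUnion _ _ fun i _ =>
    isFinUnion_convexHull (i.1.finite_toSet.prod i.2.finite_toSet)

theorem finite_extremePoints_stdSimplex_inter {ι : Type*} [Fintype ι]
    (A : (ι → ℝ) →ₗ[ℝ] F) :
    (extremePoints ℝ (stdSimplex ℝ ι ∩ {w | A w = 0})).Finite := by
  classical
  refine Finite.of_finite_image (f := fun w : ι → ℝ => {i | w i ≠ 0})
    (Set.toFinite _) ?_
  intro w hw w' hw' hs
  simp only at hs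
  have hsupp : ∀ i, w i = 0 → w' i = 0 := by
    intro i hi
    by_contra hne
    have : i ∈ {i | w i ≠ 0} := by rw [hs]; exact hne
    exact this hi
  obtain ⟨⟨⟨hw0, hw1⟩, hwA⟩, hext⟩ := mem_extremePoints.1 hw
  obtain ⟨⟨⟨hw0', hw1'⟩, hwA'⟩, -⟩ := mem_extremePoints.1 hw'
  simp only [mem_ofPred_eq] at hwA hwA'
  -- a small step from `w` away from `w'` stays inside
  obtain ⟨ε, hε, hεw⟩ : ∃ ε : ℝ, 0 < ε ∧ ∀ i, ε * w' i ≤ w i := by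
    by_cases hne : Nonempty ι
    · have : ∀ i, ∃ e : ℝ, 0 < e ∧ e * w' i ≤ w i := by
        intro i
        rcases eq_or_lt_of_le (hw0 i) with h | h
        · exact ⟨1, one_pos, by rw [hsupp i h.symm, ← h]; simp⟩
        · refine ⟨w i / (w' i + 1), by have := hw0' i; positivity, ?_⟩
          have h' := hw0' i
          rw [div_mul_eq_mul_div, div_le_iff₀ (by positivity)]
          nlinarith
      choose e he hew using this
      refine ⟨Finset.univ.inf' Finset.univ_nonempty e, by simpa using he, fun i => ?_⟩
      exact (mul_le_mul_of_nonneg_right (Finset.inf'_le e (Finset.mem_univ i)) (hw0' i)).trans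
        (hew i)
    · exact ⟨1, one_pos, fun i => (hne ⟨i⟩).elim⟩
  have hu : w + ε • (w - w') ∈ stdSimplex ℝ ι ∩ {w | A w = 0} := by
    refine ⟨⟨fun i => ?_, ?_⟩, ?_⟩
    · have h1 := hw0 i
      have h2 := hεw i
      simp only [Pi.add_apply, Pi.smul_apply, Pi.sub_apply, smul_eq_mul]
      nlinarith
    · simp [Finset.sum_add_distrib, ← Finset.mul_sum, Finset.sum_sub_distrib, hw1, hw1']
    · simp [hwA, hwA']
  have hw'm : w' ∈ stdSimplex ℝ ι ∩ {w | A w = 0} := ⟨⟨hw0', hw1'⟩, hwA'⟩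
  refine ((hext _ hu _ hw'm ?_).2).symm
  refine ⟨1 / (1 + ε), ε / (1 + ε), by positivity, by positivity, by field_simp, ?_⟩
  ext i
  simp only [Pi.add_apply, Pi.smul_apply, Pi.sub_apply, smul_eq_mul]
  field_simp
  ring

theorem IsFinUnion.inter_ker {P : Set E} (h : IsFinUnion P) (L : E →ₗ[ℝ] F)
    (hL : Continuous L) : IsFinUnion (P ∩ {x | L x = 0}) := by
  obtain ⟨T, rfl⟩ := h
  rw [iUnion₂_inter]
  refine isFinUnion_iUnion T _ fun s _ => ?_
  rw [s.finite_toSet.convexHull_eq_image]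
  let _ := s.finite_toSet.fintype
  set f : (↑(s : Set E) → ℝ) →ₗ[ℝ] E := ∑ x : ↑(s : Set E), (LinearMap.proj (R := ℝ)
    (φ := fun _ : ↑(s : Set E) => ℝ) x).smulRight (x : E) with hf
  have hfc : Continuous f := f.continuous_of_finiteDimensional
  have h1 : f '' stdSimplex ℝ _ ∩ {x | L x = 0} =
      f '' (stdSimplex ℝ _ ∩ {w | (L ∘ₗ f) w = 0}) := by
    ext x
    constructor
    · rintro ⟨⟨w, hw, rfl⟩, hx⟩
      exact ⟨w, ⟨hw, hx⟩, rfl⟩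
    · rintro ⟨w, ⟨hw, hx⟩, rfl⟩
      exact ⟨⟨w, hw, rfl⟩, hx⟩
  change IsFinUnion (f '' stdSimplex ℝ ↑(s : Set E) ∩ {x | L x = 0})
  rw [h1]
  refine IsFinUnion.image ?_ f
  have hcl : IsClosed {w | (L ∘ₗ f) w = 0} :=
    isClosed_eq (hL.comp hfc) continuous_const
  have hcv : Convex ℝ {w | (L ∘ₗ f) w = 0} := (LinearMap.ker (L ∘ₗ f)).convex
  have hfin := finite_extremePoints_stdSimplex_inter (L ∘ₗ f)
  have key := closure_convexHull_extremePoints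
    ((isCompact_stdSimplex ℝ ↑(s : Set E)).inter_right hcl)
    ((convex_stdSimplex ℝ ↑(s : Set E)).inter hcv)
  rw [(hfin.isClosed_convexHull ℝ).closure_eq] at key
  rw [← key]
  exact isFinUnion_convexHull hfin

end Polyhedra

/-! ### PL charts and PL structures -/

/-- `ℝ^n` with its Euclidean structure. -/
abbrev Euc (n : ℕ) : Type := EuclideanSpace ℝ (Fin n)

/-- A PL chart of a topological space `X`: an embedding of a compact polyhedron into `X`. -/
structure PLChart (X : Type*) [TopologicalSpace X] where
  dim : ℕ
  carrier : Set (Euc dim)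
  isCompact : IsCompact carrier
  isPolyhedron : IsPolyhedron carrier
  map : carrier → X
  isEmbedding : IsEmbedding map

section PLStructures

variable {X Y : Type*} [TopologicalSpace X] [TopologicalSpace Y]

/-- The graph of the partially defined map `ψ⁻¹ ∘ f ∘ φ : P ⇀ Q`, for charts `c = (P, φ)` and
`d = (Q, ψ)`. -/
def PLChart.graph (c : PLChart X) (d : PLChart Y) (f : X → Y) : Set (Euc c.dim × Euc d.dim) :=
  {z | ∃ (hp : z.1 ∈ c.carrier) (hq : z.2 ∈ d.carrier),
    f (c.map ⟨z.1, hp⟩) = d.map ⟨z.2, hq⟩}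

/-- The domain `φ⁻¹ (f⁻¹ (ψ (Q))) ⊆ P` of the partially defined map `ψ⁻¹ ∘ f ∘ φ : P ⇀ Q`, for
charts `c = (P, φ)` and `d = (Q, ψ)`. -/
def PLChart.domain (c : PLChart X) (d : PLChart Y) (f : X → Y) : Set (Euc c.dim) :=
  {p | ∃ hp : p ∈ c.carrier, f (c.map ⟨p, hp⟩) ∈ range d.map}

/-- The map `f` is PL in the charts `c = (P, φ)` and `d = (Q, ψ)`: the set `φ⁻¹ (f⁻¹ (ψ (Q)))` is
a compact polyhedron (possibly empty), and `ψ⁻¹ ∘ f ∘ φ` is piecewise linear on it, i.e. its graph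
is a polyhedron. (Its continuity follows from that of `f`.) -/
def PLChart.IsPLBetween (c : PLChart X) (d : PLChart Y) (f : X → Y) : Prop :=
  IsCompact (c.domain d f) ∧ IsPolyhedron (c.domain d f) ∧ IsPolyhedron (c.graph d f)

/-- Compatibility of two charts: the overlap is a compact polyhedron and the change of charts is
piecewise linear. -/
def PLChart.Compatible (c d : PLChart X) : Prop := c.IsPLBetween d id

variable (X) in
/-- A PL structure on `X`: a maximal atlas of pairwise compatible PL charts such that each point
has a neighbourhood that is the image of a chart. -/
structure PLStructure where
  charts : Set (PLChart X)
  compatible : ∀ c ∈ charts, ∀ d ∈ charts, c.Compatible d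
  covers : ∀ x : X, ∃ c ∈ charts, range c.map ∈ 𝓝 x
  maximal : ∀ c : PLChart X,
    (∀ d ∈ charts, c.Compatible d ∧ d.Compatible c) → c ∈ charts

/-- PL maps between spaces with PL structures. -/
def IsPLMap (A : PLStructure X) (B : PLStructure Y) (f : X → Y) : Prop :=
  Continuous f ∧ ∀ c ∈ A.charts, ∀ d ∈ B.charts, c.IsPLBetween d f

/-- PL homeomorphisms. -/
def IsPLHomeomorph (A : PLStructure X) (B : PLStructure Y) (F : X ≃ₜ Y) : Prop :=
  IsPLMap A B F ∧ IsPLMap B A F.symm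

/-- `X` with the PL structure `A` is a PL manifold with (possibly empty) boundary of dimension `n`:
a second-countable Hausdorff space in which every point has a neighbourhood that is the image of a
chart defined on an `n`-simplex. -/
def IsPLManifoldWithBoundary (n : ℕ) (A : PLStructure X) : Prop :=
  T2Space X ∧ SecondCountableTopology X ∧
    ∀ x : X, ∃ c ∈ A.charts,
      (∃ v : Fin (n + 1) → Euc c.dim, AffineIndependent ℝ v ∧
        c.carrier = convexHull ℝ (range v)) ∧
      range c.map ∈ 𝓝 x

/-! ### The natural PL structure on a polyhedron -/

variable {N : ℕ}

/-- The graph of a chart of `X`, seen in `ℝ^N` via `ι : X → ℝ^N`. -/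
def PLChart.graphIn (c : PLChart X) (ι : X → Euc N) : Set (Euc c.dim × Euc N) :=
  {z | ∃ hp : z.1 ∈ c.carrier, z.2 = ι (c.map ⟨z.1, hp⟩)}

theorem PLChart.isCompact_graphIn (c : PLChart X) {ι : X → Euc N} (hι : Continuous ι) :
    IsCompact (c.graphIn ι) := by
  have : CompactSpace c.carrier := isCompact_iff_compactSpace.1 c.isCompact
  have h : c.graphIn ι = range fun p : c.carrier => ((p : Euc c.dim), ι (c.map p)) := by
    ext ⟨a, b⟩
    simp only [PLChart.graphIn, mem_ofPred_eq, mem_range, Prod.mk.injEq, Subtype.exists]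
    constructor
    · rintro ⟨hp, h⟩
      exact ⟨a, hp, rfl, h.symm⟩
    · rintro ⟨a', hp, rfl, rfl⟩
      exact ⟨hp, rfl⟩
  rw [h]
  exact isCompact_range (continuous_subtype_val.prodMk
    (hι.comp c.isEmbedding.continuous))

theorem PLChart.domain_eq_image (c : PLChart X) (d : PLChart Y) (f : X → Y) :
    c.domain d f = Prod.fst '' c.graph d f := by
  ext p
  constructor
  · rintro ⟨hp, ⟨q, hq⟩, h⟩
    exact ⟨(p, q), ⟨hp, hq, h.symm⟩, rfl⟩
  · rintro ⟨⟨p, q⟩, ⟨hp, hq, h⟩, rfl⟩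
    exact ⟨hp, ⟨q, hq⟩, h.symm⟩

theorem PLChart.isPLBetween_of_graph {c : PLChart X} {d : PLChart Y} {f : X → Y}
    (h : IsFinUnion (c.graph d f)) : c.IsPLBetween d f := by
  have h2 : IsFinUnion (c.domain d f) := by
    rw [c.domain_eq_image]
    exact h.image (LinearMap.fst ℝ (Euc c.dim) (Euc d.dim))
  exact ⟨h2.isCompact, h2.isPolyhedron, h.isPolyhedron⟩

theorem PLChart.compatible_of_graphIn {c d : PLChart X} {ι : X → Euc N}
    (hι : IsEmbedding ι) (hc : IsPolyhedron (c.graphIn ι)) (hd : IsPolyhedron (d.graphIn ι)) :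
    c.Compatible d := by
  refine PLChart.isPLBetween_of_graph ?_
  have hc' := isFinUnion_iff.2 ⟨c.isCompact_graphIn hι.continuous, hc⟩
  have hd' := isFinUnion_iff.2 ⟨d.isCompact_graphIn hι.continuous, hd⟩
  let V := (Euc c.dim × Euc N) × (Euc d.dim × Euc N)
  let L : V →L[ℝ] Euc N :=
    (ContinuousLinearMap.snd ℝ _ _).comp (ContinuousLinearMap.fst ℝ _ _) -
    (ContinuousLinearMap.snd ℝ _ _).comp (ContinuousLinearMap.snd ℝ _ _)
  let p : V →ₗ[ℝ] Euc c.dim × Euc d.dim :=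
    LinearMap.prodMap (LinearMap.fst ℝ _ _) (LinearMap.fst ℝ _ _)
  have := ((hc'.prod hd').inter_ker L.toLinearMap L.continuous).image p
  convert this using 1
  ext ⟨a, b⟩
  constructor
  · rintro ⟨ha, hb, h⟩
    refine ⟨((a, ι (c.map ⟨a, ha⟩)), (b, ι (d.map ⟨b, hb⟩))), ⟨⟨⟨ha, rfl⟩, ⟨hb, rfl⟩⟩, ?_⟩, rfl⟩
    simp only [id] at h
    simp [L, h]
  · rintro ⟨⟨⟨a', x⟩, ⟨b', y⟩⟩, ⟨⟨⟨ha, hx⟩, ⟨hb, hy⟩⟩, h⟩, hab⟩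
    obtain ⟨rfl, rfl⟩ : a' = a ∧ b' = b := by simpa [p] using hab
    refine ⟨ha, hb, hι.injective ?_⟩
    simp only [L, mem_ofPred_eq, ContinuousLinearMap.coe_coe, sub_apply,
      ContinuousLinearMap.comp_apply, ContinuousLinearMap.coe_fst', ContinuousLinearMap.coe_snd',
      sub_eq_zero] at h hx hy
    simp only [id]
    rw [← hx, ← hy, h]

/-- A compact polyhedron inside the image of `ι`, as a chart. -/
def inclusionChart (ι : X → Euc N) (hι : IsEmbedding ι) (Q : Set (Euc N)) (hQ : IsFinUnion Q)
    (hQX : Q ⊆ range ι) : PLChart X where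
  dim := N
  carrier := Q
  isCompact := hQ.isCompact
  isPolyhedron := hQ.isPolyhedron
  map := fun p => (hQX p.2).choose
  isEmbedding := by
    refine IsEmbedding.of_comp (g := ι) ?_ hι.continuous ?_
    · refine hι.continuous_iff.2 ?_
      convert continuous_subtype_val (p := fun x => x ∈ Q) using 1
      ext1 p
      exact (hQX p.2).choose_spec
    · convert IsEmbedding.subtypeVal (p := fun x => x ∈ Q) using 1
      ext1 p
      exact (hQX p.2).choose_spec

theorem inclusionChart_spec (ι : X → Euc N) (hι : IsEmbedding ι) (Q : Set (Euc N))
    (hQ : IsFinUnion Q) (hQX : Q ⊆ range ι) (p : Q) :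
    ι ((inclusionChart ι hι Q hQ hQX).map p) = p := (hQX p.2).choose_spec

theorem range_inclusionChart (ι : X → Euc N) (hι : IsEmbedding ι) (Q : Set (Euc N))
    (hQ : IsFinUnion Q) (hQX : Q ⊆ range ι) :
    range (inclusionChart ι hι Q hQ hQX).map = ι ⁻¹' Q := by
  ext x
  constructor
  · rintro ⟨p, rfl⟩
    have h : ι ((inclusionChart ι hι Q hQ hQX).map p) ∈ Q := by
      rw [inclusionChart_spec ι hι Q hQ hQX p]
      exact p.2
    exact h
  · intro hx
    exact ⟨⟨ι x, hx⟩, hι.injective (inclusionChart_spec ι hι Q hQ hQX ⟨ι x, hx⟩)⟩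

theorem inclusionChart_isPolyhedron (ι : X → Euc N) (hι : IsEmbedding ι) (Q : Set (Euc N))
    (hQ : IsFinUnion Q) (hQX : Q ⊆ range ι) :
    IsPolyhedron ((inclusionChart ι hι Q hQ hQX).graphIn ι) := by
  have h := (hQ.image (LinearMap.prod LinearMap.id LinearMap.id :
    Euc N →ₗ[ℝ] Euc N × Euc N)).isPolyhedron
  have h2 : (inclusionChart ι hι Q hQ hQX).graphIn ι =
      (LinearMap.prod LinearMap.id LinearMap.id : Euc N →ₗ[ℝ] Euc N × Euc N) '' Q := by
    ext ⟨a, b⟩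
    constructor
    · rintro ⟨hp, h⟩
      have h' : b = a := h.trans (inclusionChart_spec ι hι Q hQ hQX ⟨a, hp⟩)
      exact ⟨a, hp, Prod.ext rfl h'.symm⟩
    · rintro ⟨x, hx, h⟩
      obtain ⟨rfl, rfl⟩ : x = a ∧ x = b := Prod.mk.inj h
      exact ⟨hx, (inclusionChart_spec ι hι Q hQ hQX ⟨x, hx⟩).symm⟩
  rwa [h2]

/-- The natural PL structure of a polyhedron in `ℝ^N`, transported to `X` along an embedding
`ι : X → ℝ^N` onto it: a chart `(P, φ)` belongs to it if and only if `ι ∘ φ : P → ℝ^N` is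
piecewise linear, i.e. has a polyhedral graph. -/
def PLStructure.ofPolyhedron (ι : X → Euc N) (hι : IsEmbedding ι)
    (hX : IsPolyhedron (range ι)) : PLStructure X where
  charts := {c | IsPolyhedron (c.graphIn ι)}
  compatible := fun _ hc _ hd => PLChart.compatible_of_graphIn hι hc hd
  covers := by
    intro x
    obtain ⟨Q, hQ, hQX, hn⟩ := hX.local (ι x) ⟨x, rfl⟩
    refine ⟨inclusionChart ι hι Q hQ hQX, inclusionChart_isPolyhedron ι hι Q hQ hQX, ?_⟩
    rw [range_inclusionChart, hι.nhds_eq_comap, Filter.mem_comap]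
    obtain ⟨u, hu, huQ⟩ := mem_nhdsWithin_iff_exists_mem_nhds_inter.1 hn
    exact ⟨u, hu, fun y hy => huQ ⟨hy, y, rfl⟩⟩
  maximal := by
    intro c hc
    have : CompactSpace c.carrier := isCompact_iff_compactSpace.1 c.isCompact
    obtain ⟨Q, hQ, hKQ, hQX⟩ := hX.exists_finUnion
      (isCompact_range (hι.continuous.comp c.isEmbedding.continuous))
      (range_comp_subset_range c.map ι)
    have h := (hc _ (inclusionChart_isPolyhedron ι hι Q hQ hQX)).1.2.2
    have h2 : c.graph (inclusionChart ι hι Q hQ hQX) id = c.graphIn ι := by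
      ext ⟨a, b⟩
      constructor
      · rintro ⟨ha, hb, h⟩
        refine ⟨ha, ?_⟩
        exact ((congrArg ι h).trans (inclusionChart_spec ι hι Q hQ hQX ⟨b, hb⟩)).symm
      · rintro ⟨ha, hb⟩
        have hb' : b ∈ Q := by
          rw [show b = _ from hb]
          exact hKQ ⟨_, rfl⟩
        exact ⟨ha, hb', hι.injective
          (Eq.trans hb.symm (inclusionChart_spec ι hι Q hQ hQX ⟨b, hb'⟩).symm)⟩
    have h3 : IsPolyhedron (c.graphIn ι) := h2 ▸ h
    exact h3

end PLStructures

/-! ### Euclidean space and the half space -/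

/-- The closed half space `ℝ^{n-1} × ℝ_{≥ 0}` (the first coordinate is the nonnegative one;
for `n = 0` it is the point `ℝ^0`). -/
def halfSpace (n : ℕ) : Set (Euc n) := {x | ∀ i : Fin n, (i : ℕ) = 0 → 0 ≤ x i}

theorem isFinUnion_box {n : ℕ} (a b : Fin n → ℝ) (hab : a ≤ b) :
    IsFinUnion {x : Euc n | ∀ i, x i ∈ Icc (a i) (b i)} := by
  have h1 : IsFinUnion (univ.pi fun i => Icc (a i) (b i)) := by
    have : (univ.pi fun i => Icc (a i) (b i)) =
        convexHull ℝ (univ.pi fun i => ({a i, b i} : Set ℝ)) := by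
      rw [convexHull_pi]
      simp only [convexHull_pair, segment_eq_Icc (hab _)]
    rw [this]
    exact isFinUnion_convexHull (Set.Finite.pi fun i => Set.toFinite _)
  have h2 := h1.image (WithLp.linearEquiv 2 ℝ (Fin n → ℝ)).symm.toLinearMap
  convert h2 using 1
  ext x
  constructor
  · intro hx
    exact ⟨WithLp.ofLp x, fun i _ => hx i, rfl⟩
  · rintro ⟨y, hy, rfl⟩ i
    exact hy i (mem_univ i)

theorem box_mem_nhds {n : ℕ} (x : Euc n) :
    {y : Euc n | ∀ i, y i ∈ Ioo (x i - 1) (x i + 1)} ∈ 𝓝 x := by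
  have : {y : Euc n | ∀ i, y i ∈ Ioo (x i - 1) (x i + 1)} =
      ⋂ i, {y : Euc n | y i ∈ Ioo (x i - 1) (x i + 1)} := by
    ext y; simp
  rw [this]
  refine Filter.iInter_mem.2 fun i => ?_
  have hc : Continuous fun y : Euc n => y i := by fun_prop
  exact (isOpen_Ioo.preimage hc).mem_nhds (by simp)

theorem isPolyhedron_univ {n : ℕ} : IsPolyhedron (univ : Set (Euc n)) := by
  refine isPolyhedron_of_local fun x _ => ⟨_, isFinUnion_box (fun i => x i - 1)
    (fun i => x i + 1) (fun i => by simp only; linarith), subset_univ _, ?_⟩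
  rw [nhdsWithin_univ]
  exact Filter.mem_of_superset (box_mem_nhds x) fun y hy i => Ioo_subset_Icc_self (hy i)

theorem isPolyhedron_halfSpace {n : ℕ} : IsPolyhedron (halfSpace n) := by
  refine isPolyhedron_of_local fun x hx => ⟨_, isFinUnion_box
    (fun i => if (i : ℕ) = 0 then 0 else x i - 1) (fun i => x i + 1) ?_, ?_, ?_⟩
  · intro i
    simp only
    split_ifs with h
    · linarith [hx i h]
    · linarith
  · intro y hy i hi
    simpa [hi] using (hy i).1
  · refine mem_nhdsWithin_iff_exists_mem_nhds_inter.2 ⟨_, box_mem_nhds x, ?_⟩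
    rintro y ⟨hy, hyH⟩ i
    refine ⟨?_, (hy i).2.le⟩
    split_ifs with h
    · exact hyH i h
    · exact (hy i).1.le

/-- The natural PL structure on `ℝ^n`. -/
def plEuc (n : ℕ) : PLStructure (Euc n) :=
  PLStructure.ofPolyhedron id IsEmbedding.id (by rw [range_id]; exact isPolyhedron_univ)

/-- The natural PL structure on the half space. -/
def plHalfSpace (n : ℕ) : PLStructure (halfSpace n) :=
  PLStructure.ofPolyhedron Subtype.val IsEmbedding.subtypeVal
    (by rw [Subtype.range_coe]; exact isPolyhedron_halfSpace)

/-! ### Orthogonal groups and their orbit spaces -/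

/-- The orthogonal group `O_n`, as the group of linear isometries of `ℝ^n`. -/
abbrev O (n : ℕ) : Type := Euc n ≃ₗᵢ[ℝ] Euc n

variable {n : ℕ}

/-- The codimension of the fixed point subspace of `g`. -/
def fixCodim (g : O n) : ℕ :=
  Module.finrank ℝ (Euc n ⧸ LinearMap.eqLocus (g.toLinearEquiv : Euc n →ₗ[ℝ] Euc n) LinearMap.id)

/-- A reflection: the fixed point subspace has codimension one. -/
def IsReflection (g : O n) : Prop := fixCodim g = 1

/-- A rotation: the fixed point subspace has codimension two. -/
def IsRotation (g : O n) : Prop := fixCodim g = 2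

/-- A (finite real) reflection group: a finite group generated by the reflections it contains. -/
def IsReflectionGroup (W : Subgroup (O n)) : Prop :=
  Finite W ∧ W = Subgroup.closure {g | g ∈ W ∧ IsReflection g}

/-- A reflection-rotation group: a finite group generated by the reflections and rotations it
contains. -/
def IsReflectionRotationGroup (G : Subgroup (O n)) : Prop :=
  Finite G ∧ G = Subgroup.closure {g | g ∈ G ∧ (IsReflection g ∨ IsRotation g)}

/-- The orientation preserving subgroup `G⁺`: the elements of determinant one. -/
def orientationPreserving (G : Subgroup (O n)) : Subgroup (O n) where
  carrier := {g | g ∈ G ∧ LinearMap.det (g.toLinearEquiv : Euc n →ₗ[ℝ] Euc n) = 1}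
  one_mem' := ⟨G.one_mem, LinearMap.det_id⟩
  mul_mem' := by
    rintro a b ⟨ha, ha'⟩ ⟨hb, hb'⟩
    refine ⟨G.mul_mem ha hb, ?_⟩
    change LinearMap.det ((a.toLinearEquiv : Euc n →ₗ[ℝ] Euc n) ∘ₗ
      (b.toLinearEquiv : Euc n →ₗ[ℝ] Euc n)) = 1
    rw [LinearMap.det_comp, ha', hb', one_mul]
  inv_mem' := by
    rintro a ⟨ha, ha'⟩
    refine ⟨G.inv_mem ha, ?_⟩
    have h : LinearMap.det ((a.toLinearEquiv : Euc n →ₗ[ℝ] Euc n) ∘ₗ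
        (a⁻¹.toLinearEquiv : Euc n →ₗ[ℝ] Euc n)) = 1 := by
      have : (a.toLinearEquiv : Euc n →ₗ[ℝ] Euc n) ∘ₗ
        (a⁻¹.toLinearEquiv : Euc n →ₗ[ℝ] Euc n) = LinearMap.id :=
          LinearMap.ext fun x => a.apply_symm_apply x
      rw [this, LinearMap.det_id]
    rwa [LinearMap.det_comp, ha', one_mul] at h

/-- The extension `⟨G, h⟩` of a subgroup `G` by an element `h`. -/
def extendBy (G : Subgroup (O n)) (h : O n) : Subgroup (O n) :=
  Subgroup.closure ((G : Set (O n)) ∪ {h})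

/-- Two points are equivalent if they lie in the same `G`-orbit. -/
def orbitSetoid (G : Subgroup (O n)) : Setoid (Euc n) where
  r x y := ∃ g ∈ G, g x = y
  iseqv :=
    { refl := fun _ => ⟨1, G.one_mem, rfl⟩
      symm := by
        rintro x _ ⟨g, hg, rfl⟩
        exact ⟨g⁻¹, G.inv_mem hg, g.symm_apply_apply x⟩
      trans := by
        rintro x _ _ ⟨g, hg, rfl⟩ ⟨k, hk, rfl⟩
        exact ⟨k * g, G.mul_mem hk hg, rfl⟩ }

/-- The orbit space `ℝ^n/G`, with the quotient topology. -/
abbrev OrbitSpace (G : Subgroup (O n)) : Type := Quotient (orbitSetoid G)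

/-- The projection `ℝ^n → ℝ^n/G`. -/
abbrev orbitMk (G : Subgroup (O n)) (x : Euc n) : OrbitSpace G := Quotient.mk (orbitSetoid G) x

/-- `A` is the quotient PL structure on `ℝ^n/G`: the projection `ℝ^n → ℝ^n/G` is PL. By
`IsOrbitPL.unique` there is at most one such PL structure. -/
def IsOrbitPL (G : Subgroup (O n)) (A : PLStructure (OrbitSpace G)) : Prop :=
  IsPLMap (plEuc n) A (orbitMk G)

theorem isOpenMap_orbitMk (G : Subgroup (O n)) : IsOpenMap (orbitMk G) := by
  intro U hU
  refine isOpen_coinduced.2 ?_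
  have : Quotient.mk (orbitSetoid G) ⁻¹' (orbitMk G '' U) =
      ⋃ g ∈ G, (g : Euc n → Euc n) ⁻¹' U := by
    ext x
    simp only [mem_preimage, mem_image, mem_iUnion, exists_prop]
    constructor
    · rintro ⟨y, hy, h⟩
      obtain ⟨g, hg, h'⟩ := Quotient.exact h.symm
      exact ⟨g, hg, by rwa [h']⟩
    · rintro ⟨g, hg, h⟩
      exact ⟨g x, h, (Quotient.sound ⟨g, hg, rfl⟩ : orbitMk G x = orbitMk G (g x)).symm⟩
  change IsOpen (Quotient.mk (orbitSetoid G) ⁻¹' (orbitMk G '' U))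
  rw [this]
  exact isOpen_biUnion fun g _ => hU.preimage g.continuous

theorem PLChart.IsPLBetween.isFinUnion_graph {X Y : Type*} [TopologicalSpace X]
    [TopologicalSpace Y] {c : PLChart X} {d : PLChart Y} {f : X → Y} (hf : Continuous f)
    (h : c.IsPLBetween d f) : IsFinUnion (c.graph d f) := by
  refine isFinUnion_iff.2 ⟨?_, h.2.2⟩
  have hD : CompactSpace (c.domain d f) := isCompact_iff_compactSpace.1 h.1
  let φ : c.domain d f → c.carrier := fun p => ⟨p.1, p.2.choose⟩
  have hφ : Continuous φ := continuous_subtype_val.subtype_mk _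
  let ψ : c.domain d f → d.carrier := fun p => p.2.choose_spec.choose
  have hψ' : ∀ p, d.map (ψ p) = f (c.map (φ p)) := fun p => p.2.choose_spec.choose_spec
  have hψ : Continuous ψ := by
    refine d.isEmbedding.continuous_iff.2 ?_
    rw [show d.map ∘ ψ = f ∘ c.map ∘ φ from funext hψ']
    exact hf.comp (c.isEmbedding.continuous.comp hφ)
  have : c.graph d f = range fun p : c.domain d f =>
      ((p : Euc c.dim), (ψ p : Euc d.dim)) := by
    ext ⟨a, b⟩
    constructor
    · rintro ⟨ha, hb, h⟩
      refine ⟨⟨a, ha, ⟨b, hb⟩, h.symm⟩, ?_⟩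
      have h1 := hψ' ⟨a, ha, ⟨b, hb⟩, h.symm⟩
      have h2 := d.isEmbedding.injective (h1.trans h)
      simp [h2]
    · rintro ⟨p, hp⟩
      obtain ⟨rfl, rfl⟩ := Prod.mk.inj hp
      exact ⟨(φ p).2, (ψ p).2, (hψ' p).symm⟩
  rw [this]
  exact isCompact_range (continuous_subtype_val.prodMk (continuous_subtype_val.comp hψ))

theorem IsOrbitPL.compatible {G : Subgroup (O n)} {A B : PLStructure (OrbitSpace G)}
    (hA : IsOrbitPL G A) (hB : IsOrbitPL G B) {c d : PLChart (OrbitSpace G)}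
    (hc : c ∈ A.charts) (hd : d ∈ B.charts) : c.Compatible d := by
  have : CompactSpace c.carrier := isCompact_iff_compactSpace.1 c.isCompact
  -- a compact polyhedron in `ℝ^n` whose image contains the image of `c`
  obtain ⟨Q, hQ, hcQ⟩ : ∃ Q : Set (Euc n), IsFinUnion Q ∧ range c.map ⊆ orbitMk G '' Q := by
    obtain ⟨t, ht⟩ := (isCompact_range c.isEmbedding.continuous).elim_finite_subcover
      (fun k : ℕ => orbitMk G '' Metric.ball 0 (k : ℝ))
      (fun k => isOpenMap_orbitMk G _ Metric.isOpen_ball) (by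
        intro y _
        obtain ⟨x, rfl⟩ := Quotient.exists_rep y
        obtain ⟨k, hk⟩ := exists_nat_gt ‖x‖
        exact mem_iUnion.2 ⟨k, x, by simpa using hk, rfl⟩)
    obtain ⟨Q, hQ, hK, -⟩ := isPolyhedron_univ.exists_finUnion
      (t.isCompact_biUnion fun k _ => isCompact_closedBall (0 : Euc n) (k : ℝ)) (subset_univ _)
    refine ⟨Q, hQ, fun y hy => ?_⟩
    obtain ⟨k, hk, x, hx, rfl⟩ := mem_iUnion₂.1 (ht hy)
    exact ⟨x, hK (mem_iUnion₂.2 ⟨k, hk, Metric.ball_subset_closedBall hx⟩), rfl⟩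
  have hQX : Q ⊆ range (id : Euc n → Euc n) := by simp
  let k : PLChart (Euc n) := inclusionChart id IsEmbedding.id Q hQ hQX
  have hk : k ∈ (plEuc n).charts := inclusionChart_isPolyhedron id IsEmbedding.id Q hQ hQX
  have hkm : ∀ p : Q, k.map p = p := inclusionChart_spec id IsEmbedding.id Q hQ hQX
  have h1 := (hA.2 k hk c hc).isFinUnion_graph hA.1
  have h2 := (hB.2 k hk d hd).isFinUnion_graph hB.1
  refine PLChart.isPLBetween_of_graph ?_
  let V := (Euc n × Euc c.dim) × (Euc n × Euc d.dim)
  let L : V →L[ℝ] Euc n :=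
    (ContinuousLinearMap.fst ℝ _ _).comp (ContinuousLinearMap.fst ℝ _ _) -
    (ContinuousLinearMap.fst ℝ _ _).comp (ContinuousLinearMap.snd ℝ _ _)
  let p : V →ₗ[ℝ] Euc c.dim × Euc d.dim :=
    LinearMap.prodMap (LinearMap.snd ℝ _ _) (LinearMap.snd ℝ _ _)
  have := ((h1.prod h2).inter_ker L.toLinearMap L.continuous).image p
  convert this using 1
  ext ⟨a, b⟩
  constructor
  · rintro ⟨ha, hb, h⟩
    obtain ⟨x, hx, hxa⟩ := hcQ ⟨⟨a, ha⟩, rfl⟩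
    have hx' : orbitMk G (k.map ⟨x, hx⟩) = c.map ⟨a, ha⟩ :=
      (congrArg (orbitMk G) (hkm ⟨x, hx⟩)).trans hxa
    refine ⟨((x, a), (x, b)), ⟨⟨⟨hx, ha, hx'⟩, ⟨hx, hb, hx'.trans h⟩⟩, ?_⟩, rfl⟩
    exact sub_self x
  · rintro ⟨⟨⟨x, a'⟩, ⟨y, b'⟩⟩, ⟨⟨⟨hx, ha, h1⟩, ⟨hy, hb, h2⟩⟩, h⟩, hab⟩
    obtain ⟨rfl, rfl⟩ : a' = a ∧ b' = b := Prod.mk.inj hab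
    refine ⟨ha, hb, ?_⟩
    obtain rfl : x = y := sub_eq_zero.1 h
    exact h1.symm.trans h2

theorem IsOrbitPL.unique {G : Subgroup (O n)} {A B : PLStructure (OrbitSpace G)}
    (hA : IsOrbitPL G A) (hB : IsOrbitPL G B) : A = B := by
  have h : A.charts = B.charts := by
    ext c
    exact ⟨fun hc => B.maximal c fun d hd => ⟨hA.compatible hB hc hd, hB.compatible hA hd hc⟩,
      fun hc => A.maximal c fun d hd => ⟨hB.compatible hA hc hd, hA.compatible hB hd hc⟩⟩
  cases A
  cases B
  simp only at h
  subst h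
  rfl

/-! ### The main theorem and the PL linearization principle for given groups -/

/-- The assertion of the main theorem for the finite group `G < O_n`: the PL space `ℝ^n/G` is a PL
manifold with boundary if and only if `G` is a reflection-rotation group, and in this case either
`ℝ^n/G` is PL homeomorphic to the half space and `G` contains a reflection, or `ℝ^n/G` is PL
homeomorphic to `ℝ^n` and `G` contains no reflection. -/
def MainTheoremHoldsFor (G : Subgroup (O n)) : Prop :=
  ∃ A : PLStructure (OrbitSpace G), IsOrbitPL G A ∧
    (IsPLManifoldWithBoundary n A ↔ IsReflectionRotationGroup G) ∧
    (IsPLManifoldWithBoundary n A →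
      ((∃ F : OrbitSpace G ≃ₜ halfSpace n, IsPLHomeomorph A (plHalfSpace n) F) ∧
          ∃ g ∈ G, IsReflection g) ∨
      ((∃ F : OrbitSpace G ≃ₜ Euc n, IsPLHomeomorph A (plEuc n) F) ∧
          ¬ ∃ g ∈ G, IsReflection g))

/-- The PL linearization principle can be applied to `H ◁ G`: `H` is a normal subgroup of `G`, and
there are a PL homeomorphism `F : ℝ^n/H → ℝ^n` and a homomorphism `r : G → O_n` with kernel `H` such
that `F` is equivariant, where `G` acts on `ℝ^n/H` by `g • [x] = [g x]` and on `ℝ^n` through `r`. -/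
def PLLinearizationApplies (H G : Subgroup (O n)) : Prop :=
  H ≤ G ∧ (H.subgroupOf G).Normal ∧
    ∃ A : PLStructure (OrbitSpace H), IsOrbitPL H A ∧
      ∃ (F : OrbitSpace H ≃ₜ Euc n) (r : G →* O n),
        IsPLHomeomorph A (plEuc n) F ∧ r.ker = H.subgroupOf G ∧
        ∀ (g : G) (x : Euc n), F (orbitMk H ((g : O n) x)) = r g (F (orbitMk H x))

/-! ### The reflection groups of type `BC_n` and `D_n` -/

/-- The orthogonal reflection in the hyperplane `v^⊥`. -/
def reflectionAlong (v : Euc n) : O n := Submodule.reflection (ℝ ∙ v)ᗮ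

/-- The standard basis vector `e_i` of `ℝ^n`. -/
abbrev stdVec (i : Fin n) : Euc n := EuclideanSpace.single i 1

/-- The reflection group `W(D_n)`, generated by the reflections in the hyperplanes orthogonal to the
vectors `e_i - e_j` and `e_i + e_j`, `i ≠ j`. -/
def weylD (n : ℕ) : Subgroup (O n) :=
  Subgroup.closure {g | ∃ i j : Fin n, i ≠ j ∧
    (g = reflectionAlong (stdVec i - stdVec j) ∨ g = reflectionAlong (stdVec i + stdVec j))}

/-- The reflection group `W(BC_n)`, generated by `W(D_n)` and the reflections in the coordinate
hyperplanes. -/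
def weylBC (n : ℕ) : Subgroup (O n) :=
  Subgroup.closure ((weylD n : Set (O n)) ∪ {g | ∃ i : Fin n, g = reflectionAlong (stdVec i)})

end PLQuot

end

open PLQuot

noncomputable section

open Set Topology

namespace PLQuot

/-! ### Piecewise linear maps -/

section PLMaps

variable {E F H : Type*} [NormedAddCommGroup E] [NormedSpace ℝ E]
  [NormedAddCommGroup F] [NormedSpace ℝ F] [NormedAddCommGroup H] [NormedSpace ℝ H]

/-! A closed chamber `C` of `W` is a strict fundamental domain, so `ℝ^n/W` is `C`, and `ℝ^n/W⁺` is
the double of `C` along its boundary. If `W` is nontrivial, choose a unit vector `e` in the interior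
of `C`. The PL shear along `e` that replaces the `e`-coordinate of `x` by its height above the
boundary of `C` (`straighten`) carries `C` to a half space bounded by `e^⊥`. Sending the even
translates of `C` to this half space and the odd ones to its mirror image gives a proper PL
surjection `unfold : ℝ^n → ℝ^n` whose fibres are the `W⁺`-orbits. Such a map (`IsOrbitMap`) carries
all the topology: it realizes the orbit space as a polyhedron and its quotient PL structure as the
natural one.

Let a finite group `G ≥ W` normalize `W`. Since `W` is transitive on its chambers, each `k ∈ G` is
`w * g` with `w ∈ W` and `g` preserving `C`. Averaging makes `e` invariant under all such `g`, so
`unfold` commutes with `g` and turns `w` into `1` or the reflection `σ` along `e`, according to `det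
w`. Hence `G` acts orthogonally on `ℝ^n/W⁺` with kernel `W⁺` (`exists_isLinearization`). With `G =
W` the image is generated by `σ`, and folding along `e^⊥` gives the half space for `W` itself.

For a rotation `h ∉ W` the chamber is chosen adjacent to the fixed space of `h`. Then in `h = w * g`
the factor `g` fixes that space pointwise (`fix_of_mul_fix`), so `g` is a reflection or a product of
two, and `r h` is a product of two reflections. Its powers are the orientation preserving subgroup
of a finite dihedral group `D` normalized by `σ`, so the linearization can be applied a second time,
to `D` in `⟨D, σ⟩`. The composite of the two maps is an orbit map of `⟨W⁺, h⟩`. For `W ≠ ⊥`, `⟨W,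
h⟩` acts on its target through the group generated by one reflection, the image of `σ`, and a final
fold gives the half space.

Every group considered is a reflection-rotation group, and its quotient is shown to be a manifold,
so the equivalence in the main theorem is one between two true statements. -/

theorem isFinUnion_Icc (a b : ℝ) : IsFinUnion (Icc a b) := by
  rcases le_or_gt a b with h | h
  · rw [← segment_eq_Icc h, ← convexHull_pair]
    exact isFinUnion_convexHull (Set.toFinite _)
  · rw [Icc_eq_empty (not_le.2 h)]
    exact ⟨∅, by simp⟩

/-- A slack variable turns the inequality into an equation: `L x = t` with `t ∈ [0, M]`, where `M`
bounds `L` on the compact set `P`. Intersecting with a kernel and projecting `t` away then suffices.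
-/
theorem IsFinUnion.inter_halfSpace {P : Set E} (hP : IsFinUnion P) (L : E →L[ℝ] ℝ) :
    IsFinUnion (P ∩ {x | 0 ≤ L x}) := by
  obtain ⟨M, hM⟩ := (hP.isCompact.image L.continuous).bddAbove
  have := ((hP.prod (isFinUnion_Icc 0 M)).inter_ker
    (L.comp (ContinuousLinearMap.fst ℝ E ℝ) - ContinuousLinearMap.snd ℝ E ℝ).toLinearMap
    (ContinuousLinearMap.continuous _)).image (LinearMap.fst ℝ E ℝ)
  convert this using 1
  ext x
  constructor
  · rintro ⟨h1, h2⟩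
    exact ⟨(x, L x), ⟨⟨h1, h2, hM ⟨x, h1, rfl⟩⟩, by simp⟩, rfl⟩
  · rintro ⟨⟨a, b⟩, ⟨⟨h1, h2, -⟩, h⟩, rfl⟩
    obtain rfl : L a = b := by simpa [sub_eq_zero] using h
    exact ⟨h1, h2⟩

theorem IsFinUnion.inter_cone {P : Set E} (hP : IsFinUnion P) {ι : Type*} (s : Finset ι)
    (L : ι → E →L[ℝ] ℝ) : IsFinUnion (P ∩ {x | ∀ i ∈ s, 0 ≤ L i x}) := by
  classical
  induction s using Finset.induction_on with
  | empty => simpa using hP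
  | insert a s _ ih =>
    convert ih.inter_halfSpace (L a) using 1
    ext x
    simp only [Finset.forall_mem_insert, mem_inter_iff, mem_ofPred_eq]
    tauto

/-- A map is piecewise linear if its graph over each compact polyhedron is a compact polyhedron. -/
def IsPL (f : E → F) : Prop :=
  ∀ Q, IsFinUnion Q → IsFinUnion ((fun x => (x, f x)) '' Q)

theorem IsPL.image {f : E → F} (hf : IsPL f) {Q : Set E} (hQ : IsFinUnion Q) :
    IsFinUnion (f '' Q) := by
  have := (hf Q hQ).image (LinearMap.snd ℝ E F)
  rwa [image_image] at this

theorem isPL_linearMap (f : E →ₗ[ℝ] F) : IsPL f := fun _ hQ =>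
  hQ.image (LinearMap.prod LinearMap.id f)

/-- The graph of a composite is a linear projection of the fibre product of the two graphs, and the
fibre product is cut out of the product by a linear equation. -/
theorem IsPL.comp {g : F → H} {f : E → F} (hg : IsPL g) (hf : IsPL f) : IsPL (g ∘ f) := by
  intro Q hQ
  let V := (E × F) × (F × H)
  let L : V →L[ℝ] F :=
    (ContinuousLinearMap.snd ℝ _ _).comp (ContinuousLinearMap.fst ℝ _ _) -
    (ContinuousLinearMap.fst ℝ _ _).comp (ContinuousLinearMap.snd ℝ _ _)
  let p : V →ₗ[ℝ] E × H := LinearMap.prodMap (LinearMap.fst ℝ _ _) (LinearMap.snd ℝ _ _)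
  have := (((hf Q hQ).prod (hg _ (hf.image hQ))).inter_ker L.toLinearMap L.continuous).image p
  convert this using 1
  ext ⟨a, b⟩
  constructor
  · rintro ⟨x, hx, h⟩
    obtain ⟨rfl, rfl⟩ := Prod.mk.inj h
    exact ⟨((x, f x), (f x, g (f x))), ⟨⟨⟨x, hx, rfl⟩, ⟨f x, ⟨x, hx, rfl⟩, rfl⟩⟩, sub_self (f x)⟩,
      rfl⟩
  · rintro ⟨⟨⟨_, _⟩, ⟨_, _⟩⟩, ⟨⟨⟨x, hx, hxf⟩, ⟨y, hy, hyg⟩⟩, h⟩, hab⟩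
    obtain ⟨rfl, rfl⟩ := Prod.mk.inj hxf
    obtain ⟨rfl, rfl⟩ := Prod.mk.inj hyg
    obtain ⟨rfl, rfl⟩ := Prod.mk.inj hab
    have h' : f x = y := sub_eq_zero.1 h
    exact ⟨x, hx, by simp [h']⟩

/-- A map that agrees with PL maps on the members of a finite polyhedral cover is PL. -/
theorem IsPL.glue {f : E → F} {ι : Type*} [Finite ι] (S : ι → Set E) (g : ι → E → F)
    (hcov : ∀ x, ∃ i, x ∈ S i) (hS : ∀ i Q, IsFinUnion Q → IsFinUnion (Q ∩ S i))
    (hg : ∀ i, IsPL (g i)) (hfg : ∀ i, ∀ x ∈ S i, f x = g i x) : IsPL f := by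
  intro Q hQ
  have := Fintype.ofFinite ι
  convert isFinUnion_iUnion (Finset.univ : Finset ι) _ fun i _ => hg i _ (hS i Q hQ) using 1
  ext z
  simp only [Finset.mem_univ, iUnion_true, mem_iUnion, mem_image, mem_inter_iff]
  constructor
  · rintro ⟨x, hx, rfl⟩
    obtain ⟨i, hi⟩ := hcov x
    exact ⟨i, x, ⟨hx, hi⟩, by rw [hfg i x hi]⟩
  · rintro ⟨i, x, ⟨hx, hi⟩, rfl⟩
    exact ⟨x, hx, by rw [hfg i x hi]⟩

theorem IsPL.isPolyhedron_graph {n : ℕ} {f : Euc n → F} (hf : IsPL f) :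
    IsPolyhedron (range fun x => (x, f x)) := by
  refine isPolyhedron_of_local ?_
  rintro _ ⟨x, rfl⟩
  refine ⟨_, hf _ (isFinUnion_box (fun i => x i - 1) (fun i => x i + 1)
    (fun i => by simp only; linarith)), image_subset_range _ _, ?_⟩
  refine mem_nhdsWithin_iff_exists_mem_nhds_inter.2
    ⟨Prod.fst ⁻¹' _, continuous_fst.continuousAt.preimage_mem_nhds (box_mem_nhds x), ?_⟩
  rintro _ ⟨h, y, rfl⟩
  exact ⟨y, fun i => Ioo_subset_Icc_self (h i), rfl⟩

end PLMaps

/-! ### PL maps between embedded polyhedra -/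

section Embedded

variable {X Y : Type*} [TopologicalSpace X] [TopologicalSpace Y] {N M : ℕ}

/-- Reduces the chartwise condition to the single graph of `f` between the embedded spaces. The
graph in charts is a fibre product of the two chart graphs with the graph of `f`; the latter need
not be compact, so it is replaced by a compact polyhedron `Q` inside it that contains the part over
`c`. -/
theorem PLChart.isPLBetween_of_embedded {ι : X → Euc N} {κ : Y → Euc M} (hι : IsEmbedding ι)
    (hκ : IsEmbedding κ) {f : X → Y} (hf : Continuous f)
    (hR : IsPolyhedron (range fun x => (ι x, κ (f x)))) {c : PLChart X} {d : PLChart Y}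
    (hc : IsPolyhedron (c.graphIn ι)) (hd : IsPolyhedron (d.graphIn κ)) : c.IsPLBetween d f := by
  refine PLChart.isPLBetween_of_graph ?_
  have : CompactSpace c.carrier := isCompact_iff_compactSpace.1 c.isCompact
  have hc' := isFinUnion_iff.2 ⟨c.isCompact_graphIn hι.continuous, hc⟩
  have hd' := isFinUnion_iff.2 ⟨d.isCompact_graphIn hκ.continuous, hd⟩
  obtain ⟨Q, hQ, hKQ, hQR⟩ := hR.exists_finUnion (isCompact_range
    ((hι.continuous.prodMk (hκ.continuous.comp hf)).comp c.isEmbedding.continuous))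
    (range_comp_subset_range c.map _)
  let V := ((Euc c.dim × Euc N) × (Euc d.dim × Euc M)) × (Euc N × Euc M)
  let L : V →L[ℝ] Euc N × Euc M :=
    (ContinuousLinearMap.prodMap (ContinuousLinearMap.snd ℝ _ _)
      (ContinuousLinearMap.snd ℝ _ _)).comp (ContinuousLinearMap.fst ℝ _ _) -
    ContinuousLinearMap.snd ℝ _ _
  let p : V →ₗ[ℝ] Euc c.dim × Euc d.dim :=
    (LinearMap.prodMap (LinearMap.fst ℝ _ _) (LinearMap.fst ℝ _ _)) ∘ₗ LinearMap.fst ℝ _ _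
  have := (((hc'.prod hd').prod hQ).inter_ker L.toLinearMap L.continuous).image p
  convert this using 1
  ext ⟨a, b⟩
  constructor
  · rintro ⟨ha, hb, h⟩
    refine ⟨(((a, ι (c.map ⟨a, ha⟩)), (b, κ (d.map ⟨b, hb⟩))),
      (ι (c.map ⟨a, ha⟩), κ (f (c.map ⟨a, ha⟩)))),
      ⟨⟨⟨⟨ha, rfl⟩, ⟨hb, rfl⟩⟩, hKQ ⟨⟨a, ha⟩, rfl⟩⟩, ?_⟩, rfl⟩
    simp only [] at h
    simp [L, h]
  · rintro ⟨⟨⟨⟨a', x⟩, ⟨b', y⟩⟩, ⟨x', y'⟩⟩, ⟨⟨⟨⟨ha, hx⟩, ⟨hb, hy⟩⟩, hq⟩, h⟩, hab⟩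
    obtain ⟨rfl, rfl⟩ : a' = a ∧ b' = b := by simpa [p] using hab
    obtain ⟨z, hz⟩ := hQR hq
    obtain ⟨rfl, rfl⟩ := Prod.mk.inj hz
    have h' : (x, y) - (ι z, κ (f z)) = 0 := h
    obtain ⟨rfl, rfl⟩ := Prod.mk.inj (sub_eq_zero.1 h')
    have hz' : z = c.map ⟨a', ha⟩ := hι.injective hx
    exact ⟨ha, hb, hκ.injective ((congrArg (fun t => κ (f t)) hz').symm.trans hy)⟩

theorem isPLMap_ofPolyhedron {ι : X → Euc N} {κ : Y → Euc M} (hι : IsEmbedding ι)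
    (hX : IsPolyhedron (range ι)) (hκ : IsEmbedding κ) (hY : IsPolyhedron (range κ)) {f : X → Y}
    (hf : Continuous f) (hR : IsPolyhedron (range fun x => (ι x, κ (f x)))) :
    IsPLMap (PLStructure.ofPolyhedron ι hι hX) (PLStructure.ofPolyhedron κ hκ hY) f :=
  ⟨hf, fun _ hc _ hd => PLChart.isPLBetween_of_embedded hι hκ hf hR hc hd⟩

theorem IsPolyhedron.diagonal {X : Type*} {ι : X → Euc N} (hX : IsPolyhedron (range ι)) :
    IsPolyhedron (range fun x => (ι x, ι x)) := by
  refine isPolyhedron_of_local ?_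
  rintro _ ⟨x, rfl⟩
  obtain ⟨Q, hQ, hQX, hn⟩ := hX.local (ι x) ⟨x, rfl⟩
  refine ⟨_, hQ.image (LinearMap.prod LinearMap.id LinearMap.id), ?_, ?_⟩
  · rintro _ ⟨y, hy, rfl⟩
    obtain ⟨z, rfl⟩ := hQX hy
    exact ⟨z, rfl⟩
  · obtain ⟨u, hu, huQ⟩ := mem_nhdsWithin_iff_exists_mem_nhds_inter.1 hn
    refine mem_nhdsWithin_iff_exists_mem_nhds_inter.2
      ⟨Prod.fst ⁻¹' u, continuous_fst.continuousAt.preimage_mem_nhds hu, ?_⟩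
    rintro _ ⟨h, z, rfl⟩
    exact ⟨ι z, huQ ⟨h, z, rfl⟩, rfl⟩

/-- Both spaces are embedded onto the same polyhedron and `F` becomes its identity, so the graphs of
`F` and of its inverse are diagonals. -/
theorem isPLHomeomorph_ofPolyhedron {ι : X → Euc N} {κ : Y → Euc N} (hι : IsEmbedding ι)
    (hX : IsPolyhedron (range ι)) (hκ : IsEmbedding κ) (hY : IsPolyhedron (range κ)) {F : X ≃ₜ Y}
    (hF : ∀ x, κ (F x) = ι x) :
    IsPLHomeomorph (PLStructure.ofPolyhedron ι hι hX) (PLStructure.ofPolyhedron κ hκ hY) F := by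
  refine ⟨isPLMap_ofPolyhedron hι hX hκ hY F.continuous ?_,
    isPLMap_ofPolyhedron hκ hY hι hX F.symm.continuous ?_⟩
  · simpa only [hF] using hX.diagonal
  · have : ∀ y, ι (F.symm y) = κ y := fun y => by rw [← hF, F.apply_symm_apply]
    simpa only [this] using hY.diagonal

/-- A space embedded onto a polyhedron that has simplices as neighbourhoods of its points is a PL
manifold with boundary. -/
theorem isPLManifoldWithBoundary_ofPolyhedron {n : ℕ} {ι : X → Euc n} (hι : IsEmbedding ι)
    (hX : IsPolyhedron (range ι))
    (h : ∀ x ∈ range ι, ∃ v : Fin (n + 1) → Euc n, AffineIndependent ℝ v ∧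
      convexHull ℝ (range v) ⊆ range ι ∧ convexHull ℝ (range v) ∈ 𝓝[range ι] x) :
    IsPLManifoldWithBoundary n (PLStructure.ofPolyhedron ι hι hX) := by
  refine ⟨hι.t2Space, hι.secondCountableTopology, fun x => ?_⟩
  obtain ⟨v, hv, hvX, hn⟩ := h (ι x) ⟨x, rfl⟩
  have hQ : IsFinUnion (convexHull ℝ (range v)) := isFinUnion_convexHull (finite_range v)
  refine ⟨inclusionChart ι hι _ hQ hvX, inclusionChart_isPolyhedron ι hι _ hQ hvX,
    ⟨v, hv, rfl⟩, ?_⟩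
  rw [range_inclusionChart, hι.nhds_eq_comap, Filter.mem_comap]
  obtain ⟨u, hu, huQ⟩ := mem_nhdsWithin_iff_exists_mem_nhds_inter.1 hn
  exact ⟨u, hu, fun y hy => huQ ⟨hy, y, rfl⟩⟩

end Embedded

/-! ### Corner simplices -/

section Simplex

variable {n : ℕ}

/-- The vertices `a, a + R e_1, …, a + R e_n` of a simplex. -/
def cornerSimplex (a : Euc n) (R : ℝ) : Fin (n + 1) → Euc n :=
  Fin.cons a fun i => a + R • stdVec i

theorem affineIndependent_cornerSimplex (a : Euc n) {R : ℝ} (hR : 0 < R) :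
    AffineIndependent ℝ (cornerSimplex a R) := by
  have hli : LinearIndependent ℝ fun i : Fin n => (R • stdVec i : Euc n) := by
    have h := (EuclideanSpace.basisFun (Fin n) ℝ).toBasis.linearIndependent
    have h2 := h.units_smul fun _ => Units.mk0 R hR.ne'
    have h3 : (fun i : Fin n => (R • stdVec i : Euc n)) = (fun _ : Fin n => Units.mk0 R hR.ne') •
        ⇑(EuclideanSpace.basisFun (Fin n) ℝ).toBasis := by
      ext i j
      simp [Units.smul_def]
    rw [h3]
    exact h2
  rw [affineIndependent_iff_linearIndependent_vsub ℝ _ 0]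
  let e : Fin n ≃ {x : Fin (n + 1) // x ≠ 0} := finSuccAboveEquiv 0
  rw [← linearIndependent_equiv e]
  have h : ((fun i : {x : Fin (n + 1) // x ≠ 0} =>
      cornerSimplex a R i -ᵥ cornerSimplex a R 0) ∘ e) =
      fun i : Fin n => (R • stdVec i : Euc n) := by
    ext1 i
    have : ((e i : {x : Fin (n + 1) // x ≠ 0}) : Fin (n + 1)) = i.succ := by
      simp [e, finSuccAboveEquiv_apply]
    simp only [Function.comp, this]
    simp [cornerSimplex]
  rw [h]
  exact hli

/-- The barycentric coordinates are `(y i - a i) / R` at the vertices `a + R e_i`, and the remainder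
at `a`. -/
theorem mem_convexHull_cornerSimplex {a y : Euc n} {R : ℝ} (hR : 0 < R) (hy : ∀ i, a i ≤ y i)
    (hs : ∑ i, (y i - a i) ≤ R) : y ∈ convexHull ℝ (range (cornerSimplex a R)) := by
  let w : Fin (n + 1) → ℝ := Fin.cons (1 - ∑ i, (y i - a i) / R) fun i => (y i - a i) / R
  have hsum : ∑ i, (y i - a i) / R ≤ 1 := by
    rw [← Finset.sum_div, div_le_one hR]
    exact hs
  have h : ∑ i, w i • cornerSimplex a R i = y := by
    rw [Fin.sum_univ_succ]
    simp only [w, Fin.cons_zero, Fin.cons_succ, cornerSimplex, smul_add, Finset.sum_add_distrib,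
      ← Finset.sum_smul]
    rw [← add_assoc, ← add_smul, sub_add_cancel, one_smul]
    ext j
    have : ∀ i : Fin n, ((y i - a i) / R) • (R • stdVec i : Euc n) = (y i - a i) • stdVec i := by
      intro i
      rw [smul_smul, div_mul_cancel₀ _ hR.ne']
    simp only [this]
    simp [Finset.sum_apply, Pi.single_apply]
  rw [← h]
  refine (convex_convexHull ℝ _).sum_mem ?_ ?_ fun i _ => subset_convexHull ℝ _ ⟨i, rfl⟩
  · intro i _
    refine Fin.cases ?_ (fun j => ?_) i
    · simpa [w] using hsum
    · simp only [w, Fin.cons_succ]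
      exact div_nonneg (sub_nonneg.2 (hy j)) hR.le
  · rw [Fin.sum_univ_succ]
    simp [w]

/-- The corner lies one unit below `x` in each coordinate, and the size exceeds the coordinate sum
by one, so all the defining inequalities are strict at `x`. -/
theorem exists_simplex_nhds_univ (x : Euc n) :
    ∃ v : Fin (n + 1) → Euc n, AffineIndependent ℝ v ∧
      convexHull ℝ (range v) ⊆ univ ∧ convexHull ℝ (range v) ∈ 𝓝[univ] x := by
  let a : Euc n := WithLp.toLp 2 fun i => x i - 1
  let R : ℝ := ∑ i, (x i - a i) + 1
  have hR : 0 < R := by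
    have : 0 ≤ ∑ i, (x i - a i) := Finset.sum_nonneg fun i _ => by simp [a]
    positivity
  refine ⟨cornerSimplex a R, affineIndependent_cornerSimplex a hR, subset_univ _, ?_⟩
  rw [nhdsWithin_univ]
  have hc : Continuous fun y : Euc n => ∑ i, (y i - a i) := by fun_prop
  filter_upwards [box_mem_nhds x, hc.continuousAt.eventually_lt continuousAt_const
    (show ∑ i, (x i - a i) < R by simp [R])] with y hy hy'
  exact mem_convexHull_cornerSimplex hR (fun i => (hy i).1.le) hy'.le

theorem exists_simplex_nhds_halfSpace {x : Euc n} (hx : x ∈ halfSpace n) :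
    ∃ v : Fin (n + 1) → Euc n, AffineIndependent ℝ v ∧
      convexHull ℝ (range v) ⊆ halfSpace n ∧ convexHull ℝ (range v) ∈ 𝓝[halfSpace n] x := by
  -- The corner is put on the bounding hyperplane, whether or not `x` lies there: the simplex stays
  -- in the half space, and no points of the half space near `x` are lost.
  let a : Euc n := WithLp.toLp 2 fun i => if (i : ℕ) = 0 then 0 else x i - 1
  have ha : ∀ i, a i = if (i : ℕ) = 0 then 0 else x i - 1 := fun i => rfl
  let R : ℝ := ∑ i, (x i - a i) + 1
  have hR : 0 < R := by
    have : 0 ≤ ∑ i, (x i - a i) := Finset.sum_nonneg fun i _ => by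
      rw [ha]
      split_ifs with h
      · simpa using hx i h
      · simp
    positivity
  have hconv : Convex ℝ (halfSpace n) := by
    intro y hy z hz s t hs ht _ i hi
    have := hy i hi
    have := hz i hi
    simp only [PiLp.add_apply, PiLp.smul_apply, smul_eq_mul]
    positivity
  refine ⟨cornerSimplex a R, affineIndependent_cornerSimplex a hR,
    convexHull_min ?_ hconv, ?_⟩
  · rintro _ ⟨i, rfl⟩ j hj
    refine Fin.cases ?_ (fun k => ?_) i
    · simp [cornerSimplex, ha, hj]
    · simp only [cornerSimplex, Fin.cons_succ, PiLp.add_apply, PiLp.smul_apply, ha, if_pos hj,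
        PiLp.single_apply, smul_eq_mul, zero_add]
      split_ifs <;> simp [hR.le]
  · have hc : Continuous fun y : Euc n => ∑ i, (y i - a i) := by fun_prop
    filter_upwards [nhdsWithin_le_nhds (box_mem_nhds x), nhdsWithin_le_nhds
      (hc.continuousAt.eventually_lt continuousAt_const
      (show ∑ i, (x i - a i) < R by simp [R])), self_mem_nhdsWithin] with y hy hy' hyH
    refine mem_convexHull_cornerSimplex hR (fun i => ?_) hy'.le
    rw [ha]
    split_ifs with h
    · exact hyH i h
    · exact (hy i).1.le

end Simplex

/-! ### PL maps realizing orbit spaces -/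

section OrbitMaps

variable {n : ℕ}

/-- A proper PL self-map of `ℝ^n` whose fibres are the orbits of `G`. -/
structure IsOrbitMap (G : Subgroup (O n)) (F : Euc n → Euc n) : Prop where
  isPL : IsPL F
  continuous : Continuous F
  isClosedMap : IsClosedMap F
  eq_iff : ∀ x y, F x = F y ↔ ∃ g ∈ G, g x = y

namespace IsOrbitMap

variable {G : Subgroup (O n)} {F : Euc n → Euc n}

/-- The map `ℝ^n/G → ℝ^n` induced by an orbit map. -/
def lift (hF : IsOrbitMap G F) : OrbitSpace G → Euc n :=
  Quotient.lift F fun x y h => (hF.eq_iff x y).2 h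

theorem range_lift (hF : IsOrbitMap G F) : range hF.lift = range F := by
  ext y
  constructor
  · rintro ⟨x, rfl⟩
    obtain ⟨x, rfl⟩ := Quotient.exists_rep x
    exact ⟨x, rfl⟩
  · rintro ⟨x, rfl⟩
    exact ⟨orbitMk G x, rfl⟩

/-- Closedness of `F` passes to the induced map, and a continuous injective closed map is an
embedding. -/
theorem isEmbedding_lift (hF : IsOrbitMap G F) : IsEmbedding hF.lift := by
  have hc : Continuous hF.lift := hF.continuous.quotient_lift _
  refine (IsClosedEmbedding.of_continuous_injective_isClosedMap hc ?_ ?_).isEmbedding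
  · intro x y h
    obtain ⟨x, rfl⟩ := Quotient.exists_rep x
    obtain ⟨y, rfl⟩ := Quotient.exists_rep y
    exact Quotient.sound ((hF.eq_iff x y).1 h)
  · intro S hS
    have : hF.lift '' S = F '' (orbitMk G ⁻¹' S) := by
      ext y
      constructor
      · rintro ⟨x, hx, rfl⟩
        obtain ⟨x, rfl⟩ := Quotient.exists_rep x
        exact ⟨x, hx, rfl⟩
      · rintro ⟨x, hx, rfl⟩
        exact ⟨orbitMk G x, hx, rfl⟩
    rw [this]
    exact hF.isClosedMap _ (hS.preimage continuous_quotient_mk')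

/-- The PL structure of `ℝ^n/G` defined by an orbit map onto a polyhedron. -/
def plStructure (hF : IsOrbitMap G F) (hP : IsPolyhedron (range F)) : PLStructure (OrbitSpace G) :=
  PLStructure.ofPolyhedron hF.lift hF.isEmbedding_lift (by rwa [hF.range_lift])

theorem isOrbitPL (hF : IsOrbitMap G F) (hP : IsPolyhedron (range F)) :
    IsOrbitPL G (hF.plStructure hP) :=
  isPLMap_ofPolyhedron IsEmbedding.id _ hF.isEmbedding_lift _ continuous_quotient_mk'
    hF.isPL.isPolyhedron_graph

/-- The homeomorphism from `ℝ^n/G` to the image of an orbit map, embedded by `κ`. -/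
theorem exists_homeomorph (hF : IsOrbitMap G F) (hP : IsPolyhedron (range F)) {Y : Type*}
    [TopologicalSpace Y] {κ : Y → Euc n} (hκ : IsEmbedding κ) (hY : IsPolyhedron (range κ))
    (h : range F = range κ) : ∃ Φ : OrbitSpace G ≃ₜ Y, (∀ x, κ (Φ x) = hF.lift x) ∧
      IsPLHomeomorph (hF.plStructure hP) (PLStructure.ofPolyhedron κ hκ hY) Φ := by
  let Φ : OrbitSpace G ≃ₜ Y := hF.isEmbedding_lift.toHomeomorph.trans
    ((Homeomorph.setCongr (hF.range_lift.trans h)).trans hκ.toHomeomorph.symm)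
  have hΦ : ∀ x, κ (Φ x) = hF.lift x := by
    intro x
    have h1 : ∀ y : range κ, κ (hκ.toHomeomorph.symm y) = y := fun y =>
      congrArg Subtype.val (hκ.toHomeomorph.apply_symm_apply y)
    exact h1 _
  exact ⟨Φ, hΦ, isPLHomeomorph_ofPolyhedron _ _ hκ hY hΦ⟩

/-- The orbit space inherits simplicial neighbourhoods from `ℝ^n`, so it is a manifold; with `hG`
both sides of the equivalence hold. -/
theorem mainTheoremHoldsFor (hF : IsOrbitMap G F) (hr : range F = univ)
    (hG : IsReflectionRotationGroup G) (hn : ¬ ∃ g ∈ G, IsReflection g) :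
    MainTheoremHoldsFor G := by
  have hP : IsPolyhedron (range F) := by rw [hr]; exact isPolyhedron_univ
  refine ⟨hF.plStructure hP, hF.isOrbitPL hP, ⟨fun _ => hG, fun _ => ?_⟩, fun _ => Or.inr ⟨?_, hn⟩⟩
  · refine isPLManifoldWithBoundary_ofPolyhedron _ _ fun x _ => ?_
    rw [hF.range_lift, hr]
    exact exists_simplex_nhds_univ x
  · obtain ⟨Φ, -, hΦ⟩ := hF.exists_homeomorph hP (κ := id) IsEmbedding.id
      (by rw [range_id]; exact isPolyhedron_univ) (by rw [hr, range_id])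
    exact ⟨Φ, hΦ⟩

theorem mainTheoremHoldsFor_of_halfSpace (hF : IsOrbitMap G F) (hr : range F = halfSpace n)
    (hG : IsReflectionRotationGroup G) (hn : ∃ g ∈ G, IsReflection g) :
    MainTheoremHoldsFor G := by
  have hP : IsPolyhedron (range F) := by rw [hr]; exact isPolyhedron_halfSpace
  refine ⟨hF.plStructure hP, hF.isOrbitPL hP, ⟨fun _ => hG, fun _ => ?_⟩, fun _ => Or.inl ⟨?_, hn⟩⟩
  · refine isPLManifoldWithBoundary_ofPolyhedron _ _ fun x hx => ?_
    rw [hF.range_lift, hr] at hx ⊢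
    exact exists_simplex_nhds_halfSpace hx
  · obtain ⟨Φ, -, hΦ⟩ := hF.exists_homeomorph hP (κ := (Subtype.val : halfSpace n → Euc n))
      IsEmbedding.subtypeVal (by rw [Subtype.range_coe]; exact isPolyhedron_halfSpace)
      (by rw [hr, Subtype.range_coe])
    exact ⟨Φ, hΦ⟩

theorem plLinearizationApplies {H : Subgroup (O n)} (hF : IsOrbitMap H F) (hr : range F = univ)
    (hHG : H ≤ G) (r : G →* O n) (hker : r.ker = H.subgroupOf G)
    (heq : ∀ (g : G) x, F ((g : O n) x) = r g (F x)) : PLLinearizationApplies H G := by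
  have hP : IsPolyhedron (range F) := by rw [hr]; exact isPolyhedron_univ
  refine ⟨hHG, by rw [← hker]; infer_instance, hF.plStructure hP, hF.isOrbitPL hP, ?_⟩
  obtain ⟨Φ, hΦ, hΦ'⟩ := hF.exists_homeomorph hP (κ := id) IsEmbedding.id
    (by rw [range_id]; exact isPolyhedron_univ) (by rw [hr, range_id])
  refine ⟨Φ, r, hΦ', hker, fun g x => ?_⟩
  have h1 : ∀ z, Φ (orbitMk H z) = F z := fun z => hΦ (orbitMk H z)
  rw [h1, h1, heq]

/-- If an orbit map `F` of `H` induces the group `K` from `G ≥ H`, an orbit map of `K` can be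
composed with it to an orbit map of `G`. -/
theorem comp {H K : Subgroup (O n)} {Q : Euc n → Euc n} (hQ : IsOrbitMap K Q)
    (hF : IsOrbitMap H F) (hHG : H ≤ G)
    (h1 : ∀ g ∈ G, ∃ k ∈ K, ∀ x, F (g x) = k (F x))
    (h2 : ∀ k ∈ K, ∃ g ∈ G, ∀ x, F (g x) = k (F x)) : IsOrbitMap G (Q ∘ F) where
  isPL := hQ.isPL.comp hF.isPL
  continuous := hQ.continuous.comp hF.continuous
  isClosedMap := hQ.isClosedMap.comp hF.isClosedMap
  eq_iff x y := by
    simp only [Function.comp, hQ.eq_iff]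
    constructor
    · rintro ⟨k, hk, h⟩
      obtain ⟨g, hg, hgk⟩ := h2 k hk
      rw [← hgk, hF.eq_iff] at h
      -- The lift `g` of `k` sends `x` into the fibre of `y`, hence to `y` up to an element `a` of
      -- `H`.
      obtain ⟨a, ha, h⟩ := h
      exact ⟨a * g, G.mul_mem (hHG ha) hg, h⟩
    · rintro ⟨g, hg, rfl⟩
      obtain ⟨k, hk, h⟩ := h1 g hg
      exact ⟨k, hk, (h x).symm⟩

theorem id : IsOrbitMap (⊥ : Subgroup (O n)) id where
  isPL := isPL_linearMap LinearMap.id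
  continuous := continuous_id
  isClosedMap := IsClosedMap.id
  eq_iff x y := by simp [Subgroup.mem_bot]

end IsOrbitMap

end OrbitMaps

open scoped RealInnerProductSpace

/-! ### Reflections -/

section Reflections

variable {n : ℕ}

theorem reflectionAlong_apply {v : Euc n} (hv : ‖v‖ = 1) (x : Euc n) :
    reflectionAlong v x = x - (2 * ⟪v, x⟫) • v := by
  rw [reflectionAlong, Submodule.reflection_orthogonal_apply, Submodule.reflection_singleton_apply,
    hv]
  simp only [one_pow, RCLike.ofReal_real_eq_id, id_eq, div_one]
  rw [two_smul, mul_smul, two_smul ℝ]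
  abel

theorem reflectionAlong_self (v : Euc n) : reflectionAlong v v = -v :=
  Submodule.reflection_orthogonalComplement_singleton_eq_neg v

theorem reflectionAlong_of_inner_eq_zero {v x : Euc n} (h : ⟪v, x⟫ = 0) :
    reflectionAlong v x = x :=
  Submodule.reflection_mem_subspace_eq_self (Submodule.mem_orthogonal_singleton_iff_inner_right.2 h)

theorem reflectionAlong_apply_self (v x : Euc n) :
    reflectionAlong v (reflectionAlong v x) = x := Submodule.reflection_reflection _ x

theorem reflectionAlong_mul_self (v : Euc n) : reflectionAlong v * reflectionAlong v = 1 :=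
  LinearIsometryEquiv.ext (reflectionAlong_apply_self v)

theorem reflectionAlong_inv (v : Euc n) : (reflectionAlong v)⁻¹ = reflectionAlong v :=
  inv_eq_of_mul_eq_one_right (reflectionAlong_mul_self v)

theorem reflectionAlong_smul {a : ℝ} (ha : a ≠ 0) (v : Euc n) :
    reflectionAlong (a • v) = reflectionAlong v := by
  simp only [reflectionAlong, Submodule.span_singleton_smul_eq (IsUnit.mk0 a ha)]

theorem reflectionAlong_neg (v : Euc n) : reflectionAlong (-v) = reflectionAlong v := by
  rw [← reflectionAlong_smul (neg_ne_zero.2 one_ne_zero) v, neg_one_smul]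

theorem exists_unit_reflectionAlong {v : Euc n} (hv : v ≠ 0) :
    ∃ u, ‖u‖ = 1 ∧ reflectionAlong u = reflectionAlong v :=
  ⟨‖v‖⁻¹ • v, norm_smul_inv_norm hv,
    reflectionAlong_smul (inv_ne_zero (norm_ne_zero_iff.2 hv)) v⟩

theorem reflectionAlong_zero : reflectionAlong (0 : Euc n) = 1 :=
  LinearIsometryEquiv.ext fun _ => reflectionAlong_of_inner_eq_zero (inner_zero_left _)

theorem mul_reflectionAlong_mul_inv (g : O n) (v : Euc n) :
    g * reflectionAlong v * g⁻¹ = reflectionAlong (g v) := by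
  rcases eq_or_ne v 0 with rfl | hv
  · rw [map_zero, reflectionAlong_zero, mul_one, mul_inv_cancel]
  have hc : ‖v‖⁻¹ ≠ 0 := inv_ne_zero (norm_ne_zero_iff.2 hv)
  have hu : ‖‖v‖⁻¹ • v‖ = 1 := norm_smul_inv_norm hv
  rw [← reflectionAlong_smul hc, ← reflectionAlong_smul hc (g v), ← map_smul]
  ext1 x
  have h : ⟪‖v‖⁻¹ • v, g⁻¹ x⟫ = ⟪g (‖v‖⁻¹ • v), x⟫ := by
    rw [← g.inner_map_map]
    exact congrArg _ (g.apply_symm_apply x)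
  have h2 : g (g⁻¹ x) = x := g.apply_symm_apply x
  simp only [LinearIsometryEquiv.coe_mul, Function.comp]
  rw [reflectionAlong_apply hu, reflectionAlong_apply (by rwa [g.norm_map]), map_sub, h2, h,
    map_smul g (2 * _)]

theorem eq_or_eq_neg_of_reflectionAlong_eq {u v : Euc n} (hu : ‖u‖ = 1) (hv : ‖v‖ = 1)
    (h : reflectionAlong u = reflectionAlong v) : u = v ∨ u = -v := by
  have h1 : reflectionAlong v u = -u := by rw [← h, reflectionAlong_self]
  rw [reflectionAlong_apply hv] at h1
  have h2 : u = ⟪v, u⟫ • v := by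
    have : (2 : ℝ) • u = (2 : ℝ) • (⟪v, u⟫ • v) := by
      rw [smul_smul, two_smul, ← sub_eq_zero]
      rw [← sub_eq_zero] at h1
      rw [← h1]
      abel
    exact smul_right_injective _ two_ne_zero this
  have h3 : |⟪v, u⟫| = 1 := by
    have := congrArg norm h2
    rwa [norm_smul, hu, hv, mul_one, Real.norm_eq_abs, eq_comm] at this
  rcases (abs_eq one_pos.le).1 h3 with h | h <;> rw [h] at h2
  · left; simpa using h2
  · right; simpa using h2

theorem det_reflectionAlong {v : Euc n} (hv : v ≠ 0) :
    LinearMap.det ((reflectionAlong v).toLinearEquiv : Euc n →ₗ[ℝ] Euc n) = -1 := by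
  have := Submodule.det_reflection (K := (ℝ ∙ v)ᗮ)
  rw [Submodule.orthogonal_orthogonal, finrank_span_singleton hv, pow_one] at this
  exact this

end Reflections

/-! ### Positive systems of finite reflection groups -/

section PositiveSystems

variable {n : ℕ}

/-- `P` is the set of unit normals, on the side of `ξ`, of the reflection hyperplanes of `W`, none
of which contains `ξ`; and `W` is generated by the reflections in these hyperplanes. -/
structure IsPositiveSystem (W : Subgroup (O n)) (P : Finset (Euc n)) (ξ : Euc n) : Prop where
  mem_iff : ∀ v, v ∈ P ↔ ‖v‖ = 1 ∧ reflectionAlong v ∈ W ∧ 0 < ⟪ξ, v⟫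
  regular : ∀ v, ‖v‖ = 1 → reflectionAlong v ∈ W → ⟪ξ, v⟫ ≠ 0
  generates : W = Subgroup.closure (reflectionAlong '' (P : Set (Euc n)))

/-- The closed chamber defined by `P`. -/
def chamber (P : Finset (Euc n)) : Set (Euc n) := {x | ∀ v ∈ P, 0 ≤ ⟪v, x⟫}

/-- The positive roots whose reflections permute the other positive roots. -/
def simpleRoots (P : Finset (Euc n)) : Set (Euc n) :=
  {a | a ∈ P ∧ ∀ b ∈ P, b ≠ a → reflectionAlong a b ∈ P}

namespace IsPositiveSystem

variable {W : Subgroup (O n)} {P : Finset (Euc n)} {ξ : Euc n}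

theorem norm_eq (hP : IsPositiveSystem W P ξ) {v : Euc n} (hv : v ∈ P) : ‖v‖ = 1 :=
    ((hP.mem_iff v).1 hv).1

theorem reflection_mem (hP : IsPositiveSystem W P ξ) {v : Euc n} (hv : v ∈ P) :
    reflectionAlong v ∈ W := ((hP.mem_iff v).1 hv).2.1

theorem pos (hP : IsPositiveSystem W P ξ) {v : Euc n} (hv : v ∈ P) : 0 < ⟪ξ, v⟫ :=
    ((hP.mem_iff v).1 hv).2.2

theorem neg_notMem (hP : IsPositiveSystem W P ξ) {v : Euc n} (hv : v ∈ P) : -v ∉ P := fun h => by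
  have h1 := hP.pos hv
  have h2 := hP.pos h
  rw [inner_neg_right] at h2
  linarith

theorem mem_or_neg_mem (hP : IsPositiveSystem W P ξ) {v : Euc n} (h1 : ‖v‖ = 1)
    (h2 : reflectionAlong v ∈ W) :
    v ∈ P ∨ -v ∈ P := by
  rcases lt_or_gt_of_ne (hP.regular v h1 h2) with h | h
  · right
    exact (hP.mem_iff _).2 ⟨by rwa [norm_neg], by rwa [reflectionAlong_neg],
      by rw [inner_neg_right]; linarith⟩
  · left
    exact (hP.mem_iff _).2 ⟨h1, h2, h⟩

theorem map_mem_or (hP : IsPositiveSystem W P ξ) {g : O n}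
    (hg : g ∈ Subgroup.normalizer (W : Set (O n))) {v : Euc n}
    (hv : v ∈ P) : g v ∈ P ∨ -(g v) ∈ P :=
  hP.mem_or_neg_mem (by rw [g.norm_map, hP.norm_eq hv]) (by
    rw [← mul_reflectionAlong_mul_inv]
    exact (Subgroup.mem_normalizer_iff.1 hg _).1 (hP.reflection_mem hv))

theorem map_mem_or_of_mem (hP : IsPositiveSystem W P ξ) {w : O n} (hw : w ∈ W) {v : Euc n}
    (hv : v ∈ P) :
    w v ∈ P ∨ -(w v) ∈ P := hP.map_mem_or (Subgroup.le_normalizer hw) hv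

/-- Takes the place of writing a positive root as a nonnegative combination of simple ones. Let `R`
be the maximum of `f / ⟪ξ, ·⟫` on `P` and `a` a maximizer of least `⟪ξ, a⟫`. If `a` were not simple,
then for some `c ≠ a` in `P` also `d = -s_a c` is in `P`, and `c + d = 2⟪a, c⟫ a`. The functional
`R⟪ξ, ·⟫ - f` is nonnegative on `P` and vanishes at `a`, hence at `c` and `d`. Minimality of `a`
then forces `⟪a, c⟫ ≥ 1`, so `c = a`. -/
theorem exists_simple_pos (hP : IsPositiveSystem W P ξ) (f : Euc n →ₗ[ℝ] ℝ) {b : Euc n} (hb : b ∈ P)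
    (hf : 0 < f b) :
    ∃ a ∈ simpleRoots P, 0 < f a := by
  obtain ⟨b₀, hb₀, hmax⟩ := P.exists_max_image (fun v => f v / ⟪ξ, v⟫) ⟨b, hb⟩
  set R := f b₀ / ⟪ξ, b₀⟫ with hR
  have hRpos : 0 < R := (div_pos hf (hP.pos hb)).trans_le (hmax b hb)
  have hle : ∀ v ∈ P, f v ≤ R * ⟪ξ, v⟫ := fun v hv => (div_le_iff₀ (hP.pos hv)).1 (hmax v hv)
  obtain ⟨a, ha, hmin⟩ := (P.filter fun v => f v = R * ⟪ξ, v⟫).exists_min_image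
    (fun v => ⟪ξ, v⟫) ⟨b₀, Finset.mem_filter.2 ⟨hb₀, by
      rw [hR, div_mul_cancel₀ _ (hP.pos hb₀).ne']⟩⟩
  obtain ⟨haP, haR⟩ := Finset.mem_filter.1 ha
  have hapos := hP.pos haP
  refine ⟨a, ⟨haP, fun c hc hca => ?_⟩, by rw [haR]; positivity⟩
  by_contra hcon
  have hd : -(reflectionAlong a c) ∈ P :=
    (hP.map_mem_or_of_mem (hP.reflection_mem haP) hc).resolve_left hcon
  set d := -(reflectionAlong a c) with hd'
  have hsum : d = (2 * ⟪a, c⟫) • a - c := by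
    rw [hd', reflectionAlong_apply (hP.norm_eq haP), neg_sub]
  have h1 := hle c hc
  have h2 := hle d hd
  have hfd : f d = 2 * ⟪a, c⟫ * f a - f c := by rw [hsum, map_sub, map_smul, smul_eq_mul]
  have hξd : ⟪ξ, d⟫ = 2 * ⟪a, c⟫ * ⟪ξ, a⟫ - ⟪ξ, c⟫ := by
    rw [hsum, inner_sub_right, inner_smul_right]
  have h3 : f d + f c = R * ⟪ξ, d⟫ + R * ⟪ξ, c⟫ := by rw [hfd, hξd, haR]; ring
  have hcm := hmin c (Finset.mem_filter.2 ⟨hc, by linarith⟩)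
  have hdm := hmin d (Finset.mem_filter.2 ⟨hd, by linarith⟩)
  have h4 : 1 ≤ ⟪a, c⟫ := by
    by_contra hlt
    nlinarith
  have h5 : ⟪a, c⟫ = 1 := by
    refine le_antisymm ?_ h4
    have := real_inner_le_norm a c
    rwa [hP.norm_eq haP, hP.norm_eq hc, one_mul] at this
  exact hca ((inner_eq_one_iff_of_norm_eq_one (hP.norm_eq haP) (hP.norm_eq hc)).1 h5).symm

theorem simple_reflection_mem (hP : IsPositiveSystem W P ξ) {a : Euc n} (ha : a ∈ simpleRoots P) :
    reflectionAlong a ∈ W :=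
  hP.reflection_mem ha.1

/-- Descent on `⟪ξ, c⟫` over positive roots `c` with reflection outside the closure: some simple `a`
has `⟪a, c⟫ > 0`, so `s_a c` is a lower positive root, and the reflections along `c` and `s_a c` are
conjugate by `s_a`. -/
theorem closure_simple (hP : IsPositiveSystem W P ξ) : W = Subgroup.closure
    (reflectionAlong '' simpleRoots P) := by
  refine le_antisymm ?_ ?_
  · conv_lhs => rw [hP.generates]
    rw [Subgroup.closure_le]
    by_contra hcon
    obtain ⟨_, ⟨b, hb, rfl⟩, hb'⟩ := not_subset.1 hcon
    classical
    obtain ⟨c, hc, hmin⟩ := (P.filter fun v => reflectionAlong v ∉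
      Subgroup.closure (reflectionAlong '' simpleRoots P)).exists_min_image
      (fun v => ⟪ξ, v⟫) ⟨b, Finset.mem_filter.2 ⟨hb, hb'⟩⟩
    obtain ⟨hcP, hc'⟩ := Finset.mem_filter.1 hc
    obtain ⟨a, ha, hac⟩ := hP.exists_simple_pos (innerₛₗ ℝ c) hcP (by
      rw [innerₛₗ_apply_apply, real_inner_self_eq_norm_sq, hP.norm_eq hcP]; norm_num)
    rw [innerₛₗ_apply_apply, real_inner_comm] at hac
    have haW : reflectionAlong a ∈ Subgroup.closure (reflectionAlong '' simpleRoots P) :=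
      Subgroup.subset_closure ⟨a, ha, rfl⟩
    have hca : c ≠ a := by
      rintro rfl
      exact hc' haW
    have hd := ha.2 c hcP hca
    have hlt : ⟪ξ, reflectionAlong a c⟫ < ⟪ξ, c⟫ := by
      rw [reflectionAlong_apply (hP.norm_eq ha.1), inner_sub_right, inner_smul_right]
      have := hP.pos ha.1
      have : 0 < 2 * ⟪a, c⟫ * ⟪ξ, a⟫ := by positivity
      linarith
    refine hc' ?_
    by_contra hc''
    have hdW : reflectionAlong (reflectionAlong a c) ∈
        Subgroup.closure (reflectionAlong '' simpleRoots P) := by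
      by_contra h
      exact absurd (hmin _ (Finset.mem_filter.2 ⟨hd, h⟩)) (not_le.2 hlt)
    rw [← mul_reflectionAlong_mul_inv] at hdW
    refine hc'' ?_
    have := Subgroup.mul_mem _ (Subgroup.mul_mem _ (Subgroup.inv_mem _ haW) hdW) haW
    simpa [mul_assoc] using this
  · rw [Subgroup.closure_le]
    rintro _ ⟨a, ha, rfl⟩
    exact hP.simple_reflection_mem ha

theorem exists_list (hP : IsPositiveSystem W P ξ) {w : O n} (hw : w ∈ W) :
    ∃ L : List (Euc n), (∀ a ∈ L, a ∈ simpleRoots P) ∧ w = (L.map reflectionAlong).prod := by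
  rw [hP.closure_simple] at hw
  induction hw using Subgroup.closure_induction with
  | mem x hx =>
    obtain ⟨a, ha, rfl⟩ := hx
    exact ⟨[a], by simpa using ha, by simp⟩
  | one => exact ⟨[], by simp, by simp⟩
  | mul x y _ _ hx hy =>
    obtain ⟨L, hL, rfl⟩ := hx
    obtain ⟨M, hM, rfl⟩ := hy
    refine ⟨L ++ M, fun a ha => ?_, by simp⟩
    rcases List.mem_append.1 ha with h | h
    exacts [hL a h, hM a h]
  | inv x _ hx =>
    obtain ⟨L, hL, rfl⟩ := hx
    refine ⟨L.reverse, fun a ha => hL a (List.mem_reverse.1 ha), ?_⟩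
    rw [List.prod_inv_reverse, List.map_reverse, List.map_map]
    exact congrArg _ (congrArg _ (List.map_congr_left fun a _ => reflectionAlong_inv a))

/-- The exchange condition. -/
theorem exchange {a : Euc n} (ha : a ∈ simpleRoots P) (L : List (Euc n))
    (hL : ∀ b ∈ L, b ∈ simpleRoots P) (h : (L.map reflectionAlong).prod a ∉ P) :
    ∃ M : List (Euc n), (∀ b ∈ M, b ∈ simpleRoots P) ∧ M.length + 1 = L.length ∧
      (L.map reflectionAlong).prod * reflectionAlong a = (M.map reflectionAlong).prod := by
  induction L with
  | nil => exact absurd ha.1 h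
  | cons b L ih =>
    have hL' : ∀ c ∈ L, c ∈ simpleRoots P := fun c hc => hL c (List.mem_cons_of_mem _ hc)
    have hb : b ∈ simpleRoots P := hL b List.mem_cons_self
    rw [List.map_cons, List.prod_cons] at h ⊢
    by_cases h1 : (L.map reflectionAlong).prod a ∈ P
    · have h2 : (L.map reflectionAlong).prod a = b := by
        by_contra hne
        exact h (hb.2 _ h1 hne)
      refine ⟨L, hL', rfl, ?_⟩
      rw [← h2, ← mul_reflectionAlong_mul_inv, inv_mul_cancel_right, mul_assoc,
        reflectionAlong_mul_self, mul_one]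
    · obtain ⟨M, hM, hl, h2⟩ := ih hL' h1
      refine ⟨b :: M, ?_, by simp [hl], by rw [mul_assoc, h2, List.map_cons, List.prod_cons]⟩
      intro c hc
      rcases List.mem_cons.1 hc with rfl | hc
      exacts [hb, hM c hc]

/-- `W` acts freely on its positive systems. -/
theorem eq_one_of_map_mem (hP : IsPositiveSystem W P ξ) {w : O n} (hw : w ∈ W)
    (h : ∀ v ∈ P, w v ∈ P) : w = 1 := by
  obtain ⟨L, hL, rfl⟩ := hP.exists_list hw
  induction hk : L.length using Nat.strong_induction_on generalizing L with
  | _ k ih =>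
    rcases L.eq_nil_or_concat with rfl | ⟨L, a, rfl⟩
    · rfl
    rw [List.concat_eq_append] at *
    have ha : a ∈ simpleRoots P := hL a (by simp)
    have hL' : ∀ b ∈ L, b ∈ simpleRoots P := fun b hb => hL b (by simp [hb])
    have heq : ((L ++ [a]).map reflectionAlong).prod =
      (L.map reflectionAlong).prod * reflectionAlong a := by simp
    -- As `s_a a = -a`, a word ending in `s_a` keeps `a` positive only if its initial part makes `a`
    -- negative; exchange then yields a shorter word for the same element.
    have h1 : (L.map reflectionAlong).prod a ∉ P := by
      intro h2
      have h3 := h a ha.1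
      rw [heq, LinearIsometryEquiv.coe_mul, Function.comp, reflectionAlong_self, map_neg] at h3
      exact hP.neg_notMem h2 h3
    obtain ⟨M, hM, hl, h2⟩ := exchange ha L hL' h1
    rw [heq, h2] at h hw ⊢
    exact ih M.length (by simp at hk; omega) M hM hw h rfl

theorem exists_simple_map_notMem (hP : IsPositiveSystem W P ξ) {w : O n} (hw : w ∈ W) {b : Euc n}
    (hb : b ∈ P)
    (hwb : w b ∉ P) : ∃ a ∈ simpleRoots P, w a ∉ P := by
  have h1 := hP.pos ((hP.map_mem_or_of_mem hw hb).resolve_left hwb)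
  obtain ⟨a, ha, h2⟩ := hP.exists_simple_pos
    (-(innerₛₗ ℝ ξ ∘ₗ (w.toLinearEquiv : Euc n →ₗ[ℝ] Euc n))) hb (by
      simpa [inner_neg_right] using h1)
  refine ⟨a, ha, fun h3 => ?_⟩
  have h4 := hP.pos h3
  have h5 : 0 < -⟪ξ, w a⟫ := h2
  linarith

/-- The chamber is a strict fundamental domain. -/
theorem eq_of_mem_chamber (hP : IsPositiveSystem W P ξ) {w : O n} (hw : w ∈ W) {x : Euc n}
    (hx : x ∈ chamber P)
    (hwx : w x ∈ chamber P) : w x = x := by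
  classical
  -- Induction on the number of positive roots made negative by `w`. A simple one, `a`, must be
  -- orthogonal to `x`, so `w * s_a` moves `x` as `w` does and makes fewer roots negative.
  induction hk : (P.filter fun b => w b ∉ P).card using Nat.strong_induction_on
    generalizing w with
  | _ k ih =>
    by_cases hall : ∀ b ∈ P, w b ∈ P
    · rw [hP.eq_one_of_map_mem hw hall]
      rfl
    push Not at hall
    obtain ⟨b, hb, hwb⟩ := hall
    obtain ⟨a, ha, hwa⟩ := hP.exists_simple_map_notMem hw hb hwb
    have hna := (hP.map_mem_or_of_mem hw ha.1).resolve_left hwa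
    have hax : ⟪a, x⟫ = 0 := by
      refine le_antisymm ?_ (hx a ha.1)
      have := hwx _ hna
      rw [inner_neg_left, w.inner_map_map] at this
      linarith
    have hsx := reflectionAlong_of_inner_eq_zero hax
    have hws : (w * reflectionAlong a) x = w x := by
      rw [LinearIsometryEquiv.coe_mul, Function.comp, hsx]
    rw [← hws]
    refine ih _ ?_ (W.mul_mem hw (hP.simple_reflection_mem ha)) (by rwa [hws]) rfl
    rw [← hk]
    rw [← Finset.card_image_of_injective _ (reflectionAlong a).injective]
    -- The reflection `s_a` embeds the positive roots made negative by `w * s_a` into those made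
    -- negative by `w`, and misses `a`.
    refine Finset.card_lt_card ((Finset.ssubset_iff_of_subset ?_).2
      ⟨a, Finset.mem_filter.2 ⟨ha.1, hwa⟩, ?_⟩)
    · intro c hc
      obtain ⟨b, hb, rfl⟩ := Finset.mem_image.1 hc
      obtain ⟨hbP, hb⟩ := Finset.mem_filter.1 hb
      refine Finset.mem_filter.2 ⟨ha.2 b hbP ?_, hb⟩
      rintro rfl
      refine hb ?_
      rw [LinearIsometryEquiv.coe_mul, Function.comp, reflectionAlong_self, map_neg]
      exact hna
    · intro h
      obtain ⟨b, hb, hba⟩ := Finset.mem_image.1 h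
      have : b = -a := by
        rw [← reflectionAlong_apply_self a b, hba, reflectionAlong_self]
      exact hP.neg_notMem ha.1 (this ▸ (Finset.mem_filter.1 hb).1)

/-- Take the point of the orbit with the largest inner product with `ξ`: if it were on the negative
side of a root `a`, reflecting along `a` would increase that product. -/
theorem exists_map_mem_chamber (hP : IsPositiveSystem W P ξ) [Finite W] (x : Euc n) :
    ∃ w ∈ W, w x ∈ chamber P := by
  obtain ⟨w, hmax⟩ := Finite.exists_max fun w : W => ⟪ξ, (w : O n) x⟫
  refine ⟨w, w.2, fun a ha => ?_⟩
  have h := hmax ⟨reflectionAlong a * w, W.mul_mem (hP.reflection_mem ha) w.2⟩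
  simp only [LinearIsometryEquiv.coe_mul, Function.comp, reflectionAlong_apply (hP.norm_eq ha),
    inner_sub_right, inner_smul_right] at h
  have := hP.pos ha
  by_contra! hneg
  nlinarith

/-- `W` acts transitively on its positive systems. -/
theorem exists_mul_map_mem (hP : IsPositiveSystem W P ξ) [Finite W] {g : O n}
    (hg : g ∈ Subgroup.normalizer (W : Set (O n))) :
    ∃ w ∈ W, ∀ v ∈ P, (w * g) v ∈ P := by
  -- Roots positive on `ξ` become positive on `w (g ξ)`, which lies in the chamber, so their
  -- negatives cannot be in `P`.
  obtain ⟨w, hw, h⟩ := hP.exists_map_mem_chamber (g ξ)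
  refine ⟨w, hw, fun v hv => ?_⟩
  refine (hP.map_mem_or (Subgroup.mul_mem _ (Subgroup.le_normalizer hw) hg) hv).resolve_right ?_
  intro hneg
  have h1 := h _ hneg
  have h2 : ⟪(w * g) v, w (g ξ)⟫ = ⟪v, ξ⟫ := (w * g).inner_map_map v ξ
  rw [inner_neg_left, h2, real_inner_comm] at h1
  linarith [hP.pos hv]

end IsPositiveSystem

end PositiveSystems

/-! ### Determinants and fixed spaces -/

section Linear

variable {n : ℕ}

/-- The determinant, as a homomorphism on `O_n`. -/
def detHom (n : ℕ) : O n →* ℝ where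
  toFun g := LinearMap.det (g.toLinearEquiv : Euc n →ₗ[ℝ] Euc n)
  map_one' := LinearMap.det_id
  map_mul' a b := LinearMap.det_comp (a.toLinearEquiv : Euc n →ₗ[ℝ] Euc n)
    (b.toLinearEquiv : Euc n →ₗ[ℝ] Euc n)

theorem mem_orientationPreserving {G : Subgroup (O n)} {g : O n} :
    g ∈ orientationPreserving G ↔ g ∈ G ∧ detHom n g = 1 := Iff.rfl

theorem detHom_reflectionAlong {v : Euc n} (hv : ‖v‖ = 1) :
    detHom n (reflectionAlong v) = -1 :=
  det_reflectionAlong (norm_ne_zero_iff.1 (by rw [hv]; exact one_ne_zero))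

theorem eq_one_or_unit (v : Euc n) :
    reflectionAlong v = 1 ∨ ∃ u, ‖u‖ = 1 ∧ reflectionAlong v = reflectionAlong u := by
  rcases eq_or_ne v 0 with rfl | hv
  · exact Or.inl reflectionAlong_zero
  · obtain ⟨u, hu, h⟩ := exists_unit_reflectionAlong hv
    exact Or.inr ⟨u, hu, h.symm⟩

theorem detHom_eq (g : O n) : detHom n g = 1 ∨ detHom n g = -1 := by
  obtain ⟨l, -, rfl⟩ := g.reflections_generate_dim
  induction l with
  | nil => left; simp
  | cons v l ih =>
    rw [List.map_cons, List.prod_cons, map_mul]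
    have h : detHom n (reflectionAlong v) = 1 ∨ detHom n (reflectionAlong v) = -1 := by
      rcases eq_one_or_unit v with h | ⟨u, hu, h⟩ <;> rw [h]
      · left; exact map_one _
      · right; exact detHom_reflectionAlong hu
    change detHom n (reflectionAlong v) * _ = 1 ∨ detHom n (reflectionAlong v) * _ = -1
    rcases h with h | h <;> rcases ih with h' | h' <;> rw [h, h'] <;> norm_num

theorem fixCodim_eq_finrank {g : O n} {K : Submodule ℝ (Euc n)} (h : ∀ x, g x = x ↔ x ∈ Kᗮ) :
    fixCodim g = Module.finrank ℝ K := by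
  have h1 : LinearMap.eqLocus (g.toLinearEquiv : Euc n →ₗ[ℝ] Euc n) LinearMap.id = Kᗮ := by
    ext x
    exact h x
  have h2 := Kᗮ.finrank_quotient_add_finrank
  have h3 := K.finrank_add_finrank_orthogonal
  rw [fixCodim, h1]
  omega

theorem fixCodim_le {g h : O n} (hgh : ∀ x, h x = x → g x = x) : fixCodim g ≤ fixCodim h := by
  have h1 := (LinearMap.eqLocus (g.toLinearEquiv : Euc n →ₗ[ℝ] Euc n)
    LinearMap.id).finrank_quotient_add_finrank
  have h2 := (LinearMap.eqLocus (h.toLinearEquiv : Euc n →ₗ[ℝ] Euc n)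
    LinearMap.id).finrank_quotient_add_finrank
  have h3 := Submodule.finrank_mono (R := ℝ)
    (s := LinearMap.eqLocus (h.toLinearEquiv : Euc n →ₗ[ℝ] Euc n) LinearMap.id)
    (t := LinearMap.eqLocus (g.toLinearEquiv : Euc n →ₗ[ℝ] Euc n) LinearMap.id)
    fun x hx => hgh x hx
  rw [fixCodim, fixCodim]
  omega

theorem fixCodim_one : fixCodim (1 : O n) = 0 := by
  rw [fixCodim_eq_finrank (K := ⊥) (by simp), finrank_bot]

theorem fixCodim_reflectionAlong {v : Euc n} (hv : v ≠ 0) : fixCodim (reflectionAlong v) = 1 := by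
  rw [fixCodim_eq_finrank (g := reflectionAlong v) (K := ℝ ∙ v) fun x =>
    Submodule.reflection_eq_self_iff x, finrank_span_singleton hv]

theorem isReflection_reflectionAlong {v : Euc n} (hv : ‖v‖ = 1) : IsReflection
    (reflectionAlong v) :=
  fixCodim_reflectionAlong (norm_ne_zero_iff.1 (by rw [hv]; exact one_ne_zero))

/-- A fixed point has the same image under both reflections, so `⟪v, x⟫ v = ⟪u, x⟫ u`; a nonzero
common value would make `u` and `v` parallel and the product trivial. -/
theorem inner_eq_zero_of_mul_fix {u v : Euc n} (hu : ‖u‖ = 1) (hv : ‖v‖ = 1)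
    (huv : reflectionAlong u * reflectionAlong v ≠ 1) {x : Euc n}
    (hx : (reflectionAlong u * reflectionAlong v) x = x) : ⟪u, x⟫ = 0 ∧ ⟪v, x⟫ = 0 := by
  have h1 : reflectionAlong v x = reflectionAlong u x := by
    conv_rhs => rw [← hx]
    exact (reflectionAlong_apply_self u _).symm
  rw [reflectionAlong_apply hu, reflectionAlong_apply hv, sub_right_inj] at h1
  by_cases h2 : ⟪v, x⟫ = 0
  · refine ⟨?_, h2⟩
    rw [h2, mul_zero, zero_smul, eq_comm, smul_eq_zero] at h1
    rcases h1 with h1 | h1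
    · linarith
    · rw [h1, inner_zero_left]
  · exfalso
    refine huv ?_
    have h3 : v = ((2 * ⟪v, x⟫)⁻¹ * (2 * ⟪u, x⟫)) • u := by
      rw [mul_smul, ← h1, smul_smul, inv_mul_cancel₀ (by simpa using h2), one_smul]
    have h4 : (2 * ⟪v, x⟫)⁻¹ * (2 * ⟪u, x⟫) ≠ 0 := by
      intro h4
      rw [h4, zero_smul] at h3
      rw [h3, norm_zero] at hv
      exact zero_ne_one hv
    rw [h3, reflectionAlong_smul h4, reflectionAlong_mul_self]

theorem isRotation_mul {u v : Euc n} (hu : ‖u‖ = 1) (hv : ‖v‖ = 1)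
    (huv : reflectionAlong u * reflectionAlong v ≠ 1) :
    IsRotation (reflectionAlong u * reflectionAlong v) := by
  have hli : LinearIndependent ℝ ![u, v] := by
    rw [LinearIndependent.pair_iff' (norm_ne_zero_iff.1 (by rw [hu]; exact one_ne_zero))]
    rintro a rfl
    have ha : a ≠ 0 := by
      rintro rfl
      simp at hv
    exact huv (by rw [reflectionAlong_smul ha, reflectionAlong_mul_self])
  have h := finrank_span_eq_card hli
  rw [Fintype.card_fin] at h
  refine (fixCodim_eq_finrank fun x => ?_).trans h
  have hspan : x ∈ (Submodule.span ℝ (range ![u, v]))ᗮ ↔ ⟪u, x⟫ = 0 ∧ ⟪v, x⟫ = 0 := by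
    rw [Matrix.range_cons, Matrix.range_cons, Matrix.range_empty, union_empty,
      Submodule.span_union, ← Submodule.inf_orthogonal, Submodule.mem_inf,
      Submodule.mem_orthogonal_singleton_iff_inner_right,
      Submodule.mem_orthogonal_singleton_iff_inner_right]
  rw [hspan]
  refine ⟨inner_eq_zero_of_mul_fix hu hv huv, fun ⟨h1, h2⟩ => ?_⟩
  rw [LinearIsometryEquiv.coe_mul, Function.comp, reflectionAlong_of_inner_eq_zero h2,
    reflectionAlong_of_inner_eq_zero h1]

/-- The Cartan–Dieudonné theorem with its sharp length bound; it classifies the elements of small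
fixed codimension. -/
theorem exists_list_fixCodim (g : O n) :
    ∃ l : List (Euc n), l.length ≤ fixCodim g ∧ g = (l.map reflectionAlong).prod := by
  refine g.reflections_generate_dim_aux (le_of_eq ?_)
  refine (fixCodim_eq_finrank fun x => ?_).symm
  rw [Submodule.orthogonal_orthogonal]
  change g x = x ↔ x - g x = 0
  rw [sub_eq_zero, eq_comm]

theorem of_fixCodim_le_one {g : O n} (h : fixCodim g ≤ 1) :
    g = 1 ∨ ∃ v, ‖v‖ = 1 ∧ g = reflectionAlong v := by
  obtain ⟨l, hl, rfl⟩ := exists_list_fixCodim g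
  match l, hl.trans h with
  | [], _ => exact Or.inl rfl
  | [v], _ =>
    rw [List.map_singleton, List.prod_singleton]
    exact eq_one_or_unit v

theorem of_fixCodim_le_two {g : O n} (h : fixCodim g ≤ 2) :
    g = 1 ∨ (∃ v, ‖v‖ = 1 ∧ g = reflectionAlong v) ∨
      ∃ u v, ‖u‖ = 1 ∧ ‖v‖ = 1 ∧ g = reflectionAlong u * reflectionAlong v := by
  obtain ⟨l, hl, rfl⟩ := exists_list_fixCodim g
  match l, hl.trans h with
  | [], _ => exact Or.inl rfl
  | [v], _ =>
    rw [List.map_singleton, List.prod_singleton]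
    rcases eq_one_or_unit v with h | h
    exacts [Or.inl h, Or.inr (Or.inl h)]
  | [u, v], _ =>
    rw [List.map_cons, List.map_singleton, List.prod_cons, List.prod_singleton]
    rcases eq_one_or_unit u with h | ⟨u', hu, h⟩ <;> rcases eq_one_or_unit v with h' | ⟨v', hv, h'⟩
    · left; rw [h, h', one_mul]
    · right; left; exact ⟨v', hv, by rw [h, h', one_mul]⟩
    · right; left; exact ⟨u', hu, by rw [h, h', mul_one]⟩
    · right; right; exact ⟨u', v', hu, hv, by rw [h, h']⟩

theorem isReflection_iff {g : O n} : IsReflection g ↔ ∃ v, ‖v‖ = 1 ∧ g = reflectionAlong v := by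
  constructor
  · intro h
    refine (of_fixCodim_le_one (le_of_eq h)).resolve_left ?_
    rintro rfl
    have h' : fixCodim (1 : O n) = 1 := h
    rw [fixCodim_one] at h'
    exact zero_ne_one h'
  · rintro ⟨v, hv, rfl⟩
    exact isReflection_reflectionAlong hv

theorem IsReflection.detHom_eq {g : O n} (h : IsReflection g) : detHom n g = -1 := by
  obtain ⟨v, hv, rfl⟩ := isReflection_iff.1 h
  exact detHom_reflectionAlong hv

theorem IsRotation.exists_eq_mul {g : O n} (h : IsRotation g) :
    ∃ u v, ‖u‖ = 1 ∧ ‖v‖ = 1 ∧ g = reflectionAlong u * reflectionAlong v := by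
  have h' : fixCodim g = 2 := h
  rcases of_fixCodim_le_two h'.le with rfl | ⟨v, hv, rfl⟩ | h
  · rw [fixCodim_one] at h'
    omega
  · have h2 : fixCodim (reflectionAlong v) = 1 := isReflection_reflectionAlong hv
    omega
  · exact h

theorem IsRotation.detHom_eq {g : O n} (h : IsRotation g) : detHom n g = 1 := by
  obtain ⟨u, v, hu, hv, rfl⟩ := h.exists_eq_mul
  rw [map_mul, detHom_reflectionAlong hu, detHom_reflectionAlong hv]
  norm_num

theorem not_isReflection_of_le {G : Subgroup (O n)} (hG : ∀ g ∈ G, detHom n g = 1) :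
    ¬ ∃ g ∈ G, IsReflection g := by
  rintro ⟨g, hg, h⟩
  have h1 := hG g hg
  rw [h.detHom_eq] at h1
  norm_num at h1

end Linear

/-! ### Existence of positive systems -/

section Existence

variable {n : ℕ}

theorem exists_small {E : Type*} (P : Finset E) (a b : E → ℝ) :
    ∃ ε : ℝ, 0 < ε ∧ ∀ v ∈ P, 0 < a v → 0 < a v + ε * b v := by
  have h : ∀ᶠ ε : ℝ in 𝓝[>] 0, ∀ v ∈ P, 0 < a v → 0 < a v + ε * b v := by
    rw [Filter.eventually_all_finset]
    intro v _
    by_cases hv : 0 < a v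
    · have hc : Continuous fun ε : ℝ => a v + ε * b v := by fun_prop
      refine nhdsWithin_le_nhds ((continuousAt_const.eventually_lt hc.continuousAt ?_).mono
        fun ε h _ => h)
      simpa using hv
    · exact Filter.Eventually.of_forall fun ε h => absurd h hv
  obtain ⟨ε, h1, h2⟩ := (h.and self_mem_nhdsWithin).exists
  exact ⟨ε, h2, h1⟩

/-- A real vector space is not a finite union of proper subspaces, here the intersections of `V`
with the hyperplanes that do not contain it. -/
theorem exists_generic {R : Set (Euc n)} (hR : R.Finite) (V : Submodule ℝ (Euc n)) :
    ∃ x ∈ V, ∀ v ∈ R, (∃ y ∈ V, ⟪v, y⟫ ≠ 0) → ⟪v, x⟫ ≠ 0 := by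
  let ι := {v : Euc n // v ∈ R ∧ ∃ y ∈ V, ⟪v, y⟫ ≠ 0}
  have : Finite ι := (hR.subset fun v (hv : v ∈ R ∧ _) => hv.1).to_subtype
  obtain ⟨x, hx, h⟩ := Module.Dual.exists_forall_mem_ne_zero_of_forall_exists V
    (fun v : ι => innerₛₗ ℝ (v : Euc n)) fun v => v.2.2
  exact ⟨x, hx, fun v hv hy => h ⟨v, hv, hy⟩⟩

theorem finite_roots (W : Subgroup (O n)) [Finite W] :
    {v : Euc n | ‖v‖ = 1 ∧ reflectionAlong v ∈ W}.Finite := by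
  have h : {v : Euc n | ‖v‖ = 1 ∧ reflectionAlong v ∈ W} ⊆
      ⋃ g : W, {v : Euc n | ‖v‖ = 1 ∧ reflectionAlong v = g} := fun v hv =>
    mem_iUnion.2 ⟨⟨_, hv.2⟩, hv.1, rfl⟩
  refine (finite_iUnion fun g => ?_).subset h
  rcases {v : Euc n | ‖v‖ = 1 ∧ reflectionAlong v = g}.eq_empty_or_nonempty with h | ⟨u, hu, hug⟩
  · rw [h]
    exact finite_empty
  · refine (toFinite {u, -u}).subset ?_
    rintro v ⟨hv, hvg⟩
    exact eq_or_eq_neg_of_reflectionAlong_eq hv hu (hvg.trans hug.symm)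

/-- Positive systems exist, with the chamber adjacent to a given subspace `V`. -/
theorem exists_isPositiveSystem {W : Subgroup (O n)} (hW : IsReflectionGroup W)
    (V : Submodule ℝ (Euc n)) : ∃ P ξ, IsPositiveSystem W P ξ ∧
      ∃ x ∈ V, ∀ v ∈ P, (∀ y ∈ V, ⟪v, y⟫ = 0) ∨ 0 < ⟪v, x⟫ := by
  classical
  have := hW.1
  have hfin := finite_roots W
  obtain ⟨x, hxV, hx⟩ := exists_generic hfin V
  obtain ⟨η, -, hη⟩ := exists_generic hfin ⊤
  have hη' : ∀ v, ‖v‖ = 1 → reflectionAlong v ∈ W → ⟪v, η⟫ ≠ 0 := fun v h1 h2 =>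
    hη v ⟨h1, h2⟩ ⟨v, trivial, by rw [real_inner_self_eq_norm_sq, h1]; norm_num⟩
  -- In `ξ = x + ε η` the generic point `x` of `V` decides the sign of every root not orthogonal to
  -- `V`; `η` decides only the remaining ones.
  obtain ⟨ε, hε, h⟩ := exists_small hfin.toFinset (fun v => ⟪v, x⟫) (fun v => ⟪v, η⟫)
  have h' : ∀ v, ‖v‖ = 1 → reflectionAlong v ∈ W → 0 < ⟪v, x⟫ → 0 < ⟪x + ε • η, v⟫ := by
    intro v h1 h2 h3
    rw [real_inner_comm, inner_add_right, inner_smul_right]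
    exact h v (hfin.mem_toFinset.2 ⟨h1, h2⟩) h3
  have hneg : ∀ v, ‖v‖ = 1 → reflectionAlong v ∈ W → ⟪v, x⟫ < 0 → ⟪x + ε • η, v⟫ < 0 := by
    intro v h1 h2 h3
    have := h' (-v) (by rwa [norm_neg]) (by rwa [reflectionAlong_neg]) (by
      rw [inner_neg_left]; linarith)
    rw [inner_neg_right] at this
    linarith
  have hreg : ∀ v, ‖v‖ = 1 → reflectionAlong v ∈ W → ⟪x + ε • η, v⟫ ≠ 0 := by
    intro v h1 h2
    rcases lt_trichotomy ⟪v, x⟫ 0 with h3 | h3 | h3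
    · exact (hneg v h1 h2 h3).ne
    · rw [real_inner_comm, inner_add_right, inner_smul_right, h3, zero_add]
      exact mul_ne_zero hε.ne' (hη' v h1 h2)
    · exact (h' v h1 h2 h3).ne'
  have hmem : ∀ v, v ∈ hfin.toFinset.filter (fun v => 0 < ⟪x + ε • η, v⟫) ↔
      ‖v‖ = 1 ∧ reflectionAlong v ∈ W ∧ 0 < ⟪x + ε • η, v⟫ := by
    intro v
    rw [Finset.mem_filter, hfin.mem_toFinset, and_assoc.symm]
    rfl
  refine ⟨hfin.toFinset.filter fun v => 0 < ⟪x + ε • η, v⟫, x + ε • η, ⟨hmem, hreg, ?_⟩,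
    x, hxV, ?_⟩
  · refine le_antisymm ?_ ?_
    · conv_lhs => rw [hW.2]
      rw [Subgroup.closure_le]
      rintro g ⟨hg, hgr⟩
      obtain ⟨v, hv, rfl⟩ := isReflection_iff.1 hgr
      rcases lt_or_gt_of_ne (hreg v hv hg) with h3 | h3
      · rw [← reflectionAlong_neg]
        refine Subgroup.subset_closure ⟨-v, (hmem _).2 ⟨by rwa [norm_neg], by
          rwa [reflectionAlong_neg], ?_⟩, rfl⟩
        rw [inner_neg_right]
        linarith
      · exact Subgroup.subset_closure ⟨v, (hmem v).2 ⟨hv, hg, h3⟩, rfl⟩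
    · rw [Subgroup.closure_le]
      rintro _ ⟨v, hv, rfl⟩
      exact ((hmem v).1 hv).2.1
  · intro v hv
    obtain ⟨h1, h2, h3⟩ := (hmem v).1 hv
    by_cases hy : ∃ y ∈ V, ⟪v, y⟫ ≠ 0
    · right
      have h4 := hx v ⟨h1, h2⟩ hy
      rcases lt_or_gt_of_ne h4 with h5 | h5
      · exact absurd h3 (hneg v h1 h2 h5).not_gt
      · exact h5
    · left
      push Not at hy
      exact hy

/-- If `w g` fixes `V` pointwise and `g` preserves a chamber adjacent to `V`, then `g` fixes `V`
pointwise. -/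
theorem IsPositiveSystem.fix_of_mul_fix {W : Subgroup (O n)} {P : Finset (Euc n)} {ξ : Euc n}
    (hP : IsPositiveSystem W P ξ) {V : Submodule ℝ (Euc n)} {x : Euc n} (hxV : x ∈ V)
    (hx : ∀ v ∈ P, (∀ y ∈ V, ⟪v, y⟫ = 0) ∨ 0 < ⟪v, x⟫) {w g : O n} (hw : w ∈ W)
    (hg : ∀ v, g v ∈ P ↔ v ∈ P) (hV : ∀ y ∈ V, (w * g) y = y) {y : Euc n} (hy : y ∈ V) :
    g y = y := by
  -- Both `g z` and `w (g z) = z` lie in the chamber, so they coincide. The chamber points `x` and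
  -- `x + ε y` of `V` then give the claim for any `y ∈ V` by linearity.
  have key : ∀ z ∈ V, z ∈ chamber P → g z = z := by
    intro z hz hzC
    have h1 : w (g z) = z := hV z hz
    have h2 : g z ∈ chamber P := by
      intro v hv
      have h3 : g (g⁻¹ v) = v := g.apply_symm_apply v
      rw [← h3, g.inner_map_map]
      exact hzC _ ((hg _).1 (by rwa [h3]))
    have := hP.eq_of_mem_chamber hw h2 (by rwa [h1])
    rw [← this, h1]
  have hxC : x ∈ chamber P := fun v hv => (hx v hv).elim (fun h => (h x hxV).ge) le_of_lt
  obtain ⟨ε, hε, h⟩ := exists_small P (fun v => ⟪v, x⟫) (fun v => ⟪v, y⟫)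
  have h1 : x + ε • y ∈ chamber P := by
    intro v hv
    rcases hx v hv with h2 | h2
    · exact (h2 _ (V.add_mem hxV (V.smul_mem _ hy))).ge
    · have := h v hv h2
      rw [inner_add_right, inner_smul_right]
      exact this.le
  have h2 := key _ (V.add_mem hxV (V.smul_mem _ hy)) h1
  rw [map_add, map_smul, key x hxV hxC, add_right_inj] at h2
  exact smul_right_injective _ hε.ne' h2

end Existence

/-! ### Straightening a chamber -/

section Straighten

variable {n : ℕ}

/-- The elements of `G` preserving `P`. -/
def chamberStabilizer (G : Subgroup (O n)) (P : Finset (Euc n)) : Subgroup (O n) where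
  carrier := {g | g ∈ G ∧ ∀ v, g v ∈ P ↔ v ∈ P}
  one_mem' := ⟨G.one_mem, fun _ => Iff.rfl⟩
  mul_mem' := fun {a b} ha hb => ⟨G.mul_mem ha.1 hb.1, fun v => (ha.2 (b v)).trans (hb.2 v)⟩
  inv_mem' := fun {a} ha => ⟨G.inv_mem ha.1, fun v => by
    have h : a (a⁻¹ v) = v := a.apply_symm_apply v
    rw [← ha.2, h]⟩

theorem map_mem_iff_of_forall {P : Finset (Euc n)} {g : O n} (h : ∀ v ∈ P, g v ∈ P) (v : Euc n) :
    g v ∈ P ↔ v ∈ P := by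
  classical
  refine ⟨fun hv => ?_, h v⟩
  have : P.image g = P := Finset.eq_of_subset_of_card_le (Finset.image_subset_iff.2 h)
    (Finset.card_image_of_injective _ g.injective).ge
  rw [← this] at hv
  obtain ⟨u, hu, huv⟩ := Finset.mem_image.1 hv
  rwa [← g.injective huv]

/-- Sum `ξ` over the stabilizer of `P` and normalize. Each summand is positive on `P`, so the sum is
interior and nonzero. -/
theorem IsPositiveSystem.exists_center {W : Subgroup (O n)} {P : Finset (Euc n)} {ξ : Euc n}
    (hP : IsPositiveSystem W P ξ) (hne : P.Nonempty) (G : Subgroup (O n)) [Finite G] :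
    ∃ e : Euc n, ‖e‖ = 1 ∧ (∀ v ∈ P, 0 < ⟪v, e⟫) ∧ ∀ g ∈ chamberStabilizer G P, g e = e := by
  have hle : chamberStabilizer G P ≤ G := fun g hg => hg.1
  have : Finite (chamberStabilizer G P) := Finite.of_injective _ (Subgroup.inclusion_injective hle)
  have := Fintype.ofFinite (chamberStabilizer G P)
  let e : Euc n := ∑ g : chamberStabilizer G P, (g : O n) ξ
  have hpos : ∀ v ∈ P, 0 < ⟪v, e⟫ := by
    intro v hv
    rw [inner_sum]
    refine Finset.sum_pos (fun g _ => ?_) ⟨1, Finset.mem_univ _⟩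
    have h3 : (g : O n) ((g : O n)⁻¹ v) = v := (g : O n).apply_symm_apply v
    rw [← h3, LinearIsometryEquiv.inner_map_map, real_inner_comm]
    exact hP.pos ((g.2.2 _).1 (by rwa [h3]))
  have hfix : ∀ g ∈ chamberStabilizer G P, g e = e := by
    intro g hg
    rw [map_sum]
    exact Fintype.sum_equiv (Equiv.mulLeft (⟨g, hg⟩ : chamberStabilizer G P)) _ _ fun k => rfl
  have he : e ≠ 0 := by
    obtain ⟨v, hv⟩ := hne
    intro h
    have := hpos v hv
    rw [h, inner_zero_right] at this
    exact lt_irrefl _ this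
  refine ⟨‖e‖⁻¹ • e, norm_smul_inv_norm he, fun v hv => ?_, fun g hg => ?_⟩
  · rw [inner_smul_right]
    have := hpos v hv
    have := norm_pos_iff.2 he
    positivity
  · rw [map_smul, hfix g hg]

/-- A unit vector in the interior of the chamber defined by `P`. -/
structure IsCenter (P : Finset (Euc n)) (e : Euc n) : Prop where
  nonempty : P.Nonempty
  norm_eq : ‖e‖ = 1
  pos : ∀ v ∈ P, 0 < ⟪v, e⟫

namespace IsCenter

variable {P : Finset (Euc n)} {e : Euc n}

theorem inner_self (he : IsCenter P e) : ⟪e, e⟫ = 1 := by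
  rw [real_inner_self_eq_norm_sq, he.norm_eq, one_pow]

/-- The height above the boundary of the chamber in the direction of `e`. -/
def height (he : IsCenter P e) (x : Euc n) : ℝ :=
  P.inf' he.nonempty fun v => ⟪v, x⟫ / ⟪v, e⟫

theorem continuous_height (he : IsCenter P e) : Continuous he.height :=
  Continuous.finset_inf'_apply he.nonempty fun v _ => by fun_prop

theorem height_le (he : IsCenter P e) {v : Euc n} (hv : v ∈ P) (x : Euc n) :
    he.height x ≤ ⟪v, x⟫ / ⟪v, e⟫ := Finset.inf'_le _ hv

theorem exists_height_eq (he : IsCenter P e) (x : Euc n) :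
    ∃ v ∈ P, he.height x = ⟪v, x⟫ / ⟪v, e⟫ := Finset.exists_mem_eq_inf' he.nonempty _

/-- Dividing by `⟪v, e⟫` makes all walls recede at unit speed along `e`; this makes the shear
invertible by an explicit formula. -/
theorem height_add_smul (he : IsCenter P e) (x : Euc n) (t : ℝ) :
    he.height (x + t • e) = he.height x + t := by
  have h : ∀ v ∈ P, ⟪v, x + t • e⟫ / ⟪v, e⟫ = ⟪v, x⟫ / ⟪v, e⟫ + t := by
    intro v hv
    have := (he.pos v hv).ne'
    rw [inner_add_right, inner_smul_right]
    field_simp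
  refine le_antisymm ?_ ?_
  · obtain ⟨v, hv, hvx⟩ := he.exists_height_eq x
    rw [hvx, ← h v hv]
    exact he.height_le hv _
  · obtain ⟨v, hv, hvx⟩ := he.exists_height_eq (x + t • e)
    rw [hvx, h v hv]
    exact add_le_add (he.height_le hv x) le_rfl

theorem height_map (he : IsCenter P e) {g : O n} (hg : ∀ v, g v ∈ P ↔ v ∈ P) (hge : g e = e)
    (x : Euc n) : he.height (g x) = he.height x := by
  have h : ∀ v, ⟪g v, g x⟫ / ⟪g v, e⟫ = ⟪v, x⟫ / ⟪v, e⟫ := fun v => by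
    conv_lhs => rw [← hge, g.inner_map_map, g.inner_map_map]
  refine le_antisymm ?_ ?_
  · obtain ⟨v, hv, hvx⟩ := he.exists_height_eq x
    rw [hvx, ← h v]
    exact he.height_le ((hg v).2 hv) _
  · obtain ⟨v, hv, hvx⟩ := he.exists_height_eq (g x)
    have h3 : g (g⁻¹ v) = v := g.apply_symm_apply v
    rw [hvx, ← h3, h]
    exact he.height_le ((hg _).1 (by rwa [h3])) x

theorem mem_chamber_iff (he : IsCenter P e) {x : Euc n} : x ∈ chamber P ↔ 0 ≤ he.height x := by
  constructor
  · intro hx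
    obtain ⟨v, hv, hvx⟩ := he.exists_height_eq x
    rw [hvx]
    exact div_nonneg (hx v hv) (he.pos v hv).le
  · intro h v hv
    have := h.trans (he.height_le hv x)
    rwa [le_div_iff₀ (he.pos v hv), zero_mul] at this

/-- The shear along `e` that takes the chamber to a half space. -/
def straighten (he : IsCenter P e) : Euc n ≃ₜ Euc n where
  toFun x := x + (he.height x - ⟪e, x⟫) • e
  invFun y := y + (⟪e, y⟫ - he.height y) • e
  left_inv x := by
    simp only [he.height_add_smul, inner_add_right, inner_smul_right, he.inner_self]
    rw [add_assoc, ← add_smul]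
    ring_nf
    simp
  right_inv x := by
    simp only [he.height_add_smul, inner_add_right, inner_smul_right, he.inner_self]
    rw [add_assoc, ← add_smul]
    ring_nf
    simp
  continuous_toFun := by
    have := he.continuous_height
    fun_prop
  continuous_invFun := by
    have := he.continuous_height
    fun_prop

theorem straighten_apply (he : IsCenter P e) (x : Euc n) :
    he.straighten x = x + (he.height x - ⟪e, x⟫) • e := rfl

theorem inner_straighten (he : IsCenter P e) (x : Euc n) : ⟪e, he.straighten x⟫ = he.height x := by
  rw [straighten_apply, inner_add_right, inner_smul_right, he.inner_self]
  ring

theorem straighten_map (he : IsCenter P e) {g : O n} (hg : ∀ v, g v ∈ P ↔ v ∈ P) (hge : g e = e)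
    (x : Euc n) : he.straighten (g x) = g (he.straighten x) := by
  have h : ⟪e, g x⟫ = ⟪e, x⟫ := by
    conv_lhs => rw [← hge, g.inner_map_map]
  rw [straighten_apply, straighten_apply, he.height_map hg hge, h, map_add, map_smul, hge]

/-- On the cone where a fixed `v ∈ P` attains the minimum defining the height, the map is linear;
finitely many such cones cover `ℝ^n`. -/
theorem isPL_straighten (he : IsCenter P e) : IsPL he.straighten := by
  refine IsPL.glue (ι := P)
    (fun v => {x | ∀ u ∈ P, 0 ≤ ((⟪u, e⟫⁻¹ • innerSL ℝ u -
      ⟪(v : Euc n), e⟫⁻¹ • innerSL ℝ (v : Euc n) : Euc n →L[ℝ] ℝ)) x})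
    (fun v x => (LinearMap.id +
      (⟪(v : Euc n), e⟫⁻¹ • innerₛₗ ℝ (v : Euc n) - innerₛₗ ℝ e).smulRight e : Euc n →ₗ[ℝ] Euc n) x) ?_ ?_ ?_ ?_
  · intro x
    obtain ⟨v, hv, hvx⟩ := he.exists_height_eq x
    refine ⟨⟨v, hv⟩, fun u hu => ?_⟩
    have := he.height_le hu x
    rw [hvx, div_eq_inv_mul, div_eq_inv_mul] at this
    simpa using this
  · exact fun v Q hQ => hQ.inter_cone P _
  · exact fun v => isPL_linearMap _
  · intro v x hx
    have h : he.height x = ⟪(v : Euc n), x⟫ / ⟪(v : Euc n), e⟫ := by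
      refine le_antisymm (he.height_le v.2 x) ?_
      obtain ⟨u, hu, hux⟩ := he.exists_height_eq x
      rw [hux, div_eq_inv_mul, div_eq_inv_mul]
      simpa using hx u hu
    rw [straighten_apply, h, div_eq_inv_mul]
    simp

end IsCenter

end Straighten

/-! ### The double of a chamber -/

section Double

variable {n : ℕ}

/-- The identity on elements of determinant one, `σ` on the others. -/
def signed (σ : O n) (w : O n) : O n := if detHom n w = 1 then 1 else σ

theorem signed_of_det_eq_one (σ : O n) {w : O n} (h : detHom n w = 1) : signed σ w = 1 := if_pos h

theorem signed_of_det_eq_neg_one (σ : O n) {w : O n} (h : detHom n w = -1) : signed σ w = σ :=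
  if_neg (by rw [h]; norm_num)

theorem signed_mul {σ : O n} (hσ : σ * σ = 1) (w w' : O n) :
    signed σ (w * w') = signed σ w * signed σ w' := by
  rcases detHom_eq w with h | h <;> rcases detHom_eq w' with h' | h'
  · rw [signed_of_det_eq_one σ h, signed_of_det_eq_one σ h',
      signed_of_det_eq_one σ (by rw [map_mul, h, h', one_mul]), one_mul]
  · rw [signed_of_det_eq_one σ h, signed_of_det_eq_neg_one σ h',
      signed_of_det_eq_neg_one σ (by rw [map_mul, h, h', one_mul]), one_mul]
  · rw [signed_of_det_eq_neg_one σ h, signed_of_det_eq_one σ h',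
      signed_of_det_eq_neg_one σ (by rw [map_mul, h, h', mul_one]), mul_one]
  · rw [signed_of_det_eq_neg_one σ h, signed_of_det_eq_neg_one σ h',
      signed_of_det_eq_one σ (by rw [map_mul, h, h']; norm_num), hσ]

theorem detHom_inv (g : O n) : detHom n g⁻¹ = detHom n g := by
  have h : detHom n g * detHom n g⁻¹ = 1 := by rw [← map_mul, mul_inv_cancel, map_one]
  rcases detHom_eq g with h' | h' <;> rw [h'] at h ⊢ <;> linarith

theorem detHom_conj (g w : O n) : detHom n (g * w * g⁻¹) = detHom n w := by
  have h : detHom n g * detHom n g⁻¹ = 1 := by rw [← map_mul, mul_inv_cancel, map_one]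
  rw [map_mul, map_mul, mul_right_comm, h, one_mul]

theorem signed_conj (σ g w : O n) : signed σ (g * w * g⁻¹) = signed σ w := by
  rw [signed, signed, detHom_conj]

theorem signed_comm {σ g : O n} (h : g * σ = σ * g) (w : O n) :
    g * signed σ w = signed σ w * g := by
  rw [signed]
  split_ifs
  · rw [one_mul, mul_one]
  · exact h

theorem mul_reflectionAlong_comm {g : O n} {e : Euc n} (h : g e = e) :
    g * reflectionAlong e = reflectionAlong e * g := by
  have := mul_reflectionAlong_mul_inv g e
  rwa [h, mul_inv_eq_iff_eq_mul] at this

variable {W : Subgroup (O n)} {P : Finset (Euc n)} {ξ e : Euc n}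

/-- Well-definedness of the unfolding. The two chamber points agree. At height zero the straightened
point lies in `e^⊥`, where the sign is immaterial; at positive height the point is interior and `w =
w'`. -/
theorem signed_straighten_unique (hP : IsPositiveSystem W P ξ) (he : IsCenter P e) {w w' : O n}
    (hw : w ∈ W) (hw' : w' ∈ W) {x : Euc n} (hx : w x ∈ chamber P) (hx' : w' x ∈ chamber P) :
    signed (reflectionAlong e) w (he.straighten (w x)) =
      signed (reflectionAlong e) w' (he.straighten (w' x)) := by
  have hu : w' * w⁻¹ ∈ W := W.mul_mem hw' (W.inv_mem hw)
  have h0 : (w' * w⁻¹) (w x) = w' x := congrArg w' (w.symm_apply_apply x)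
  have h1 : w' x = w x := h0.symm.trans (hP.eq_of_mem_chamber hu hx (by rwa [h0]))
  rw [h1] at h0 ⊢
  rcases (he.mem_chamber_iff.1 hx).eq_or_lt with h | h
  · have h2 : ∀ u, signed (reflectionAlong e) u (he.straighten (w x)) = he.straighten (w x) := by
      intro u
      rw [signed]
      split_ifs
      · rfl
      · exact reflectionAlong_of_inner_eq_zero (by rw [he.inner_straighten, ← h])
    rw [h2, h2]
  · have hpos : ∀ v ∈ P, 0 < ⟪v, w x⟫ := by
      intro v hv
      have := h.trans_le (he.height_le hv (w x))
      rwa [lt_div_iff₀ (he.pos v hv), zero_mul] at this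
    have h3 : w' * w⁻¹ = 1 := by
      refine hP.eq_one_of_map_mem hu fun v hv => ?_
      refine (hP.map_mem_or_of_mem hu hv).resolve_right fun hneg => ?_
      have h4 := hpos _ hneg
      rw [← h0, inner_neg_left, LinearIsometryEquiv.inner_map_map] at h4
      linarith [hpos v hv]
    rw [mul_inv_eq_one.1 h3]

/-- The map `ℝ^n → ℝ^n` that straightens the chamber and unfolds its translates by even and odd
elements of `W` to the two half spaces bounded by `e^⊥`. -/
def unfold (hP : IsPositiveSystem W P ξ) (he : IsCenter P e) [Finite W] (x : Euc n) : Euc n :=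
  signed (reflectionAlong e) (hP.exists_map_mem_chamber x).choose
    (he.straighten ((hP.exists_map_mem_chamber x).choose x))

variable [Finite W]

theorem unfold_eq (hP : IsPositiveSystem W P ξ) (he : IsCenter P e) {w : O n} (hw : w ∈ W)
    {x : Euc n} (hx : w x ∈ chamber P) :
    unfold hP he x = signed (reflectionAlong e) w (he.straighten (w x)) :=
  signed_straighten_unique hP he (hP.exists_map_mem_chamber x).choose_spec.1 hw
    (hP.exists_map_mem_chamber x).choose_spec.2 hx

theorem unfold_of_mem (hP : IsPositiveSystem W P ξ) (he : IsCenter P e) {x : Euc n}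
    (hx : x ∈ chamber P) : unfold hP he x = he.straighten x := by
  rw [unfold_eq hP he W.one_mem (x := x) hx, signed_of_det_eq_one _ (map_one _)]
  rfl

theorem unfold_map (hP : IsPositiveSystem W P ξ) (he : IsCenter P e) {w : O n} (hw : w ∈ W)
    (x : Euc n) : unfold hP he (w x) = signed (reflectionAlong e) w (unfold hP he x) := by
  obtain ⟨u, hu, hux⟩ := hP.exists_map_mem_chamber x
  have h1 : (u * w⁻¹) (w x) = u x := congrArg u (w.symm_apply_apply x)
  have h2 : signed (reflectionAlong e) (u * w⁻¹) =
      signed (reflectionAlong e) w * signed (reflectionAlong e) u := by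
    rw [← signed_mul (reflectionAlong_mul_self e)]
    have : detHom n (u * w⁻¹) = detHom n (w * u) := by
      rw [map_mul, map_mul, detHom_inv, mul_comm]
    rw [signed, signed, this]
  rw [unfold_eq hP he (W.mul_mem hu (W.inv_mem hw)) (by rwa [h1]), h1, h2, unfold_eq hP he hu hux]
  rfl

/-- If `u` brings `x` into the chamber, its conjugate by `g` does so for `g x` and has the same
parity; since `g e = e`, `g` commutes with both the shear and the reflection along `e`. -/
theorem unfold_map_stabilizer (hP : IsPositiveSystem W P ξ) (he : IsCenter P e) {g : O n}
    (hgW : g ∈ Subgroup.normalizer (W : Set (O n))) (hg : ∀ v, g v ∈ P ↔ v ∈ P) (hge : g e = e)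
    (x : Euc n) : unfold hP he (g x) = g (unfold hP he x) := by
  obtain ⟨u, hu, hux⟩ := hP.exists_map_mem_chamber x
  have h1 : (g * u * g⁻¹) (g x) = g (u x) :=
    congrArg (fun y => g (u y)) (g.symm_apply_apply x)
  have h2 : g (u x) ∈ chamber P := by
    rw [he.mem_chamber_iff] at hux ⊢
    rwa [he.height_map hg hge]
  rw [unfold_eq hP he ((Subgroup.mem_normalizer_iff.1 hgW u).1 hu) (by rwa [h1]), h1, signed_conj,
    he.straighten_map hg hge, unfold_eq hP he hu hux]
  exact (congrArg (fun k : O n => k (he.straighten (u x)))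
    (signed_comm (mul_reflectionAlong_comm hge) u)).symm

theorem unfold_eq_iff (hP : IsPositiveSystem W P ξ) (he : IsCenter P e) (x y : Euc n) :
    unfold hP he x = unfold hP he y ↔ ∃ g ∈ orientationPreserving W, g x = y := by
  constructor
  · intro h
    obtain ⟨w, hw, hwx⟩ := hP.exists_map_mem_chamber x
    obtain ⟨w', hw', hwy⟩ := hP.exists_map_mem_chamber y
    have hx0 := he.mem_chamber_iff.1 hwx
    have hy0 := he.mem_chamber_iff.1 hwy
    rw [unfold_eq hP he hw hwx, unfold_eq hP he hw' hwy] at h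
    have same : detHom n w = detHom n w' → he.straighten (w x) = he.straighten (w' y) →
        ∃ g ∈ orientationPreserving W, g x = y := by
      intro hd hs
      refine ⟨w'⁻¹ * w, ⟨W.mul_mem (W.inv_mem hw') hw, ?_⟩, ?_⟩
      · change detHom n (w'⁻¹ * w) = 1
        rw [map_mul, ← hd.symm, ← map_mul, inv_mul_cancel, map_one]
      · change w'⁻¹ (w x) = y
        rw [he.straighten.injective hs]
        exact w'.symm_apply_apply y
    -- Opposite parities: the images lie in opposite closed half spaces, so equality forces both
    -- heights to vanish. The common chamber point then lies on a wall, and inserting the reflection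
    -- in that wall corrects the parity.
    have diff : detHom n w * detHom n w' = -1 →
        ⟪e, he.straighten (w x)⟫ = - ⟪e, he.straighten (w' y)⟫ →
        (⟪e, he.straighten (w' y)⟫ = 0 → he.straighten (w x) = he.straighten (w' y)) →
        ∃ g ∈ orientationPreserving W, g x = y := by
      intro hd h1 h2
      rw [he.inner_straighten, he.inner_straighten] at h1
      rw [he.inner_straighten] at h2
      have h3 := he.straighten.injective (h2 (by linarith))
      obtain ⟨v, hv, hvx⟩ := he.exists_height_eq (w' y)
      have h4 : ⟪v, w' y⟫ = 0 := by
        rw [show he.height (w' y) = 0 by linarith, eq_comm, div_eq_zero_iff] at hvx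
        exact hvx.resolve_right (he.pos v hv).ne'
      refine ⟨w'⁻¹ * (reflectionAlong v * w), ⟨W.mul_mem (W.inv_mem hw')
        (W.mul_mem (hP.reflection_mem hv) hw), ?_⟩, ?_⟩
      · change detHom n (w'⁻¹ * (reflectionAlong v * w)) = 1
        rw [map_mul, map_mul, detHom_inv, detHom_reflectionAlong (hP.norm_eq hv)]
        linear_combination -hd
      · change w'⁻¹ (reflectionAlong v (w x)) = y
        rw [h3, reflectionAlong_of_inner_eq_zero h4]
        exact w'.symm_apply_apply y
    have hrefl : ∀ z, ⟪e, reflectionAlong e z⟫ = -⟪e, z⟫ := by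
      intro z
      rw [reflectionAlong_apply he.norm_eq, inner_sub_right, inner_smul_right, he.inner_self]
      ring
    rcases detHom_eq w with hd | hd <;> rcases detHom_eq w' with hd' | hd'
    · rw [signed_of_det_eq_one _ hd, signed_of_det_eq_one _ hd'] at h
      exact same (hd.trans hd'.symm) h
    · rw [signed_of_det_eq_one _ hd, signed_of_det_eq_neg_one _ hd'] at h
      change he.straighten (w x) = reflectionAlong e (he.straighten (w' y)) at h
      refine diff (by rw [hd, hd', one_mul]) (by rw [h, hrefl]) fun h0 => ?_
      rw [h, reflectionAlong_of_inner_eq_zero h0]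
    · rw [signed_of_det_eq_neg_one _ hd, signed_of_det_eq_one _ hd'] at h
      change reflectionAlong e (he.straighten (w x)) = he.straighten (w' y) at h
      refine diff (by rw [hd, hd', mul_one]) (by rw [← h, hrefl, neg_neg]) fun h0 => ?_
      rw [← h, hrefl, neg_eq_zero] at h0
      rw [← h, reflectionAlong_of_inner_eq_zero h0]
    · rw [signed_of_det_eq_neg_one _ hd, signed_of_det_eq_neg_one _ hd'] at h
      exact same (hd.trans hd'.symm) ((reflectionAlong e).injective h)
  · rintro ⟨g, hg, rfl⟩
    rw [unfold_map hP he hg.1, signed_of_det_eq_one _ hg.2]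
    rfl

/-- The chamber covers the upper half space, and its image under any reflection of `W` covers the
lower one. -/
theorem unfold_surjective (hP : IsPositiveSystem W P ξ) (he : IsCenter P e) :
    Function.Surjective (unfold hP he) := by
  have key : ∀ y, 0 ≤ ⟪e, y⟫ → ∃ x, unfold hP he x = y := by
    intro y hy
    refine ⟨he.straighten.symm y, ?_⟩
    rw [unfold_of_mem hP he, he.straighten.apply_symm_apply]
    rwa [he.mem_chamber_iff, ← he.inner_straighten, he.straighten.apply_symm_apply]
  intro y
  rcases le_total 0 ⟪e, y⟫ with h | h
  · exact key y h
  · obtain ⟨x, hx⟩ := key (reflectionAlong e y) (by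
      rw [reflectionAlong_apply he.norm_eq, inner_sub_right, inner_smul_right, he.inner_self]
      linarith)
    obtain ⟨v, hv⟩ := he.nonempty
    refine ⟨reflectionAlong v x, ?_⟩
    rw [unfold_map hP he (hP.reflection_mem hv), hx,
      signed_of_det_eq_neg_one _ (detHom_reflectionAlong (hP.norm_eq hv)),
      reflectionAlong_apply_self]

/-- On each of the finitely many closed translates of the chamber the map is the restriction of a PL
homeomorphism of `ℝ^n`; the PL property, continuity and closedness are all glued from this. -/
theorem isOrbitMap_unfold (hP : IsPositiveSystem W P ξ) (he : IsCenter P e) :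
    IsOrbitMap (orientationPreserving W) (unfold hP he) := by
  let S : W → Set (Euc n) := fun w => (w : O n) ⁻¹' chamber P
  let f : W → (Euc n ≃ₜ Euc n) := fun w => ((w : O n).toHomeomorph.trans he.straighten).trans
    (signed (reflectionAlong e) (w : O n)).toHomeomorph
  have hf : ∀ w, ∀ x ∈ S w, unfold hP he x = f w x := fun w x hx => unfold_eq hP he w.2 hx
  have hcov : ∀ x, ∃ w, x ∈ S w := fun x => by
    obtain ⟨w, hw, h⟩ := hP.exists_map_mem_chamber x
    exact ⟨⟨w, hw⟩, h⟩
  have hS : ∀ w, S w = {x | ∀ v ∈ P, 0 ≤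
      ((innerSL ℝ v).comp ((w : O n).toContinuousLinearEquiv : Euc n →L[ℝ] Euc n)) x} :=
    fun w => rfl
  have hclosed : ∀ w, IsClosed (S w) := by
    intro w
    have hC : chamber P = he.height ⁻¹' Ici 0 := by
      ext x
      exact he.mem_chamber_iff
    exact (hC ▸ isClosed_Ici.preimage he.continuous_height).preimage (w : O n).continuous
  refine ⟨?_, ?_, ?_, unfold_eq_iff hP he⟩
  · refine IsPL.glue S (fun w => f w) hcov (fun w Q hQ => ?_) (fun w => ?_) hf
    · rw [hS]
      exact hQ.inter_cone P _
    · exact (isPL_linearMap ((signed (reflectionAlong e) (w : O n)).toLinearEquiv :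
        Euc n →ₗ[ℝ] Euc n)).comp (he.isPL_straighten.comp
          (isPL_linearMap ((w : O n).toLinearEquiv : Euc n →ₗ[ℝ] Euc n)))
  · refine (locallyFinite_of_finite S).continuous (iUnion_eq_univ_iff.2 hcov) hclosed fun w => ?_
    exact (f w).continuous.continuousOn.congr (hf w)
  · intro A hA
    have : unfold hP he '' A = ⋃ w, f w '' (A ∩ S w) := by
      ext y
      simp only [mem_iUnion]
      constructor
      · rintro ⟨x, hx, rfl⟩
        obtain ⟨w, hw⟩ := hcov x
        exact ⟨w, x, ⟨hx, hw⟩, (hf w x hw).symm⟩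
      · rintro ⟨w, x, ⟨hx, hw⟩, rfl⟩
        exact ⟨x, hx, hf w x hw⟩
    rw [this]
    exact isClosed_iUnion_of_finite fun w =>
      (f w).isClosedMap _ (hA.inter (hclosed w))

end Double

/-! ### Linearization of the action on `ℝ^n/W⁺` -/

section Linearization

variable {n : ℕ}

/-- `F` is an orbit map of `W⁺` onto `ℝ^n` that linearizes the action of `G`, through `r`. Elements
of `W` act through their determinants: those of determinant `-1` act by `σ`. The element `γ` is the
product of an element `w` of `W` and an element `g` whose action commutes with that of `W` and is
not changed by `F`. -/
structure IsLinearization (W G : Subgroup (O n)) (F : Euc n → Euc n) (r : G →* O n)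
    (σ γ w g : O n) : Prop where
  le : W ≤ G
  isOrbitMap : IsOrbitMap (orientationPreserving W) F
  surjective : Function.Surjective F
  map_eq : ∀ (k : G) x, F ((k : O n) x) = r k (F x)
  ker_eq : r.ker = (orientationPreserving W).subgroupOf G
  apply_of_mem : ∀ k : G, (k : O n) ∈ W → r k = signed σ k
  of_eq_bot : W = ⊥ → σ = 1
  of_ne_bot : W ≠ ⊥ → ∃ e, ‖e‖ = 1 ∧ σ = reflectionAlong e ∧ g e = e
  left_mem : w ∈ W
  eq_mul : γ = w * g
  apply_eq : ∀ k : G, (k : O n) = γ → r k = signed σ w * g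
  fix_of_fix : ∀ x, γ x = x → g x = x

theorem orientationPreserving_le (W : Subgroup (O n)) : orientationPreserving W ≤ W :=
  fun _ h => h.1

/-- The trivial group has no walls, hence no height function; the identity serves as orbit map, with
`σ = 1` and `g = γ`. -/
theorem exists_isLinearization_of_eq_bot (G : Subgroup (O n)) (γ : O n) :
    ∃ F r σ w g, IsLinearization (⊥ : Subgroup (O n)) G F r σ γ w g := by
  have hbot : orientationPreserving (⊥ : Subgroup (O n)) = ⊥ :=
    le_bot_iff.1 (orientationPreserving_le ⊥)
  refine ⟨id, G.subtype, 1, 1, γ, bot_le, ?_, Function.surjective_id, fun _ _ => rfl, ?_, ?_,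
    fun _ => rfl, fun h => absurd rfl h, Subgroup.one_mem _, (one_mul γ).symm, ?_, fun _ h => h⟩
  · rw [hbot]
    exact IsOrbitMap.id
  · rw [hbot, Subgroup.ker_subtype, Subgroup.bot_subgroupOf]
  · intro k hk
    rw [Subgroup.mem_bot.1 hk, signed_of_det_eq_one _ (map_one _)]
    exact Subgroup.mem_bot.1 hk
  · intro k hk
    rw [signed_of_det_eq_one _ (map_one _), one_mul]
    exact hk

/-- The orbit map is `unfold` for a chamber adjacent to the fixed space of `γ`, with centre fixed by
the chamber stabilizer in `G`; the action is `r (w * g) = signed σ w * g`. -/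
theorem exists_isLinearization {W G : Subgroup (O n)} [Finite G] (hW : IsReflectionGroup W)
    (hWG : W ≤ G) (hN : G ≤ Subgroup.normalizer (W : Set (O n))) {γ : O n} (hγ : γ ∈ G) :
    ∃ F r σ w g, IsLinearization W G F r σ γ w g := by
  rcases eq_or_ne W ⊥ with rfl | hne
  · exact exists_isLinearization_of_eq_bot G γ
  have := hW.1
  let V : Submodule ℝ (Euc n) :=
    LinearMap.eqLocus (γ.toLinearEquiv : Euc n →ₗ[ℝ] Euc n) LinearMap.id
  obtain ⟨P, ξ, hP, x₀, hx₀, hV⟩ := exists_isPositiveSystem hW V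
  have hPne : P.Nonempty := by
    by_contra h
    rw [Finset.not_nonempty_iff_eq_empty] at h
    refine hne ?_
    rw [hP.generates, h, Finset.coe_empty, image_empty, Subgroup.closure_empty]
  obtain ⟨e, he1, hepos, hefix⟩ := hP.exists_center hPne G
  have he : IsCenter P e := ⟨hPne, he1, hepos⟩
  set F := unfold hP he with hF
  have hsurj : Function.Surjective F := unfold_surjective hP he
  have hstab : ∀ g ∈ chamberStabilizer G P, ∀ x, F (g x) = g (F x) := fun g hg =>
    unfold_map_stabilizer hP he (hN hg.1) hg.2 (hefix g hg)
  have hdec : ∀ k ∈ G, ∃ w ∈ W, ∃ g ∈ chamberStabilizer G P, k = w * g := by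
    intro k hk
    obtain ⟨w, hw, h⟩ := hP.exists_mul_map_mem (hN hk)
    exact ⟨w⁻¹, W.inv_mem hw, w * k, ⟨G.mul_mem (hWG hw) hk, map_mem_iff_of_forall h⟩,
      (inv_mul_cancel_left w k).symm⟩
  have hmul : ∀ w ∈ W, ∀ g ∈ chamberStabilizer G P, ∀ x,
      F ((w * g) x) = (signed (reflectionAlong e) w * g) (F x) := by
    intro w hw g hg x
    exact (unfold_map hP he hw (g x)).trans (congrArg _ (hstab g hg x))
  have hex : ∀ k : G, ∃ a : O n, ∀ x, F ((k : O n) x) = a (F x) := by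
    intro k
    obtain ⟨w, hw, g, hg, hk⟩ := hdec k k.2
    exact ⟨signed (reflectionAlong e) w * g, fun x => by rw [hk]; exact hmul w hw g hg x⟩
  -- As `F` is surjective, equivariance determines `r`; it is therefore a homomorphism and does not
  -- depend on the decomposition `w * g`.
  have huniq : ∀ a b : O n, (∀ x, a (F x) = b (F x)) → a = b := by
    intro a b h
    ext1 y
    obtain ⟨x, rfl⟩ := hsurj y
    exact h x
  choose r hr using hex
  let r' : G →* O n :=
    { toFun := r
      map_one' := huniq _ _ fun x => (hr 1 x).symm
      map_mul' := fun a b => huniq _ _ fun x => by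
        rw [← hr]
        exact (hr a _).trans (congrArg _ (hr b x)) }
  have hr' : ∀ k : G, ∀ w ∈ W, ∀ g ∈ chamberStabilizer G P, (k : O n) = w * g →
      r' k = signed (reflectionAlong e) w * g := by
    intro k w hw g hg hk
    refine huniq _ _ fun x => (hr k x).symm.trans ?_
    rw [hk]
    exact hmul w hw g hg x
  obtain ⟨w, hw, g, hg, hγwg⟩ := hdec γ hγ
  refine ⟨F, r', reflectionAlong e, w, g, hWG, isOrbitMap_unfold hP he, hsurj, hr, ?_, ?_,
    fun h => absurd h hne, fun _ => ⟨e, he1, rfl, hefix g hg⟩, hw, hγwg,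
    fun k hk => hr' k w hw g hg (hk.trans hγwg), ?_⟩
  · ext k
    rw [MonoidHom.mem_ker, Subgroup.mem_subgroupOf, mem_orientationPreserving]
    constructor
    · intro h
      obtain ⟨u, hu, a, ha, hk⟩ := hdec k k.2
      rw [hr' k u hu a ha hk] at h
      -- Evaluating at `e`, which `a` fixes, excludes the sign `-1`; so `u` is even and then `a =
      -- 1`.
      have h1 : signed (reflectionAlong e) u e = e := by
        have := LinearIsometryEquiv.congr_fun h e
        rwa [LinearIsometryEquiv.coe_mul, Function.comp, hefix a ha] at this
      rcases detHom_eq u with hd | hd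
      · rw [signed_of_det_eq_one _ hd, one_mul] at h
        rw [hk, h, mul_one]
        exact ⟨hu, hd⟩
      · rw [signed_of_det_eq_neg_one _ hd, reflectionAlong_self] at h1
        have h2 : ⟪e, -e⟫ = 1 := by rw [h1, he.inner_self]
        rw [inner_neg_right, he.inner_self] at h2
        norm_num at h2
    · rintro ⟨h1, h2⟩
      rw [hr' k k h1 1 (Subgroup.one_mem _) (mul_one _).symm, signed_of_det_eq_one _ h2, mul_one]
  · intro k hk
    rw [hr' k k hk 1 (Subgroup.one_mem _) (mul_one _).symm, mul_one]
  · intro x hx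
    refine hP.fix_of_mul_fix hx₀ hV hw hg.2 (fun y hy => ?_) hx
    rw [← hγwg]
    exact hy

namespace IsLinearization

variable {W G : Subgroup (O n)} {F : Euc n → Euc n} {r : G →* O n} {σ γ w g : O n}

theorem plLinearizationApplies (h : IsLinearization W G F r σ γ w g) :
    PLLinearizationApplies (orientationPreserving W) G :=
  h.isOrbitMap.plLinearizationApplies h.surjective.range_eq
    ((orientationPreserving_le W).trans h.le) r h.ker_eq h.map_eq

theorem sq_eq_one (h : IsLinearization W G F r σ γ w g) : σ * σ = 1 := by
  rcases eq_or_ne W ⊥ with hW | hW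
  · rw [h.of_eq_bot hW, one_mul]
  · obtain ⟨e, -, rfl, -⟩ := h.of_ne_bot hW
    exact reflectionAlong_mul_self e

theorem isReflection (h : IsLinearization W G F r σ γ w g) (hW : W ≠ ⊥) : IsReflection σ := by
  obtain ⟨e, he, rfl, -⟩ := h.of_ne_bot hW
  exact isReflection_reflectionAlong he

/-- A reflection `γ` acts on `ℝ^n/W⁺` as a reflection. -/
theorem isReflection_apply (h : IsLinearization W G F r σ γ w g) (hγ : IsReflection γ) (k : G)
    (hk : (k : O n) = γ) : IsReflection (r k) := by
  rw [h.apply_eq k hk]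
  have hdet : detHom n w * detHom n g = -1 := by
    rw [← map_mul, ← h.eq_mul, hγ.detHom_eq]
  -- Since `g` fixes whatever `γ` fixes, it is trivial or a reflection. As `det γ = -1`, exactly one
  -- of `w` and `g` is odd, and `r k` is `σ` or `g` accordingly.
  rcases of_fixCodim_le_one ((fixCodim_le h.fix_of_fix).trans (le_of_eq hγ)) with h1 | ⟨v, hv, h1⟩
  · rw [h1, map_one, mul_one] at hdet
    have hW : W ≠ ⊥ := by
      rintro rfl
      rw [Subgroup.mem_bot.1 h.left_mem, map_one] at hdet
      norm_num at hdet
    rw [signed_of_det_eq_neg_one _ hdet, h1, mul_one]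
    exact h.isReflection hW
  · rw [h1, detHom_reflectionAlong hv] at hdet
    rw [signed_of_det_eq_one _ (by linarith), one_mul, h1]
    exact isReflection_reflectionAlong hv

/-- A rotation `γ ∉ W` acts on `ℝ^n/W⁺` as a product of two reflections, one of which is `σ` or both
of which commute with `σ`. -/
theorem exists_apply_eq_mul (h : IsLinearization W G F r σ γ w g) (hγ : IsRotation γ)
    (hγW : γ ∉ W) : ∃ u v : Euc n, ‖u‖ = 1 ∧ ‖v‖ = 1 ∧
      (∀ k : G, (k : O n) = γ → r k = reflectionAlong u * reflectionAlong v) ∧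
      (σ = reflectionAlong u ∨ σ * reflectionAlong u = reflectionAlong u * σ ∧
        σ * reflectionAlong v = reflectionAlong v * σ) := by
  have hdet : detHom n w * detHom n g = 1 := by
    rw [← map_mul, ← h.eq_mul, hγ.detHom_eq]
  have hg1 : g ≠ 1 := by
    intro hg
    refine hγW ?_
    rw [h.eq_mul, hg, mul_one]
    exact h.left_mem
  -- Now `w` and `g` have equal parity: if `g` is a reflection, `r k = σ * g`; if `g` is a product
  -- of two, `r k = g`, and as `g` fixes `e` both roots are orthogonal to `e`.
  rcases of_fixCodim_le_two ((fixCodim_le h.fix_of_fix).trans (le_of_eq hγ)) with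
    h1 | ⟨v, hv, h1⟩ | ⟨u, v, hu, hv, h1⟩
  · exact absurd h1 hg1
  · rw [h1, detHom_reflectionAlong hv] at hdet
    have hw : detHom n w = -1 := by linarith
    have hW : W ≠ ⊥ := by
      rintro rfl
      rw [Subgroup.mem_bot.1 h.left_mem, map_one] at hw
      norm_num at hw
    obtain ⟨e, he, rfl, -⟩ := h.of_ne_bot hW
    refine ⟨e, v, he, hv, fun k hk => ?_, Or.inl rfl⟩
    rw [h.apply_eq k hk, signed_of_det_eq_neg_one _ hw, h1]
  · rw [h1, map_mul, detHom_reflectionAlong hu, detHom_reflectionAlong hv] at hdet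
    have hw : detHom n w = 1 := by linarith
    refine ⟨u, v, hu, hv, fun k hk => ?_, Or.inr ?_⟩
    · rw [h.apply_eq k hk, signed_of_det_eq_one _ hw, h1, one_mul]
    · rcases eq_or_ne W ⊥ with hW | hW
      · rw [h.of_eq_bot hW]
        simp
      · obtain ⟨e, he, rfl, hge⟩ := h.of_ne_bot hW
        rw [h1] at hge hg1
        obtain ⟨h2, h3⟩ := inner_eq_zero_of_mul_fix hu hv hg1 hge
        exact ⟨(mul_reflectionAlong_comm (reflectionAlong_of_inner_eq_zero h2)).symm,
          (mul_reflectionAlong_comm (reflectionAlong_of_inner_eq_zero h3)).symm⟩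

end IsLinearization

end Linearization

/-! ### Extensions by involutions, and dihedral groups -/

section Dihedral

variable {n : ℕ}

/-- Adjoining an involution that normalizes `N` adds at most one coset. This gives both finiteness
and the determination of orientation preserving subgroups. -/
theorem mem_or_mul_mem_of_mem_sup {G : Type*} [Group G] {N : Subgroup G} {t : G}
    (ht : t ∈ Subgroup.normalizer (N : Set G)) (htt : t * t = 1) {x : G}
    (hx : x ∈ N ⊔ Subgroup.zpowers t) : x ∈ N ∨ x * t ∈ N := by
  rw [Subgroup.zpowers_eq_closure, ← Subgroup.closure_eq N, ← Subgroup.closure_union] at hx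
  have hconj : ∀ a ∈ N, t * a * t ∈ N := by
    intro a ha
    have := (Subgroup.mem_normalizer_iff.1 ht a).1 ha
    rwa [inv_eq_of_mul_eq_one_right htt] at this
  induction hx using Subgroup.closure_induction with
  | mem x hx =>
    rcases hx with hx | rfl
    · exact Or.inl hx
    · right; rw [htt]; exact N.one_mem
  | one => exact Or.inl N.one_mem
  | mul x y _ _ hx hy =>
    rcases hx with hx | hx <;> rcases hy with hy | hy
    · exact Or.inl (N.mul_mem hx hy)
    · right; rw [mul_assoc]; exact N.mul_mem hx hy
    · right
      have := N.mul_mem hx (hconj y hy)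
      rwa [show x * t * (t * y * t) = x * (t * t) * y * t by simp only [mul_assoc], htt, mul_one]
        at this
    · left
      have := N.mul_mem hx (hconj _ hy)
      rwa [show x * t * (t * (y * t) * t) = x * (t * t) * y * (t * t) by simp only [mul_assoc], htt,
        mul_one, mul_one] at this
  | inv x _ hx =>
    rcases hx with hx | hx
    · exact Or.inl (N.inv_mem hx)
    · right
      have := hconj _ (N.inv_mem hx)
      rwa [mul_inv_rev, inv_eq_of_mul_eq_one_right htt, ← mul_assoc, htt, one_mul] at this

theorem finite_sup_zpowers {G : Type*} [Group G] {N : Subgroup G} [Finite N] {t : G}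
    (ht : t ∈ Subgroup.normalizer (N : Set G)) (htt : t * t = 1) :
    Finite (N ⊔ Subgroup.zpowers t : Subgroup G) := by
  have hN : (N : Set G).Finite := Set.toFinite _
  refine Set.Finite.to_subtype (s := ((N ⊔ Subgroup.zpowers t : Subgroup G) : Set G))
    ((hN.union (hN.image fun x => x * t)).subset fun x hx => ?_)
  rcases mem_or_mul_mem_of_mem_sup ht htt hx with h | h
  · exact Or.inl h
  · exact Or.inr ⟨x * t, h, by simp only [mul_assoc, htt, mul_one]⟩

/-- The dihedral group generated by the reflections along `u` and `v`. -/
def dihedral (u v : Euc n) : Subgroup (O n) :=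
  Subgroup.zpowers (reflectionAlong u * reflectionAlong v) ⊔ Subgroup.zpowers (reflectionAlong v)

theorem mul_mem_dihedral (u v : Euc n) : reflectionAlong u * reflectionAlong v ∈ dihedral u v :=
  Subgroup.mem_sup_left (Subgroup.mem_zpowers _)

theorem right_mem_dihedral (u v : Euc n) : reflectionAlong v ∈ dihedral u v :=
  Subgroup.mem_sup_right (Subgroup.mem_zpowers _)

theorem left_mem_dihedral (u v : Euc n) : reflectionAlong u ∈ dihedral u v := by
  have := Subgroup.mul_mem _ (mul_mem_dihedral u v) (right_mem_dihedral u v)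
  rwa [mul_assoc, reflectionAlong_mul_self, mul_one] at this

theorem mem_normalizer_zpowers {G : Type*} [Group G] {a t : G} (htt : t * t = 1)
    (h : t * a * t = a⁻¹) : t ∈ Subgroup.normalizer (Subgroup.zpowers a : Set G) := by
  have hz : ∀ b ∈ Subgroup.zpowers a, t * b * t⁻¹ ∈ Subgroup.zpowers a := by
    rintro _ ⟨k, rfl⟩
    rw [← conj_zpow, inv_eq_of_mul_eq_one_right htt, h]
    exact Subgroup.zpow_mem _ (Subgroup.inv_mem _ (Subgroup.mem_zpowers a)) k
  refine Subgroup.mem_normalizer_iff.2 fun b => ⟨hz b, fun hb => ?_⟩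
  have := hz _ hb
  rw [inv_eq_of_mul_eq_one_right htt] at this
  rwa [show t * (t * b * t) * t = (t * t) * b * (t * t) by simp only [mul_assoc], htt, one_mul,
    mul_one] at this

theorem reflectionAlong_mem_normalizer (u v : Euc n) : reflectionAlong v ∈
    Subgroup.normalizer (Subgroup.zpowers (reflectionAlong u * reflectionAlong v) : Set (O n)) := by
  refine mem_normalizer_zpowers (reflectionAlong_mul_self v) ?_
  rw [mul_inv_rev, reflectionAlong_inv, reflectionAlong_inv, mul_assoc, mul_assoc,
    reflectionAlong_mul_self, mul_one]

theorem isReflectionGroup_dihedral {u v : Euc n} (hu : ‖u‖ = 1) (hv : ‖v‖ = 1)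
    (h : IsOfFinOrder (reflectionAlong u * reflectionAlong v)) :
    IsReflectionGroup (dihedral u v) := by
  have : Finite (Subgroup.zpowers (reflectionAlong u * reflectionAlong v)) := h.finite_zpowers
  refine ⟨finite_sup_zpowers (reflectionAlong_mem_normalizer u v) (reflectionAlong_mul_self v),
    le_antisymm ?_ ?_⟩
  · have h1 : reflectionAlong u ∈
        Subgroup.closure {g | g ∈ dihedral u v ∧ IsReflection g} :=
      Subgroup.subset_closure ⟨left_mem_dihedral u v, isReflection_reflectionAlong hu⟩
    have h2 : reflectionAlong v ∈
        Subgroup.closure {g | g ∈ dihedral u v ∧ IsReflection g} :=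
      Subgroup.subset_closure ⟨right_mem_dihedral u v, isReflection_reflectionAlong hv⟩
    exact sup_le ((Subgroup.zpowers_le).2 (Subgroup.mul_mem _ h1 h2)) ((Subgroup.zpowers_le).2 h2)
  · rw [Subgroup.closure_le]
    exact fun g hg => hg.1

theorem orientationPreserving_dihedral {u v : Euc n} (hu : ‖u‖ = 1) (hv : ‖v‖ = 1) :
    orientationPreserving (dihedral u v) =
      Subgroup.zpowers (reflectionAlong u * reflectionAlong v) := by
  have hdet : ∀ x ∈ Subgroup.zpowers (reflectionAlong u * reflectionAlong v),
      detHom n x = 1 := by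
    rintro _ ⟨k, rfl⟩
    rw [map_zpow, map_mul, detHom_reflectionAlong hu, detHom_reflectionAlong hv]
    norm_num
  ext x
  rw [mem_orientationPreserving]
  refine ⟨fun ⟨h1, h2⟩ => ?_, fun hx => ⟨Subgroup.mem_sup_left hx, hdet x hx⟩⟩
  refine (mem_or_mul_mem_of_mem_sup (reflectionAlong_mem_normalizer u v)
    (reflectionAlong_mul_self v) h1).resolve_right fun h3 => ?_
  have h4 := hdet _ h3
  rw [map_mul, h2, detHom_reflectionAlong hv] at h4
  norm_num at h4

/-- In the first case `σ` belongs to the group; in the second it centralizes the generators. -/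
theorem dihedral_mem_normalizer {u v : Euc n} {σ : O n}
    (h : σ = reflectionAlong u ∨ σ * reflectionAlong u = reflectionAlong u * σ ∧
      σ * reflectionAlong v = reflectionAlong v * σ) :
    σ ∈ Subgroup.normalizer (dihedral u v : Set (O n)) := by
  rcases h with rfl | ⟨h1, h2⟩
  · exact Subgroup.le_normalizer (left_mem_dihedral u v)
  · have hle : dihedral u v ≤ Subgroup.centralizer {σ} := by
      refine sup_le ((Subgroup.zpowers_le).2 ?_) ((Subgroup.zpowers_le).2 ?_)
      · exact Subgroup.mul_mem _ (Subgroup.mem_centralizer_singleton_iff.2 h1.symm)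
          (Subgroup.mem_centralizer_singleton_iff.2 h2.symm)
      · exact Subgroup.mem_centralizer_singleton_iff.2 h2.symm
    have h3 : ∀ b ∈ dihedral u v, b * σ = σ * b := fun b hb =>
      Subgroup.mem_centralizer_singleton_iff.1 (hle hb)
    refine Subgroup.mem_normalizer_iff.2 fun b => ⟨fun hb => ?_, fun hb => ?_⟩
    · rwa [← h3 b hb, mul_inv_cancel_right]
    · have h4 := h3 _ hb
      rw [inv_mul_cancel_right, mul_assoc, mul_right_inj] at h4
      rw [mul_assoc] at hb
      rwa [← h4] at hb

end Dihedral

/-! ### Folding along a hyperplane -/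

section Folding

variable {n : ℕ}

/-- An isometry moves the unit normal to the first basis vector; then the negative half space is
reflected onto the positive one. -/
theorem exists_isOrbitMap_zpowers {τ : O n} (hτ : IsReflection τ) :
    ∃ Q, IsOrbitMap (Subgroup.zpowers τ) Q ∧ range Q = halfSpace n := by
  obtain ⟨v, hv, rfl⟩ := isReflection_iff.1 hτ
  have hn : 0 < n := by
    rcases Nat.eq_zero_or_pos n with rfl | h
    · rw [Subsingleton.elim v 0, norm_zero] at hv
      exact absurd hv zero_ne_one
    · exact h
  let i : Fin n := ⟨0, hn⟩
  let e : Euc n := stdVec i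
  have he : ‖e‖ = 1 := by simp [e]
  have hei : ∀ x, ⟪e, x⟫ = x i := fun x => by simp [e, stdVec, EuclideanSpace.inner_single_left]
  have hhalf : ∀ x, x ∈ halfSpace n ↔ 0 ≤ x i :=
    fun x => ⟨fun h => h i rfl, fun h j hj => by rwa [show j = i from Fin.ext hj]⟩
  obtain ⟨A, hA⟩ : ∃ A : O n, A v = e :=
    -- Two vectors of equal length are interchanged by the reflection along their difference.
    ⟨reflectionAlong (v - e), Submodule.reflection_sub (hv.trans he.symm)⟩
  have hAτ : ∀ x, A (reflectionAlong v x) = reflectionAlong e (A x) := by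
    intro x
    have h : A * reflectionAlong v = reflectionAlong e * A := by
      rw [← hA, ← mul_reflectionAlong_mul_inv, inv_mul_cancel_right]
    exact LinearIsometryEquiv.congr_fun h x
  have hrefl : ∀ y, (reflectionAlong e y) i = -y i := by
    intro y
    rw [reflectionAlong_apply he, hei]
    simp [e]
    ring
  let q : Euc n → Euc n := fun y => if 0 ≤ y i then y else reflectionAlong e y
  have hq1 : ∀ y, 0 ≤ y i → q y = y := fun y h => if_pos h
  have hq2 : ∀ y, y i ≤ 0 → q y = reflectionAlong e y := by
    intro y h
    rcases h.eq_or_lt with h | h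
    · rw [hq1 y h.ge, reflectionAlong_of_inner_eq_zero (by rw [hei, h])]
    · exact if_neg h.not_ge
  have hqmem : ∀ y, 0 ≤ q y i := by
    intro y
    rcases le_total 0 (y i) with h | h
    · rwa [hq1 y h]
    · rw [hq2 y h, hrefl]
      linarith
  have hqr : ∀ y, q (reflectionAlong e y) = q y := by
    intro y
    rcases le_total 0 (y i) with h | h
    · rw [hq1 y h, hq2 _ (by rw [hrefl]; linarith), reflectionAlong_apply_self]
    · rw [hq2 y h, hq1 _ (by rw [hrefl]; linarith)]
  have hqor : ∀ y, q y = y ∨ q y = reflectionAlong e y := by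
    intro y
    rcases le_total 0 (y i) with h | h
    exacts [Or.inl (hq1 y h), Or.inr (hq2 y h)]
  let s : Bool → O n := fun b => if b then 1 else reflectionAlong e
  let L : Bool → Euc n →L[ℝ] ℝ := fun b => if b then innerSL ℝ e else -innerSL ℝ e
  let S : Bool → Set (Euc n) := fun b => {x | ∀ u ∈ ({()} : Finset Unit), 0 ≤ L b x}
  have hSt : ∀ x, x ∈ S true ↔ 0 ≤ x i := fun x => by simp [S, L, hei]
  have hSf : ∀ x, x ∈ S false ↔ x i ≤ 0 := fun x => by simp [S, L, hei]
  have hcov : ∀ x, ∃ b, x ∈ S b := by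
    intro x
    rcases le_total 0 (x i) with h | h
    exacts [⟨true, (hSt x).2 h⟩, ⟨false, (hSf x).2 h⟩]
  have hqs : ∀ b, ∀ x ∈ S b, q x = s b x := by
    rintro (_ | _) x hx
    · exact hq2 x ((hSf x).1 hx)
    · exact hq1 x ((hSt x).1 hx)
  have hclosed : ∀ b, IsClosed (S b) := by
    intro b
    have : S b = L b ⁻¹' Ici 0 := by
      ext x
      simp [S]
    rw [this]
    exact isClosed_Ici.preimage (L b).continuous
  have hqc : Continuous q :=
    (locallyFinite_of_finite S).continuous (iUnion_eq_univ_iff.2 hcov) hclosed fun b =>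
      (s b).continuous.continuousOn.congr (hqs b)
  have hqPL : IsPL q := IsPL.glue S (fun b => s b) hcov (fun b Q hQ => hQ.inter_cone _ _)
    (fun b => isPL_linearMap ((s b).toLinearEquiv : Euc n →ₗ[ℝ] Euc n)) hqs
  have hqcl : IsClosedMap q := by
    intro B hB
    have : q '' B = ⋃ b, s b '' (B ∩ S b) := by
      ext y
      simp only [mem_iUnion]
      constructor
      · rintro ⟨x, hx, rfl⟩
        obtain ⟨b, hb⟩ := hcov x
        exact ⟨b, x, ⟨hx, hb⟩, (hqs b x hb).symm⟩
      · rintro ⟨b, x, ⟨hx, hb⟩, rfl⟩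
        exact ⟨x, hx, hqs b x hb⟩
    rw [this]
    exact isClosed_iUnion_of_finite fun b =>
      (s b).toHomeomorph.isClosedMap _ (hB.inter (hclosed b))
  refine ⟨q ∘ A, ⟨hqPL.comp (isPL_linearMap (A.toLinearEquiv : Euc n →ₗ[ℝ] Euc n)),
    hqc.comp A.continuous, hqcl.comp A.toHomeomorph.isClosedMap, fun x y => ?_⟩, ?_⟩
  · simp only [Function.comp]
    constructor
    · intro h
      have hxy : A x = A y ∨ reflectionAlong e (A x) = A y := by
        rcases hqor (A x) with h1 | h1 <;> rcases hqor (A y) with h2 | h2 <;> rw [h1, h2] at h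
        · exact Or.inl h
        · exact Or.inr (by rw [h, reflectionAlong_apply_self])
        · exact Or.inr h
        · exact Or.inl ((reflectionAlong e).injective h)
      rcases hxy with h | h
      · exact ⟨1, Subgroup.one_mem _, A.injective h⟩
      · refine ⟨_, Subgroup.mem_zpowers _, A.injective ?_⟩
        rw [hAτ, h]
    · rintro ⟨_, ⟨k, rfl⟩, rfl⟩
      have h1 : ∀ x, q (A (reflectionAlong v x)) = q (A x) := fun x => by rw [hAτ, hqr]
      rcases Int.even_or_odd' k with ⟨m, rfl | rfl⟩
      · simp only [zpow_mul, zpow_two, reflectionAlong_mul_self, one_zpow]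
        rfl
      · simp only [zpow_add, zpow_mul, zpow_two, reflectionAlong_mul_self, one_zpow, one_mul,
          zpow_one]
        exact (h1 x).symm
  · ext y
    rw [hhalf]
    constructor
    · rintro ⟨x, rfl⟩
      exact hqmem _
    · intro hy
      refine ⟨A⁻¹ y, ?_⟩
      have : A (A⁻¹ y) = y := A.apply_symm_apply y
      rw [Function.comp, this, hq1 y hy]

end Folding

/-! ### Generation by reflections and rotations -/

section Generation

variable {n : ℕ}

theorem IsReflectionGroup.isReflectionRotationGroup {W : Subgroup (O n)}
    (hW : IsReflectionGroup W) :
    IsReflectionRotationGroup W := by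
  refine ⟨hW.1, le_antisymm ?_ ((Subgroup.closure_le _).2 fun g hg => hg.1)⟩
  conv_lhs => rw [hW.2]
  exact Subgroup.closure_mono fun g hg => ⟨hg.1, Or.inl hg.2⟩

theorem IsReflectionGroup.orientationPreserving_eq {W : Subgroup (O n)} (hW : IsReflectionGroup W) :
    orientationPreserving W =
      Subgroup.closure {g | g ∈ orientationPreserving W ∧ IsRotation g} := by
  refine le_antisymm ?_ ((Subgroup.closure_le _).2 fun g hg => hg.1)
  set K := Subgroup.closure {g | g ∈ orientationPreserving W ∧ IsRotation g}
  have hmul : ∀ u v : Euc n, ‖u‖ = 1 → ‖v‖ = 1 → reflectionAlong u ∈ W → reflectionAlong v ∈ W →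
      reflectionAlong u * reflectionAlong v ∈ K := by
    intro u v hu hv huW hvW
    by_cases h : reflectionAlong u * reflectionAlong v = 1
    · rw [h]
      exact K.one_mem
    · refine Subgroup.subset_closure ⟨⟨W.mul_mem huW hvW, ?_⟩, isRotation_mul hu hv h⟩
      exact (isRotation_mul hu hv h).detHom_eq
  -- Reflections in a word are grouped in pairs, each product being trivial or a rotation. For odd
  -- words the invariant is that any further reflection of `W` brings them into `K`.
  have key : ∀ w ∈ W, (w ∈ K ∧ detHom n w = 1) ∨
      (detHom n w = -1 ∧ ∀ v : Euc n, ‖v‖ = 1 → reflectionAlong v ∈ W →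
        w * reflectionAlong v ∈ K) := by
    intro w hw
    rw [hW.2] at hw
    have step : ∀ (x : O n) (v : Euc n), ‖v‖ = 1 → reflectionAlong v ∈ W →
        ((x ∈ K ∧ detHom n x = 1) ∨ (detHom n x = -1 ∧ ∀ v : Euc n, ‖v‖ = 1 →
          reflectionAlong v ∈ W → x * reflectionAlong v ∈ K)) →
        ((x * reflectionAlong v ∈ K ∧ detHom n (x * reflectionAlong v) = 1) ∨
          (detHom n (x * reflectionAlong v) = -1 ∧ ∀ u : Euc n, ‖u‖ = 1 → reflectionAlong u ∈ W →
            x * reflectionAlong v * reflectionAlong u ∈ K)) := by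
      intro x v hv hvW hx
      rw [map_mul, detHom_reflectionAlong hv]
      rcases hx with ⟨h1, h2⟩ | ⟨h1, h2⟩
      · right
        refine ⟨by rw [h2]; norm_num, fun u hu huW => ?_⟩
        rw [mul_assoc]
        exact K.mul_mem h1 (hmul v u hv hu hvW huW)
      · left
        exact ⟨h2 v hv hvW, by rw [h1]; norm_num⟩
    induction hw using Subgroup.closure_induction_right with
    | one => exact Or.inl ⟨K.one_mem, map_one _⟩
    | mul_right x hx y hy ih =>
      obtain ⟨v, hv, rfl⟩ := isReflection_iff.1 hy.2
      exact step x v hv hy.1 ih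
    | mul_inv_cancel x hx y hy ih =>
      obtain ⟨v, hv, rfl⟩ := isReflection_iff.1 hy.2
      rw [reflectionAlong_inv]
      exact step x v hv hy.1 ih
  rintro w ⟨hw, hdet⟩
  rcases key w hw with h | h
  · exact h.1
  · have : (1 : ℝ) = -1 := Eq.trans (Eq.symm hdet) h.1
    norm_num at this

theorem IsReflectionGroup.isReflectionRotationGroup_orientationPreserving {W : Subgroup (O n)}
    (hW : IsReflectionGroup W) : IsReflectionRotationGroup (orientationPreserving W) := by
  have := hW.1
  refine ⟨Finite.of_injective _ (Subgroup.inclusion_injective (orientationPreserving_le W)),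
    le_antisymm ?_ ((Subgroup.closure_le _).2 fun g hg => hg.1)⟩
  conv_lhs => rw [hW.orientationPreserving_eq]
  exact Subgroup.closure_mono fun g hg => ⟨hg.1, Or.inr hg.2⟩

theorem le_extendBy (G : Subgroup (O n)) (h : O n) : G ≤ extendBy G h := fun _ hg =>
  Subgroup.subset_closure (Or.inl hg)

theorem mem_extendBy (G : Subgroup (O n)) (h : O n) : h ∈ extendBy G h :=
  Subgroup.subset_closure (Or.inr rfl)

theorem extendBy_le {G K : Subgroup (O n)} {h : O n} : extendBy G h ≤ K ↔ G ≤ K ∧ h ∈ K := by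
  rw [extendBy, Subgroup.closure_le, union_subset_iff, singleton_subset_iff]
  rfl

theorem IsReflectionRotationGroup.extendBy {G : Subgroup (O n)} {h : O n}
    (hG : IsReflectionRotationGroup G) (hh : IsRotation h) (hfin : Finite (extendBy G h)) :
    IsReflectionRotationGroup (PLQuot.extendBy G h) := by
  refine ⟨hfin, le_antisymm ?_ ((Subgroup.closure_le _).2 fun g hg => hg.1)⟩
  refine extendBy_le.2 ⟨?_, Subgroup.subset_closure ⟨mem_extendBy G h, Or.inr hh⟩⟩
  conv_lhs => rw [hG.2]
  exact Subgroup.closure_mono fun g hg => ⟨le_extendBy G h hg.1, hg.2⟩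

theorem detHom_eq_one_of_mem_extendBy {W : Subgroup (O n)} {h : O n} (hh : IsRotation h) {g : O n}
    (hg : g ∈ extendBy (orientationPreserving W) h) : detHom n g = 1 := by
  have hle : extendBy (orientationPreserving W) h ≤ (detHom n).ker :=
    extendBy_le.2 ⟨fun k hk => hk.2, hh.detHom_eq⟩
  exact hle hg

end Generation

/-! ### The main theorem for the groups attached to a reflection group -/

section Main

variable {n : ℕ}

theorem IsReflectionGroup.exists_isReflection {W : Subgroup (O n)} (hW : IsReflectionGroup W)
    (hne : W ≠ ⊥) : ∃ s ∈ W, IsReflection s := by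
  by_contra h
  refine hne (hW.2.trans ?_)
  rw [Subgroup.closure_eq_bot_iff]
  exact fun g hg => absurd ⟨g, hg⟩ h

/-- If an element acts on the model of `ℝ^n/H` as a reflection and `G` acts through the group it
generates, then `ℝ^n/G` is a half space. -/
theorem IsOrbitMap.mainTheoremHoldsFor_of_isReflection {H G : Subgroup (O n)} {F : Euc n → Euc n}
    {τ : O n} (hF : IsOrbitMap H F) (hsurj : Function.Surjective F) (hHG : H ≤ G)
    (hG : IsReflectionRotationGroup G) (hτ : IsReflection τ)
    (h1 : ∀ g ∈ G, ∃ k ∈ Subgroup.zpowers τ, ∀ x, F (g x) = k (F x))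
    (h2 : ∃ s ∈ G, IsReflection s ∧ ∀ x, F (s x) = τ (F x)) : MainTheoremHoldsFor G := by
  obtain ⟨Q, hQ, hr⟩ := exists_isOrbitMap_zpowers hτ
  obtain ⟨s, hs, hsr, hsτ⟩ := h2
  have h3 : ∀ k ∈ Subgroup.zpowers τ, ∃ g ∈ G, ∀ x, F (g x) = k (F x) := by
    intro k hk
    rw [Subgroup.zpowers_eq_closure] at hk
    induction hk using Subgroup.closure_induction with
    | mem k hk =>
      rw [mem_singleton_iff.1 hk]
      exact ⟨s, hs, hsτ⟩
    | one => exact ⟨1, G.one_mem, fun x => rfl⟩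
    | mul a b _ _ ha hb =>
      obtain ⟨g, hg, hga⟩ := ha
      obtain ⟨g', hg', hgb⟩ := hb
      exact ⟨g * g', G.mul_mem hg hg', fun x => (hga (g' x)).trans (congrArg a (hgb x))⟩
    | inv a _ ha =>
      obtain ⟨g, hg, hga⟩ := ha
      refine ⟨g⁻¹, G.inv_mem hg, fun x => a.injective ?_⟩
      have h4 : g (g⁻¹ x) = x := g.apply_symm_apply x
      have h5 : a (a⁻¹ (F x)) = F x := a.apply_symm_apply _
      rw [← hga, h4, h5]
  refine (hQ.comp hF hHG h1 h3).mainTheoremHoldsFor_of_halfSpace ?_ hG ⟨s, hs, hsr⟩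
  rw [hsurj.range_comp, hr]

theorem IsReflectionGroup.mainTheoremHoldsFor {W : Subgroup (O n)} (hW : IsReflectionGroup W) :
    MainTheoremHoldsFor W ∧ MainTheoremHoldsFor (orientationPreserving W) ∧
      PLLinearizationApplies (orientationPreserving W) W := by
  have := hW.1
  -- No adjacency of the chamber is needed here, so `γ = 1` will do.
  obtain ⟨F, r, σ, w, g, h⟩ := exists_isLinearization hW le_rfl Subgroup.le_normalizer W.one_mem
  have hplus : MainTheoremHoldsFor (orientationPreserving W) :=
    h.isOrbitMap.mainTheoremHoldsFor h.surjective.range_eq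
      hW.isReflectionRotationGroup_orientationPreserving
      (not_isReflection_of_le fun g hg => hg.2)
  refine ⟨?_, hplus, h.plLinearizationApplies⟩
  rcases eq_or_ne W ⊥ with hbot | hne
  · rwa [hbot, le_bot_iff.1 (orientationPreserving_le ⊥), ← hbot] at hplus
  · have hmap : ∀ k ∈ W, ∀ x, F (k x) = signed σ k (F x) := fun k hk x => by
      rw [← h.apply_of_mem ⟨k, hk⟩ hk]
      exact h.map_eq ⟨k, hk⟩ x
    refine h.isOrbitMap.mainTheoremHoldsFor_of_isReflection h.surjective
      (orientationPreserving_le W) hW.isReflectionRotationGroup (h.isReflection hne)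
      (fun k hk => ⟨signed σ k, ?_, hmap k hk⟩) ?_
    · rw [signed]
      split_ifs
      exacts [Subgroup.one_mem _, Subgroup.mem_zpowers _]
    · obtain ⟨s, hs, hsr⟩ := hW.exists_isReflection hne
      refine ⟨s, hs, hsr, fun x => ?_⟩
      rw [hmap s hs, signed_of_det_eq_neg_one _ hsr.detHom_eq]

theorem orientationPreserving_extendBy_le (W : Subgroup (O n)) (h : O n) :
    extendBy (orientationPreserving W) h ≤ extendBy W h :=
  extendBy_le.2 ⟨(orientationPreserving_le W).trans (le_extendBy W h), mem_extendBy W h⟩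

/-- The action of `⟨W, h⟩` on `ℝ^n/⟨W⁺, h⟩` is linearized by an orbit map. -/
theorem exists_linearization_extendBy {W : Subgroup (O n)} (hW : IsReflectionGroup W) {h : O n}
    (hh : IsRotation h) (hhW : h ∉ W) (hN : h ∈ Subgroup.normalizer (W : Set (O n)))
    [Finite (extendBy W h)] :
    ∃ (F : Euc n → Euc n) (r : extendBy W h →* O n) (τ : O n),
      IsOrbitMap (extendBy (orientationPreserving W) h) F ∧ Function.Surjective F ∧
      (∀ (k : extendBy W h) x, F ((k : O n) x) = r k (F x)) ∧
      r.ker = (extendBy (orientationPreserving W) h).subgroupOf (extendBy W h) ∧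
      (∀ k : extendBy W h, r k ∈ Subgroup.zpowers τ) ∧
      (W ≠ ⊥ → IsReflection τ ∧ ∃ s ∈ W, IsReflection s ∧ ∀ x, F (s x) = τ (F x)) := by
  obtain ⟨F, r, σ, w, g, hL⟩ := exists_isLinearization hW (le_extendBy W h)
    (extendBy_le.2 ⟨Subgroup.le_normalizer, hN⟩) (mem_extendBy W h)
  obtain ⟨u, v, hu, hv, hrh, hσ⟩ := hL.exists_apply_eq_mul hh hhW
  let h' : extendBy W h := ⟨h, mem_extendBy W h⟩
  have hrh' : r h' = reflectionAlong u * reflectionAlong v := hrh h' rfl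
  have hD : IsReflectionGroup (dihedral u v) := by
    refine isReflectionGroup_dihedral hu hv ?_
    rw [← hrh']
    -- Finiteness of the dihedral group comes from that of `⟨W, h⟩`: the product of its two
    -- reflections is `r h'`.
    exact r.isOfFinOrder (isOfFinOrder_of_finite h')
  have := hD.1
  have hσN := dihedral_mem_normalizer (u := u) (v := v) hσ
  have := finite_sup_zpowers hσN hL.sq_eq_one
  let G' : Subgroup (O n) := dihedral u v ⊔ Subgroup.zpowers σ
  have hσG : σ ∈ G' := Subgroup.mem_sup_right (Subgroup.mem_zpowers σ)
  -- The second linearization is taken with `γ = σ`, so that its chamber is adjacent to the fixed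
  -- space of `σ` and `r' σ` is again a reflection when `σ` is.
  obtain ⟨F', r', σ', w', g', hL'⟩ := exists_isLinearization hD (G := G') le_sup_left
    (sup_le Subgroup.le_normalizer ((Subgroup.zpowers_le).2 hσN)) hσG
  have hsigned : ∀ k, signed σ k = 1 ∨ signed σ k = σ := fun k => by
    rw [signed]
    split_ifs
    exacts [Or.inl rfl, Or.inr rfl]
  have hind : ∀ {p : extendBy W h → Prop}, (∀ k : extendBy W h, (k : O n) ∈ W → p k) → p h' →
      p 1 → (∀ a b, p a → p b → p (a * b)) → (∀ a, p a → p a⁻¹) → ∀ k, p k := by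
    rintro p h1 h2 h3 h4 h5 ⟨k, hk⟩
    refine Subgroup.closure_induction (p := fun k hk => p ⟨k, hk⟩) ?_ h3
      (fun a b ha hb => h4 ⟨a, ha⟩ ⟨b, hb⟩) (fun a ha => h5 ⟨a, ha⟩) hk
    rintro x (hx | rfl)
    exacts [h1 ⟨x, _⟩ hx, h2]
  have hrG : ∀ k, r k ∈ G' := by
    refine hind (fun k hk => ?_) ?_ ?_ (fun a b ha hb => ?_) (fun a ha => ?_)
    · rw [hL.apply_of_mem k hk]
      rcases hsigned k with h1 | h1 <;> rw [h1]
      exacts [G'.one_mem, hσG]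
    · rw [hrh']
      exact Subgroup.mem_sup_left (mul_mem_dihedral u v)
    · rw [map_one]
      exact G'.one_mem
    · rw [map_mul]
      exact G'.mul_mem ha hb
    · rw [map_inv]
      exact G'.inv_mem ha
  let R : extendBy W h →* O n := r'.comp (r.codRestrict G' hrG)
  have hDplus := orientationPreserving_dihedral hu hv
  have hker : ∀ k, R k = 1 ↔ r k ∈ Subgroup.zpowers (r h') := by
    intro k
    rw [hrh', ← hDplus, ← Subgroup.mem_subgroupOf (h := ⟨r k, hrG k⟩) (K := G'), ← hL'.ker_eq]
    rfl
  have hF : ∀ (k : extendBy W h) x, (F' ∘ F) ((k : O n) x) = R k ((F' ∘ F) x) := by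
    intro k x
    simp only [Function.comp]
    rw [hL.map_eq]
    exact hL'.map_eq ⟨r k, hrG k⟩ (F x)
  have hplus1 : ∀ k : extendBy W h, (k : O n) ∈ orientationPreserving W → r k = 1 := by
    intro k hk
    rwa [← MonoidHom.mem_ker, hL.ker_eq, Subgroup.mem_subgroupOf]
  -- `⟨W⁺, h⟩` is the full preimage under `r` of the powers of `r h'`, because `r` has kernel `W⁺`.
  -- With `hker` this identifies it as the kernel of `R`.
  have hplus : ∀ k : extendBy W h, (k : O n) ∈ extendBy (orientationPreserving W) h ↔
      r k ∈ Subgroup.zpowers (r h') := by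
    intro k
    constructor
    · intro hk
      have hle : extendBy (orientationPreserving W) h ≤
          ((Subgroup.zpowers (r h')).comap r).map (extendBy W h).subtype := by
        refine extendBy_le.2 ⟨fun x hx => ?_, ⟨h', Subgroup.mem_zpowers _, rfl⟩⟩
        refine ⟨⟨x, le_extendBy W h hx.1⟩, ?_, rfl⟩
        change r _ ∈ Subgroup.zpowers (r h')
        rw [hplus1 ⟨x, le_extendBy W h hx.1⟩ hx]
        exact Subgroup.one_mem _
      obtain ⟨y, hy, hyk⟩ := hle hk
      rwa [← Subtype.ext hyk]
    · rintro ⟨m, hm⟩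
      have h1 : k * (h' ^ m)⁻¹ ∈ r.ker := by
        rw [MonoidHom.mem_ker, map_mul, map_inv, map_zpow]
        exact mul_inv_eq_one.2 hm.symm
      rw [hL.ker_eq, Subgroup.mem_subgroupOf] at h1
      have h2 := Subgroup.mul_mem _ (le_extendBy _ h h1)
        (Subgroup.zpow_mem _ (mem_extendBy (orientationPreserving W) h) m)
      have h3 : ((k * (h' ^ m)⁻¹ : extendBy W h) : O n) * h ^ m = k := by
        simp [h']
      rwa [h3] at h2
  have hRσ : ∀ k : extendBy W h, r k = σ → R k = r' ⟨σ, hσG⟩ := fun k hk =>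
    congrArg r' (Subtype.ext hk)
  refine ⟨F' ∘ F, R, r' ⟨σ, hσG⟩, ?_, hL'.surjective.comp hL.surjective, hF, ?_, ?_, ?_⟩
  · refine hL'.isOrbitMap.comp hL.isOrbitMap (le_extendBy _ h) (fun k hk => ?_) ?_
    · have hk' := orientationPreserving_extendBy_le W h hk
      refine ⟨r ⟨k, hk'⟩, ?_, hL.map_eq ⟨k, hk'⟩⟩
      rw [hDplus, ← hrh']
      exact (hplus ⟨k, hk'⟩).1 hk
    · rw [hDplus, ← hrh']
      rintro _ ⟨m, rfl⟩
      refine ⟨h ^ m, Subgroup.zpow_mem _ (mem_extendBy _ h) m, fun x => ?_⟩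
      have := hL.map_eq (h' ^ m) x
      rwa [map_zpow] at this
  · ext k
    rw [MonoidHom.mem_ker, Subgroup.mem_subgroupOf, hker, hplus]
  -- On generators `R` is easy to read off: `h` goes to `1`, and elements of `W` go to `1` or to the
  -- image of `σ`.
  · refine hind (fun k hk => ?_) ?_ ?_ (fun a b ha hb => ?_) (fun a ha => ?_)
    · rcases hsigned k with h1 | h1 <;> rw [← hL.apply_of_mem k hk] at h1
      · rw [(hker k).2 (by rw [h1]; exact Subgroup.one_mem _)]
        exact Subgroup.one_mem _
      · rw [hRσ k h1]
        exact Subgroup.mem_zpowers _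
    · rw [(hker h').2 (Subgroup.mem_zpowers _)]
      exact Subgroup.one_mem _
    · rw [map_one]
      exact Subgroup.one_mem _
    · rw [map_mul]
      exact Subgroup.mul_mem _ ha hb
    · rw [map_inv]
      exact Subgroup.inv_mem _ ha
  · intro hne
    refine ⟨hL'.isReflection_apply (hL.isReflection hne) _ rfl, ?_⟩
    obtain ⟨s, hs, hsr⟩ := hW.exists_isReflection hne
    refine ⟨s, hs, hsr, fun x => ?_⟩
    rw [hF ⟨s, le_extendBy W h hs⟩ x, hRσ ⟨s, le_extendBy W h hs⟩ ((hL.apply_of_mem _ hs).trans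
      (signed_of_det_eq_neg_one σ hsr.detHom_eq))]

theorem IsReflectionGroup.mainTheoremHoldsFor_extendBy {W : Subgroup (O n)}
    (hW : IsReflectionGroup W) {h : O n} (hh : IsRotation h) (hhW : h ∉ W)
    (hN : h ∈ Subgroup.normalizer (W : Set (O n))) (hfin : Finite (extendBy W h)) :
    MainTheoremHoldsFor (extendBy (orientationPreserving W) h) ∧
    MainTheoremHoldsFor (extendBy W h) ∧
    PLLinearizationApplies (orientationPreserving W) (extendBy W h) ∧
    PLLinearizationApplies (extendBy (orientationPreserving W) h) (extendBy W h) := by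
  obtain ⟨F, r, τ, hF, hsurj, hmap, hker, hτ, hne⟩ := exists_linearization_extendBy hW hh hhW hN
  have hle := orientationPreserving_extendBy_le W h
  have hfin' : Finite (extendBy (orientationPreserving W) h) :=
    Finite.of_injective _ (Subgroup.inclusion_injective hle)
  have hplus : MainTheoremHoldsFor (extendBy (orientationPreserving W) h) :=
    hF.mainTheoremHoldsFor hsurj.range_eq
      (hW.isReflectionRotationGroup_orientationPreserving.extendBy hh hfin')
      (not_isReflection_of_le fun g hg => detHom_eq_one_of_mem_extendBy hh hg)
  refine ⟨hplus, ?_, ?_, hF.plLinearizationApplies hsurj.range_eq hle r hker hmap⟩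
  · rcases eq_or_ne W ⊥ with rfl | hbot
    -- For trivial `W` the two extensions coincide, and the quotient is `ℝ^n`, not a half space.
    · rwa [le_bot_iff.1 (orientationPreserving_le (⊥ : Subgroup (O n)))] at hplus
    · obtain ⟨h1, s, hs, hsr, hsτ⟩ := hne hbot
      exact hF.mainTheoremHoldsFor_of_isReflection hsurj hle
        (hW.isReflectionRotationGroup.extendBy hh hfin) h1
        (fun g hg => ⟨r ⟨g, hg⟩, hτ _, hmap ⟨g, hg⟩⟩) ⟨s, le_extendBy W h hs, hsr, hsτ⟩
  · obtain ⟨F, r, σ, w, g, hL⟩ := exists_isLinearization hW (le_extendBy W h)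
      (extendBy_le.2 ⟨Subgroup.le_normalizer, hN⟩) (mem_extendBy W h)
    exact hL.plLinearizationApplies

end Main

/-! ### The reflection groups of type `BC_n` and `D_n` -/

section SignedPermutations

variable {n : ℕ}

/-- The vectors `±e_i`. -/
def signedBasis (n : ℕ) : Set (Euc n) := {x | ∃ i, x = stdVec i ∨ x = -stdVec i}

theorem neg_mem_signedBasis {x : Euc n} (hx : x ∈ signedBasis n) : -x ∈ signedBasis n := by
  obtain ⟨i, rfl | rfl⟩ := hx
  exacts [⟨i, Or.inr rfl⟩, ⟨i, Or.inl (neg_neg _)⟩]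

theorem stdVec_mem_signedBasis (i : Fin n) : stdVec i ∈ signedBasis n := ⟨i, Or.inl rfl⟩

theorem inner_stdVec (i j : Fin n) : ⟪(stdVec i : Euc n), stdVec j⟫ = if i = j then 1 else 0 := by
  simp [stdVec, EuclideanSpace.inner_single_left]

theorem norm_signedBasis {x : Euc n} (hx : x ∈ signedBasis n) : ‖x‖ = 1 := by
  obtain ⟨i, rfl | rfl⟩ := hx <;> simp

theorem finite_signedBasis : (signedBasis n).Finite := by
  refine ((finite_range fun i : Fin n => (stdVec i : Euc n)).union
    (finite_range fun i : Fin n => -(stdVec i : Euc n))).subset ?_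
  rintro x ⟨i, rfl | rfl⟩
  exacts [Or.inl ⟨i, rfl⟩, Or.inr ⟨i, rfl⟩]

theorem eq_or_inner_eq_zero {x y : Euc n} (hx : x ∈ signedBasis n) (hy : y ∈ signedBasis n) :
    y = x ∨ y = -x ∨ ⟪x, y⟫ = 0 := by
  obtain ⟨i, hx⟩ := hx
  obtain ⟨j, hy⟩ := hy
  by_cases hij : i = j
  · subst hij
    rcases hx with rfl | rfl <;> rcases hy with rfl | rfl <;> simp
  · right; right
    rcases hx with rfl | rfl <;> rcases hy with rfl | rfl <;>
      simp [inner_neg_left, inner_neg_right, inner_stdVec, hij]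

/-- The reflection interchanges `a` and `b` and fixes the signed basis vectors orthogonal to both.
The choice `b = -a` covers the coordinate hyperplanes. -/
theorem reflectionAlong_sub_map_mem {a b x : Euc n} (ha : a ∈ signedBasis n)
    (hb : b ∈ signedBasis n) (hx : x ∈ signedBasis n) :
    reflectionAlong (a - b) x ∈ signedBasis n := by
  have h1 : reflectionAlong (a - b) a = b :=
    Submodule.reflection_sub ((norm_signedBasis ha).trans (norm_signedBasis hb).symm)
  have h2 : reflectionAlong (a - b) b = a :=
    (congrArg _ h1.symm).trans (reflectionAlong_apply_self (a - b) a)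
  rcases eq_or_inner_eq_zero ha hx with rfl | rfl | hax
  · rwa [h1]
  · rw [map_neg, h1]
    exact neg_mem_signedBasis hb
  rcases eq_or_inner_eq_zero hb hx with rfl | rfl | hbx
  · rwa [h2]
  · rw [map_neg, h2]
    exact neg_mem_signedBasis ha
  rwa [reflectionAlong_of_inner_eq_zero (by rw [inner_sub_left, hax, hbx, sub_zero])]

theorem reflectionAlong_sub_mem_weylD {a b : Euc n} (ha : a ∈ signedBasis n)
    (hb : b ∈ signedBasis n) (hab : ⟪a, b⟫ = 0) : reflectionAlong (a - b) ∈ weylD n := by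
  obtain ⟨i, ha⟩ := ha
  obtain ⟨j, hb⟩ := hb
  have hij : i ≠ j := by
    rintro rfl
    rcases ha with rfl | rfl <;> rcases hb with rfl | rfl <;>
      simp [inner_neg_left, inner_neg_right] at hab
  refine Subgroup.subset_closure ⟨i, j, hij, ?_⟩
  rcases ha with rfl | rfl <;> rcases hb with rfl | rfl
  · left; rfl
  · right; rw [sub_neg_eq_add]
  · right; rw [← reflectionAlong_neg, neg_sub, sub_neg_eq_add, add_comm]
  · left; rw [← reflectionAlong_neg, neg_sub, neg_sub_neg, ← neg_sub, reflectionAlong_neg]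

/-- Reading `e_i + e_j` as `e_i - (-e_j)` puts all generators into one form, which is stable under
signed permutations. -/
theorem exists_sub_of_weylD {g : O n} (hg : ∃ i j : Fin n, i ≠ j ∧
    (g = reflectionAlong (stdVec i - stdVec j) ∨ g = reflectionAlong (stdVec i + stdVec j))) :
    ∃ a ∈ signedBasis n, ∃ b ∈ signedBasis n, ⟪a, b⟫ = 0 ∧ g = reflectionAlong (a - b) := by
  obtain ⟨i, j, hij, rfl | rfl⟩ := hg
  · exact ⟨_, stdVec_mem_signedBasis i, _, stdVec_mem_signedBasis j, by
      rw [inner_stdVec, if_neg hij], rfl⟩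
  · exact ⟨_, stdVec_mem_signedBasis i, _, neg_mem_signedBasis (stdVec_mem_signedBasis j), by
      rw [inner_neg_right, inner_stdVec, if_neg hij, neg_zero], by rw [sub_neg_eq_add]⟩

theorem map_mem_signedBasis {g : O n} (hg : g ∈ weylBC n) {x : Euc n} (hx : x ∈ signedBasis n) :
    g x ∈ signedBasis n := by
  let K : Subgroup (O n) :=
    { carrier := {g | (∀ x ∈ signedBasis n, g x ∈ signedBasis n) ∧
        ∀ x ∈ signedBasis n, g⁻¹ x ∈ signedBasis n}
      one_mem' := ⟨fun _ h => h, fun _ h => h⟩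
      mul_mem' := fun {a b} ha hb => ⟨fun x hx => ha.1 _ (hb.1 x hx), fun x hx => by
        rw [mul_inv_rev]
        exact hb.2 _ (ha.2 x hx)⟩
      inv_mem' := fun {a} ha => ⟨ha.2, by rw [inv_inv]; exact ha.1⟩ }
  have hK : ∀ a ∈ signedBasis n, ∀ b ∈ signedBasis n, reflectionAlong (a - b) ∈ K := by
    intro a ha b hb
    refine ⟨fun x hx => reflectionAlong_sub_map_mem ha hb hx, ?_⟩
    rw [reflectionAlong_inv]
    exact fun x hx => reflectionAlong_sub_map_mem ha hb hx
  have hle : weylBC n ≤ K := by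
    rw [weylBC, Subgroup.closure_le, union_subset_iff]
    constructor
    · change weylD n ≤ K
      rw [weylD, Subgroup.closure_le]
      intro g hg
      obtain ⟨a, ha, b, hb, -, rfl⟩ := exists_sub_of_weylD hg
      exact hK a ha b hb
    · rintro _ ⟨i, rfl⟩
      have := hK _ (stdVec_mem_signedBasis i) _ (neg_mem_signedBasis (stdVec_mem_signedBasis i))
      rwa [sub_neg_eq_add, ← two_smul ℝ, reflectionAlong_smul two_ne_zero] at this
  exact (hle hg).1 x hx

/-- The group permutes the finite set of vectors `±e_i`, faithfully because they span. -/
theorem finite_weylBC (n : ℕ) : Finite (weylBC n) := by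
  have := (finite_signedBasis (n := n)).to_subtype
  refine Finite.of_injective (fun (g : weylBC n) (x : signedBasis n) =>
    (⟨(g : O n) x, map_mem_signedBasis g.2 x.2⟩ : signedBasis n)) fun g k h => Subtype.ext ?_
  have h1 : ((g : O n).toLinearEquiv : Euc n →ₗ[ℝ] Euc n) = (k : O n).toLinearEquiv := by
    refine (EuclideanSpace.basisFun (Fin n) ℝ).toBasis.ext fun i => ?_
    have := congrArg Subtype.val (congrFun h ⟨stdVec i, stdVec_mem_signedBasis i⟩)
    simpa using this
  ext1 x
  exact LinearMap.congr_fun h1 x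

theorem weylD_le_weylBC (n : ℕ) : weylD n ≤ weylBC n := fun _ hg =>
  Subgroup.subset_closure (Or.inl hg)

theorem isReflectionGroup_weylD (n : ℕ) : IsReflectionGroup (weylD n) := by
  have := finite_weylBC n
  refine ⟨Finite.of_injective _ (Subgroup.inclusion_injective (weylD_le_weylBC n)),
    le_antisymm ?_ ((Subgroup.closure_le _).2 fun g hg => hg.1)⟩
  conv_lhs => rw [weylD]
  refine Subgroup.closure_mono fun g hg => ⟨Subgroup.subset_closure hg, ?_⟩
  obtain ⟨a, ha, b, hb, hab, rfl⟩ := exists_sub_of_weylD hg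
  refine fixCodim_reflectionAlong (sub_ne_zero.2 ?_)
  rintro rfl
  rw [real_inner_self_eq_norm_sq, norm_signedBasis ha] at hab
  norm_num at hab

/-- Conjugating the reflection along `a - b` by `g` gives the one along `g a - g b`, and `g a`, `g
b` are again orthogonal signed basis vectors. -/
theorem weylBC_le_normalizer (n : ℕ) :
    weylBC n ≤ Subgroup.normalizer (weylD n : Set (O n)) := by
  rw [weylD, Subgroup.le_normalizer_closure_iff]
  intro g hg k hk
  obtain ⟨a, ha, b, hb, hab, rfl⟩ := exists_sub_of_weylD hk
  rw [mul_reflectionAlong_mul_inv, map_sub]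
  exact reflectionAlong_sub_mem_weylD (map_mem_signedBasis hg ha) (map_mem_signedBasis hg hb)
    (by rwa [g.inner_map_map])

/-- An instance of the general linearization for a finite group normalizing a reflection group. It
includes `n ≤ 1`, where `W(D_n)` is trivial. -/
theorem plLinearizationApplies_weylBC (n : ℕ) :
    PLLinearizationApplies (orientationPreserving (weylD n)) (weylBC n) := by
  have := finite_weylBC n
  obtain ⟨F, r, σ, w, g, h⟩ := exists_isLinearization (isReflectionGroup_weylD n)
    (weylD_le_weylBC n) (weylBC_le_normalizer n) (weylBC n).one_mem
  exact h.plLinearizationApplies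

end SignedPermutations

end PLQuot

end

open PLQuot
theorem mainTheorem6 :
    (∀ (n : ℕ) (W : Subgroup (O n)), IsReflectionGroup W →
      MainTheoremHoldsFor W ∧
      MainTheoremHoldsFor (orientationPreserving W) ∧
      PLLinearizationApplies (orientationPreserving W) W ∧
      ∀ h : O n, IsRotation h → h ∉ W → h ∈ Subgroup.normalizer (W : Set (O n)) →
        Finite (extendBy W h) →
          MainTheoremHoldsFor (extendBy (orientationPreserving W) h) ∧
          MainTheoremHoldsFor (extendBy W h) ∧
          PLLinearizationApplies (orientationPreserving W) (extendBy W h) ∧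
          PLLinearizationApplies (extendBy (orientationPreserving W) h) (extendBy W h)) ∧
    ∀ n : ℕ, PLLinearizationApplies (orientationPreserving (weylD n)) (weylBC n) := by
  refine ⟨fun n W hW => ?_, plLinearizationApplies_weylBC⟩
  obtain ⟨h1, h2, h3⟩ := hW.mainTheoremHoldsFor
  exact ⟨h1, h2, h3, fun h hh hhW hN hfin => hW.mainTheoremHoldsFor_extendBy hh hhW hN hfin⟩
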